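/- **Setting.** Words and addresses are natural numbers. A *concurrent program* for $n$ asynchronous processes gives each process a finite code. Each process has a program counter and a private RAM (direct and indirect addressing) and executes local instructions (constants, addition, truncated subtraction, multiplication, any further fixed set of binary word operations, conditional and computed jumps) and the atomic shared-memory instructions Read, Write and CAS. The processes start at location $0$ with private RAM $0$, on an arbitrary initial shared memory $m_0$. A process halts when its program counter leaves its code. In the *Parallel Persistent Memory (PPM) model*, $n$ asynchronous processes share an unbounded persistent memory accessed by atomic Reads, Writes and CASes on single words. Each process has a program counter, $v$ words of volatile memory, the same local operations and jumps, and an instruction $\mathtt{crashed}()$ that returns and resets a flag set by a crash. A process may crash at any time, independently of the others and any number of times. Its volatile memory then takes arbitrary values, the persistent memory is unchanged, and the process restarts: a fixed persistent location of the process (its restart pointer location) holds the address of a context, from which its program counter and the values of a fixed number of volatile words are reloaded. A *simulator* replaces every instruction $I$ of a process of a concurrent program $A$ by a block of instructions of the PPM model, which depends only on $I$, its location, the process, $n$ and the machine. All blocks have the same length, and one fixed position in a block is the capsule boundary; executing it completes the simulated instruction. The initial persistent memory does not depend on $A$; each of its cells contains a constant or a copy of a cell of $m_0$. The simulator fixes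 persistent addresses for the program counter and each private variable of each simulated process. A process is *idle* if it has taken no step since it completed its last simulated instruction (or since the start). **Theorem.** There is a universal constant $k$ such that for every set of local operations, every number $n$ of processes, every context size and every $v\ge k$, there is a simulator with blocks of length at most $k$ such that the following holds for every concurrent program $A$ that uses Reads, Writes and CASes and every $m_0$. Let $A'$ be the simulating program. 1. *(Correct simulation.)* Let $E$ be any finite execution of $A'$, with arbitrary crashes. One can assign to each event of $E$ a finite sequence of processes, saying whose simulated instruction takes effect at that event and in which order, such that after every prefix of $E$: the instructions that have taken effect so far, in this order, form an execution of $A$ on $m_0$; for each process, every completed instruction has taken effect exactly once, and at most one more instruction, the one being simulated, has taken effect; if the process is idle or has halted in $A'$, then only its completed instructions have taken effect and the fixed persistent addresses hold its local state in the execution of $A$; and if it has halted in $A'$, it has halted in $A$. 2. *(Constant computation delay.)* At any point of any execution, an idle process that from there takes $k$ steps without crashing, whatever the other processes do meanwhile, completes at least one simulated instruction. Moreover, local instructions are simulated locally: some of the persistent cells can be declared private to single processes so that no process accesses a cell private to another one, and in the block of a local instruction a process accesses only persistent cells private to itself. 3. *(Constant recovery delay.)* At whatever point of an execution a process crashes,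 once it has taken $k$ steps after the restart without crashing again, whatever the other processes do meanwhile, it has completed the simulated instruction in which it crashed. -/

import Mathlib

namespace PPM

/-! ### Instructions

Words and addresses are natural numbers.  The instructions below act on a program counter, on
private cells named by elements of `R`, and on a memory `ℕ → ℕ` shared by all processes. -/

/-- Local binary operations: basic arithmetic and any further operations `Op` of the machine. -/
inductive Alu (Op : Type) where
  | add
  | sub
  | mul
  | ext (o : Op)

def Alu.eval {Op : Type} (interp : Op → ℕ → ℕ → ℕ) : Alu Op → ℕ → ℕ → ℕ
  | .add, x, y => x + y
  | .sub, x, y => x - y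
  | .mul, x, y => x * y
  | .ext o, x, y => interp o x y

inductive Instr (Op R : Type) where
  /-- `d := c` -/
  | const (d : R) (c : ℕ)
  /-- `d := f a b` -/
  | alu (f : Alu Op) (d a b : R)
  /-- `if a = b then goto l` -/
  | jumpEq (a b : R) (l : ℕ)
  /-- `goto a` (computed jump) -/
  | jumpTo (a : R)
  /-- `d := Read (a)`, where `a` contains the address -/
  | read (d a : R)
  /-- `Write (a, b)` -/
  | write (a b : R)
  /-- `d := CAS (a, e, w)`: if memory cell `a` contains `e`, store `w` there and return `1`,
  else return `0`; this is one atomic instruction -/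
  | cas (d a e w : R)

/-- The state of one process: a program counter and private variables. -/
structure Proc (R : Type) where
  pc : ℕ
  vars : R → ℕ

/-- The effect of one atomic instruction on the executing process and on the shared memory. -/
def Instr.exec {Op R : Type} [DecidableEq R] (interp : Op → ℕ → ℕ → ℕ)
    (i : Instr Op R) (s : Proc R) (M : ℕ → ℕ) : Proc R × (ℕ → ℕ) :=
  match i with
  | .const d c => (⟨s.pc + 1, Function.update s.vars d c⟩, M)
  | .alu f d a b =>
      (⟨s.pc + 1, Function.update s.vars d (f.eval interp (s.vars a) (s.vars b))⟩, M)
  | .jumpEq a b l => (⟨if s.vars a = s.vars b then l else s.pc + 1, s.vars⟩, M)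
  | .jumpTo a => (⟨s.vars a, s.vars⟩, M)
  | .read d a => (⟨s.pc + 1, Function.update s.vars d (M (s.vars a))⟩, M)
  | .write a b => (⟨s.pc + 1, s.vars⟩, Function.update M (s.vars a) (s.vars b))
  | .cas d a e w =>
      if M (s.vars a) = s.vars e then
        (⟨s.pc + 1, Function.update s.vars d 1⟩, Function.update M (s.vars a) (s.vars w))
      else
        (⟨s.pc + 1, Function.update s.vars d 0⟩, M)

/-- The memory address that an instruction accesses, if it is a Read, a Write or a CAS. -/
def Instr.address {Op R : Type} (i : Instr Op R) (vars : R → ℕ) : Option ℕ :=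
  match i with
  | .read _ a => some (vars a)
  | .write a _ => some (vars a)
  | .cas _ a _ _ => some (vars a)
  | _ => none

/-- Is the instruction a local one, i.e. neither a Read nor a Write nor a CAS? -/
def Instr.isLocal {Op R : Type} : Instr Op R → Bool
  | .read _ _ => false
  | .write _ _ => false
  | .cas _ _ _ _ => false
  | _ => true

/-! ### Concurrent programs (the ordinary, crash-free model)

Each of `n` asynchronous processes has its own code and a private RAM with direct and indirect
addressing; the processes share a memory accessed by Read, Write and CAS. -/

inductive SrcInstr (Op : Type) where
  | base (i : Instr Op ℕ)
  /-- `vars[d] := vars[vars[a]]` -/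
  | load (d a : ℕ)
  /-- `vars[vars[a]] := vars[b]` -/
  | store (a b : ℕ)

def SrcInstr.exec {Op : Type} (interp : Op → ℕ → ℕ → ℕ)
    (i : SrcInstr Op) (s : Proc ℕ) (M : ℕ → ℕ) : Proc ℕ × (ℕ → ℕ) :=
  match i with
  | .base j => j.exec interp s M
  | .load d a => (⟨s.pc + 1, Function.update s.vars d (s.vars (s.vars a))⟩, M)
  | .store a b => (⟨s.pc + 1, Function.update s.vars (s.vars a) (s.vars b)⟩, M)

def SrcInstr.isLocal {Op : Type} : SrcInstr Op → Bool
  | .base j => j.isLocal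
  | .load _ _ => true
  | .store _ _ => true

/-- A concurrent program: a finite code for each of the `n` processes. -/
abbrev SrcProgram (Op : Type) (n : ℕ) := Fin n → List (SrcInstr Op)

structure SrcConfig (n : ℕ) where
  proc : Fin n → Proc ℕ
  mem : ℕ → ℕ

/-- All processes start at location `0` with private RAM `0`; the input is the shared memory. -/
def srcStart {n : ℕ} (m₀ : ℕ → ℕ) : SrcConfig n := ⟨fun _ => ⟨0, fun _ => 0⟩, m₀⟩

/-- A process has halted if its program counter is outside its code. -/
def SrcProgram.Halted {Op : Type} {n : ℕ} (A : SrcProgram Op n) (c : SrcConfig n)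
    (p : Fin n) : Prop :=
  (A p)[(c.proc p).pc]? = none

/-- Process `p` executes one instruction; impossible (`none`) if it has halted. -/
def SrcProgram.step {Op : Type} {n : ℕ} (interp : Op → ℕ → ℕ → ℕ) (A : SrcProgram Op n)
    (c : SrcConfig n) (p : Fin n) : Option (SrcConfig n) :=
  ((A p)[(c.proc p).pc]?).map fun i =>
    let r := i.exec interp (c.proc p) c.mem
    ⟨Function.update c.proc p r.1, r.2⟩

/-- The execution in which the processes execute their instructions in the given order. -/
def SrcProgram.run {Op : Type} {n : ℕ} (interp : Op → ℕ → ℕ → ℕ) (A : SrcProgram Op n)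
    (m₀ : ℕ → ℕ) (σ : List (Fin n)) : Option (SrcConfig n) :=
  σ.foldlM (A.step interp) (srcStart m₀)

/-! ### The Parallel Persistent Memory model

`n` asynchronous processes share an unbounded persistent memory.  Each process has a program
counter, `v` words of volatile memory and a hardware flag that tells whether it has crashed. -/

inductive PInstr (Op : Type) (v : ℕ) where
  | base (i : Instr Op (Fin v))
  /-- `d := crashed()`: return the crash flag (as `0` or `1`) and reset it -/
  | crashed (d : Fin v)

def PInstr.address {Op : Type} {v : ℕ} (i : PInstr Op v) (vars : Fin v → ℕ) : Option ℕ :=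
  match i with
  | .base j => j.address vars
  | .crashed _ => none

/-- A persistent program: a finite code for each process. -/
abbrev PProgram (Op : Type) (v n : ℕ) := Fin n → List (PInstr Op v)

structure PConfig (v n : ℕ) where
  proc : Fin n → Proc (Fin v)
  flag : Fin n → Bool
  mem : ℕ → ℕ

/-- An event is a step of one process, or a crash of one process followed by its restart; the
crash leaves arbitrary values `junk` in the volatile memory of that process. -/
inductive Event (v n : ℕ) where
  | step (p : Fin n)
  | crash (p : Fin n) (junk : Fin v → ℕ)

def Event.isStep {v n : ℕ} (p : Fin n) : Event v n → Bool
  | .step q => q = p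
  | .crash _ _ => false

def Event.isCrash {v n : ℕ} (p : Fin n) : Event v n → Bool
  | .step _ => false
  | .crash q _ => q = p

/-- The state in which a process restarts when the persistent memory is `M`.  Cell `p` of the
persistent memory is the restart pointer location of process `p`.  It contains the address of a
context: a program counter followed by the values of the first `ctx` volatile words. -/
def restart {v n : ℕ} (ctx : ℕ) (M : ℕ → ℕ) (p : Fin n) (junk : Fin v → ℕ) : Proc (Fin v) where
  pc := M (M p)
  vars := fun i => if (i : ℕ) < ctx then M (M p + 1 + i) else junk i

def PProgram.Halted {Op : Type} {v n : ℕ} (B : PProgram Op v n) (c : PConfig v n)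
    (p : Fin n) : Prop :=
  (B p)[(c.proc p).pc]? = none

/-- The effect of an event.  A process that has halted cannot take a step, but it can crash. -/
def PProgram.next {Op : Type} {v n : ℕ} (interp : Op → ℕ → ℕ → ℕ) (ctx : ℕ)
    (B : PProgram Op v n) (c : PConfig v n) : Event v n → Option (PConfig v n)
  | .step p => ((B p)[(c.proc p).pc]?).map fun
      | .base i =>
          let r := i.exec interp (c.proc p) c.mem
          ⟨Function.update c.proc p r.1, c.flag, r.2⟩
      | .crashed d =>
          let s := c.proc p
          ⟨Function.update c.proc p
              ⟨s.pc + 1, Function.update s.vars d (if c.flag p then 1 else 0)⟩,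
            Function.update c.flag p false, c.mem⟩
  | .crash p junk =>
      some ⟨Function.update c.proc p (restart ctx c.mem p junk),
        Function.update c.flag p true, c.mem⟩

/-! ### Simulators -/

/-- A simulator of concurrent programs with `n` processes by persistent programs.  It replaces
every instruction of the given program by a block of `blockLen` instructions.

* `block p s i` is the implementation of instruction `i` at location `s` of the code of `p`.
* `boundary` is the offset in each block of the instruction (the capsule boundary) whose
  execution completes the simulation of the current instruction.
* `initMem` describes the initial persistent memory: each cell contains a constant (`Sum.inl`) or
  a copy of a cell of the initial shared memory of the given program (`Sum.inr`).
* `pcAddr p` and `varAddr p j` are the addresses in persistent memory at which the simulated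
  program counter and the simulated private variable `j` of process `p` are to be found whenever
  `p` is between two simulated instructions.
* `owner` tells which persistent cells are private to which process (`none`: shared cells). -/
structure Simulator (Op : Type) (v n : ℕ) where
  blockLen : ℕ
  block : Fin n → ℕ → SrcInstr Op → List (PInstr Op v)
  length_block : ∀ p s i, (block p s i).length = blockLen
  boundary : ℕ
  initMem : ℕ → ℕ ⊕ ℕ
  pcAddr : Fin n → ℕ
  varAddr : Fin n → ℕ → ℕ
  owner : ℕ → Option (Fin n)

namespace Simulator

variable {Op : Type} {v n : ℕ}

/-- The simulating program: every instruction is replaced by its block. -/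
def translate (S : Simulator Op v n) (A : SrcProgram Op n) : PProgram Op v n :=
  fun p => ((A p).mapIdx fun s i => S.block p s i).flatten

/-- The initial configuration on input `m₀`; the volatile memories have arbitrary contents. -/
def start (S : Simulator Op v n) (m₀ : ℕ → ℕ) (junk : Fin n → Fin v → ℕ) : PConfig v n where
  proc := fun p => ⟨0, junk p⟩
  flag := fun _ => false
  mem := fun x => Sum.elim id m₀ (S.initMem x)

/-- A configuration with bookkeeping of the simulated instructions: how many instructions of `p`
have been completed so far, and whether `p` is between two simulated instructions, i.e. has taken
no step since it completed the last one (or since the start). -/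
structure Tracked (v n : ℕ) where
  config : PConfig v n
  completed : Fin n → ℕ
  idle : Fin n → Bool

/-- Is `p` about to execute a capsule boundary? -/
def AtBoundary (S : Simulator Op v n) (c : PConfig v n) (p : Fin n) : Prop :=
  (c.proc p).pc % S.blockLen = S.boundary

instance (S : Simulator Op v n) (c : PConfig v n) (p : Fin n) : Decidable (S.AtBoundary c p) :=
  inferInstanceAs (Decidable ((c.proc p).pc % S.blockLen = S.boundary))

def track (S : Simulator Op v n) (interp : Op → ℕ → ℕ → ℕ) (ctx : ℕ) (A : SrcProgram Op n)
    (x : Tracked v n) (e : Event v n) : Option (Tracked v n) :=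
  ((S.translate A).next interp ctx x.config e).map fun c =>
    match e with
    | .step p =>
        if S.AtBoundary x.config p then
          ⟨c, Function.update x.completed p (x.completed p + 1), Function.update x.idle p true⟩
        else
          ⟨c, x.completed, Function.update x.idle p false⟩
    | .crash _ _ => ⟨c, x.completed, x.idle⟩

/-- The execution of the simulating program with the given sequence of steps and crashes
(`none` if the sequence contains a step of a process that has halted). -/
def run (S : Simulator Op v n) (interp : Op → ℕ → ℕ → ℕ) (ctx : ℕ) (A : SrcProgram Op n)
    (m₀ : ℕ → ℕ) (junk : Fin n → Fin v → ℕ) (E : List (Event v n)) : Option (Tracked v n) :=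
  E.foldlM (S.track interp ctx A) ⟨S.start m₀ junk, fun _ => 0, fun _ => true⟩

/-- The persistent memory `M` stores the local state `s` of the simulated process `p`. -/
def Stores (S : Simulator Op v n) (M : ℕ → ℕ) (p : Fin n) (s : Proc ℕ) : Prop :=
  M (S.pcAddr p) = s.pc ∧ ∀ j, M (S.varAddr p j) = s.vars j

/-- Correctness of the simulation.  Every execution `E` of the simulating program, with arbitrary
crashes, maps to an execution of the original program: to each event of `E`, with index `t`, one
can attach the list `lin t` of the processes whose simulated instruction takes effect at that
event, in this order, such that the following holds after every prefix of `E`.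

* The instructions that have taken effect so far form an execution of the original program.
* Every completed instruction has taken effect exactly once, and besides these at most one
  further instruction of each process, the one it is currently simulating, has taken effect.
  In particular every instruction takes effect between the first step and the last step of its
  implementation.
* When a process is between two instructions, or has halted, its local state in the original
  execution is the one stored in persistent memory.
* A process of the simulating program halts only if the simulated process has halted. -/
def Simulates (S : Simulator Op v n) (interp : Op → ℕ → ℕ → ℕ) (ctx : ℕ) (A : SrcProgram Op n)
    (m₀ : ℕ → ℕ) : Prop :=
  ∀ (junk : Fin n → Fin v → ℕ) (E : List (Event v n)),
    (S.run interp ctx A m₀ junk E).isSome →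
    ∃ lin : ℕ → List (Fin n), ∀ t ≤ E.length, ∀ x,
      S.run interp ctx A m₀ junk (E.take t) = some x →
      ∃ c, A.run interp m₀ ((List.range t).flatMap lin) = some c ∧
        ∀ p : Fin n,
          let done := ((List.range t).flatMap lin).count p
          x.completed p ≤ done ∧ done ≤ x.completed p + 1 ∧
          (x.idle p = true ∨ (S.translate A).Halted x.config p →
            done = x.completed p ∧ S.Stores x.config.mem p (c.proc p)) ∧
          ((S.translate A).Halted x.config p → A.Halted c p)

/-- `k`-computation delay: a process that is between two simulated instructions and then takes
`k` steps without crashing (while the other processes do whatever they want) completes an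
instruction, i.e. every instruction is implemented in at most `k` steps. -/
def ComputationDelay (S : Simulator Op v n) (interp : Op → ℕ → ℕ → ℕ) (ctx : ℕ)
    (A : SrcProgram Op n) (m₀ : ℕ → ℕ) (k : ℕ) : Prop :=
  ∀ (junk : Fin n → Fin v → ℕ) (E F : List (Event v n)) (x y : Tracked v n) (p : Fin n),
    S.run interp ctx A m₀ junk E = some x →
    S.run interp ctx A m₀ junk (E ++ F) = some y →
    x.idle p = true → F.countP (Event.isCrash p) = 0 → k ≤ F.countP (Event.isStep p) →
    x.completed p < y.completed p

/-- Local instructions are simulated by local steps: no process accesses a persistent cell that is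
private to another one, and in the implementation of a local instruction a process accesses only
its own private persistent cells. -/
def PreservesLocality (S : Simulator Op v n) (interp : Op → ℕ → ℕ → ℕ) (ctx : ℕ)
    (A : SrcProgram Op n) (m₀ : ℕ → ℕ) : Prop :=
  ∀ (junk : Fin n → Fin v → ℕ) (E : List (Event v n)) (x : Tracked v n) (p : Fin n)
    (i : SrcInstr Op) (j : PInstr Op v) (a : ℕ),
    S.run interp ctx A m₀ junk E = some x →
    (A p)[(x.config.proc p).pc / S.blockLen]? = some i →
    (S.translate A p)[(x.config.proc p).pc]? = some j →
    j.address (x.config.proc p).vars = some a →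
    (∀ q, S.owner a = some q → q = p) ∧ (i.isLocal = true → S.owner a = some p)

/-- `k`-recovery delay: at whatever point a process crashes, once it has taken `k` steps after the
restart without crashing again it has gone past the point at which it crashed: it has completed
the instruction that it was simulating then (no completed instruction is ever repeated). -/
def RecoveryDelay (S : Simulator Op v n) (interp : Op → ℕ → ℕ → ℕ) (ctx : ℕ)
    (A : SrcProgram Op n) (m₀ : ℕ → ℕ) (k : ℕ) : Prop :=
  ∀ (junk : Fin n → Fin v → ℕ) (E F : List (Event v n)) (x y : Tracked v n) (p : Fin n)
    (junk' : Fin v → ℕ),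
    S.run interp ctx A m₀ junk E = some x →
    S.run interp ctx A m₀ junk (E ++ Event.crash p junk' :: F) = some y →
    F.countP (Event.isCrash p) = 0 → k ≤ F.countP (Event.isStep p) →
    x.completed p < y.completed p

end Simulator

end PPM

/-! Representation. A simulated cell is reached through two pointers: its persistent cell contains a
record `W`, the cell `W` contains a record `J`, and the value is stored next to `J`. A Write swings
the first pointer to a new record whose content is itself. A CAS that changes the value swings the
second pointer, the content of `W`. Each instruction of each process has its own record, so a record
that has been replaced never comes back: there is no ABA problem, and repeating a hardware CAS that
has succeeded does nothing.

Recovery. A block consists of three capsules, each of which reloads what it needs from private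
persistent cells and moves the restart location by a single write at its end. The first only reads
and prepares (its only shared writes go to a record nobody else can reach), the second contains the
single hardware CAS, the third copies the result to its destination and is idempotent. Local
instructions and Reads skip the second capsule. The one delicate question after a crash is whether a
CAS had succeeded. Every process sets the flag of the record it wants to replace before it tries to.
Hence a CAS with record `N` has succeeded iff `W` still contains `N` or the flag of `N` is set,
because the flag of an unpublished record is 0.

Linearization. Instructions may take effect in the past. A Write whose hardware CAS fails has seen a
record that another Write displaced, so it can be placed just before that Write, which hides it. A
CAS that succeeds inside a displaced record is placed there as well. A Read gets its value either
now or just before the displacing Write. A CAS whose hardware CAS fails has been overtaken by a CAS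
that changed the value to a different one, and can fail right after that one. This is why a CAS with
equal expected and new values is treated as a Read.

Formalization. A history interleaves the instructions that have taken effect with all states reached
so far; an instruction may be inserted anywhere after which its process is busy with it
(`Insertable`, `Open`, `Valid.insert`). A `World` couples the persistent memory with such a history
and satisfies `GI`. The argument is of rely-guarantee type: `Ext` is what a process may rely on,
`Step` what it guarantees, and the assertions along the code are `Stable`. The lemmas `commit_pos`,
`commit_masked`, `commit_write` and `commit_cas` are the four ways of taking effect. `Safe` counts
the remaining steps and requires at each point that a restart is possible; `T_block`, `T_mid_write`,
`T_mid_cas` and `T_fin` establish it at the restart locations. `Inv` collects this for all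
processes, and the final history yields the linearization. -/

namespace PPM

/-- The data of the machine, the simulated program and its input. -/
structure Setup where
  Op : Type
  interp : Op → ℕ → ℕ → ℕ
  v : ℕ
  ctx : ℕ
  n : ℕ
  hv : 16 ≤ v
  A : SrcProgram Op n
  m₀ : ℕ → ℕ

/-! ### Persistent addresses -/

/-- Cell `j` of the private persistent memory of process `p`. -/
def priv (n p j : ℕ) : ℕ := (n + 4) * j + p

/-- The persistent cell that represents the simulated shared cell `x`. -/
def objAddr (n x : ℕ) : ℕ := (n + 4) * x + n

/-- The record with index `r`; its value is in the next cell and its notification flag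
in the cell after that. -/
def recAddr (n r : ℕ) : ℕ := (n + 4) * r + (n + 1)

/-- The record that process `p` uses in its instruction number `m`. -/
def freshRec (n p m : ℕ) : ℕ := recAddr n ((n + 1) * m + p)

/-- The record that holds the initial value of the shared cell `x`. -/
def initRec (n x : ℕ) : ℕ := recAddr n ((n + 1) * x + n)

/-- The residue modulo `n + 4` sorts the addresses: one class for each process, then the simulated
cells, and one class for each of the three words of a record. -/
def ownerOf (n a : ℕ) : Option (Fin n) :=
  if h : a % (n + 4) < n then some ⟨a % (n + 4), h⟩ else none

/-- Private cell 0 points to the context in private cell 1, and private cell 3 names the next unused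
record. Every record starts with itself as content and flag 0; only the value words of the initial
records depend on the input. -/
def initCell (n a : ℕ) : ℕ ⊕ ℕ :=
  let c := a % (n + 4)
  let q := a / (n + 4)
  if c < n then
    (if q = 0 then .inl (priv n c 1) else if q = 3 then .inl (freshRec n c 0) else .inl 0)
  else if c = n then .inl (initRec n q)
  else if c = n + 1 then .inl a
  else if c = n + 2 then (if q % (n + 1) = n then .inr (q / (n + 1)) else .inl 0)
  else .inl 0

section Addresses

variable {n : ℕ}

lemma addr_mod (q c : ℕ) (hc : c < n + 4) : ((n + 4) * q + c) % (n + 4) = c := by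
  rw [Nat.mul_add_mod, Nat.mod_eq_of_lt hc]

lemma addr_div (q c : ℕ) (hc : c < n + 4) : ((n + 4) * q + c) / (n + 4) = q := by
  rw [Nat.mul_add_div (by omega), Nat.div_eq_of_lt hc, add_zero]

lemma addr_inj {q c q' c' : ℕ} (hc : c < n + 4) (hc' : c' < n + 4)
    (h : (n + 4) * q + c = (n + 4) * q' + c') : q = q' ∧ c = c' := by
  constructor
  · rw [← addr_div q c hc, h, addr_div q' c' hc']
  · rw [← addr_mod q c hc, h, addr_mod q' c' hc']

lemma ownerOf_priv (p : Fin n) (j : ℕ) : ownerOf n (priv n p j) = some p := by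
  have := p.isLt
  have h : priv n p j % (n + 4) = p := addr_mod _ _ (by omega)
  unfold ownerOf
  rw [dif_pos (by omega)]
  simp [h]

lemma ownerOf_shared (q c : ℕ) (h1 : n ≤ c) (h2 : c < n + 4) :
    ownerOf n ((n + 4) * q + c) = none := by
  unfold ownerOf
  rw [dif_neg]
  rw [addr_mod q c h2]; omega

lemma priv_inj {p q : Fin n} {i j : ℕ} (h : priv n p i = priv n q j) : p = q ∧ i = j := by
  have := p.isLt; have := q.isLt
  have := addr_inj (by omega) (by omega) h
  exact ⟨Fin.ext this.2, this.1⟩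

@[simp] lemma priv_inj_iff {p : Fin n} {i j : ℕ} : priv n p i = priv n p j ↔ i = j :=
  ⟨fun h => (priv_inj h).2, fun h => h ▸ rfl⟩

@[simp] lemma priv_zero (p : Fin n) : priv n p 0 = p := by simp [priv]

lemma objAddr_inj {x y : ℕ} (h : objAddr n x = objAddr n y) : x = y :=
  (addr_inj (by omega) (by omega) h).1

/-- The addresses that are used as names of records. -/
def IsRec (n I : ℕ) : Prop := ∃ r, I = recAddr n r

lemma isRec_freshRec (p m : ℕ) : IsRec n (freshRec n p m) := ⟨_, rfl⟩
lemma isRec_initRec (x : ℕ) : IsRec n (initRec n x) := ⟨_, rfl⟩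

/-- The record index modulo `n + 1` gives the process and the quotient gives the instruction number;
the residue `n` is left for the initial records. So no record is ever used twice. -/
lemma freshRec_inj {p q : Fin n} {m k : ℕ} (h : freshRec n p m = freshRec n q k) :
    p = q ∧ m = k := by
  have h1 := (addr_inj (by omega) (by omega) h).1
  have := p.isLt; have := q.isLt
  have hm := congrArg (· % (n + 1)) h1
  have hd := congrArg (· / (n + 1)) h1
  simp only [Nat.mul_add_mod] at hm
  simp only [Nat.mul_add_div (Nat.succ_pos n)] at hd
  rw [Nat.mod_eq_of_lt (by omega), Nat.mod_eq_of_lt (by omega)] at hm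
  rw [Nat.div_eq_of_lt (by omega), Nat.div_eq_of_lt (by omega)] at hd
  exact ⟨Fin.ext hm, by simpa using hd⟩

lemma freshRec_ne_initRec {p : Fin n} {m x : ℕ} : freshRec n p m ≠ initRec n x := by
  intro h
  have h1 := (addr_inj (by omega) (by omega) h).1
  have := p.isLt
  have hm := congrArg (· % (n + 1)) h1
  simp only [Nat.mul_add_mod] at hm
  rw [Nat.mod_eq_of_lt (by omega), Nat.mod_eq_of_lt (by omega)] at hm
  omega

lemma initRec_inj {x y : ℕ} (h : initRec n x = initRec n y) : x = y := by
  have h1 := (addr_inj (by omega) (by omega) h).1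
  have : (n + 1) * x = (n + 1) * y := by omega
  exact Nat.eq_of_mul_eq_mul_left (Nat.succ_pos n) this

/-- Advancing to the next record is the addition of a constant, so processes allocate records
without communication. -/
lemma freshRec_succ (p m : ℕ) :
    freshRec n p m + (n + 4) * (n + 1) = freshRec n p (m + 1) := by
  simp only [freshRec, recAddr]; ring

lemma priv_ne_objAddr (p : Fin n) (j x : ℕ) : priv n p j ≠ objAddr n x := by
  intro h
  have := p.isLt
  have := (addr_inj (by omega) (by omega) h).2
  omega

lemma priv_ne_rec (p : Fin n) (j : ℕ) {I : ℕ} (hI : IsRec n I) (e : ℕ) (he : e < 3) :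
    priv n p j ≠ I + e := by
  obtain ⟨r, rfl⟩ := hI
  intro h
  have := p.isLt
  have := (addr_inj (q := j) (c := p) (q' := r) (c' := n + 1 + e) (n := n) (by omega) (by omega)
    (by simp only [priv, recAddr] at h; omega)).2
  omega

lemma objAddr_ne_rec (x : ℕ) {I : ℕ} (hI : IsRec n I) (e : ℕ) (he : e < 3) :
    objAddr n x ≠ I + e := by
  obtain ⟨r, rfl⟩ := hI
  intro h
  have := (addr_inj (q := x) (c := n) (q' := r) (c' := n + 1 + e) (n := n) (by omega) (by omega)
    (by simp only [objAddr, recAddr] at h; omega)).2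
  omega

lemma rec_inj {I J : ℕ} (hI : IsRec n I) (hJ : IsRec n J) {e f : ℕ} (he : e < 3) (hf : f < 3)
    (h : I + e = J + f) : I = J ∧ e = f := by
  obtain ⟨r, rfl⟩ := hI
  obtain ⟨s, rfl⟩ := hJ
  have := addr_inj (q := r) (q' := s) (c := n + 1 + e) (c' := n + 1 + f) (n := n) (by omega) (by omega)
    (by simp only [recAddr] at h; omega)
  exact ⟨by rw [this.1], by omega⟩

lemma ownerOf_objAddr (x : ℕ) : ownerOf n (objAddr n x) = none :=
  ownerOf_shared _ _ le_rfl (by omega)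

lemma ownerOf_rec {I : ℕ} (hI : IsRec n I) (e : ℕ) (he : e < 3) : ownerOf n (I + e) = none := by
  obtain ⟨r, rfl⟩ := hI
  have := ownerOf_shared (n := n) r (n + 1 + e) (by omega) (by omega)
  simpa [recAddr, add_assoc] using this

lemma initCell_priv (p : Fin n) (j : ℕ) : initCell n (priv n p j) =
    if j = 0 then .inl (priv n p 1) else if j = 3 then .inl (freshRec n p 0) else .inl 0 := by
  have := p.isLt
  have h1 : priv n p j % (n + 4) = p := addr_mod _ _ (by omega)
  have h2 : priv n p j / (n + 4) = j := addr_div _ _ (by omega)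
  simp [initCell, h1, h2]

lemma initCell_objAddr (x : ℕ) : initCell n (objAddr n x) = .inl (initRec n x) := by
  have h1 : objAddr n x % (n + 4) = n := addr_mod _ _ (by omega)
  have h2 : objAddr n x / (n + 4) = x := addr_div _ _ (by omega)
  simp [initCell, h1, h2]

lemma initCell_rec {I : ℕ} (hI : IsRec n I) : initCell n I = .inl I := by
  obtain ⟨r, rfl⟩ := hI
  have h1 : recAddr n r % (n + 4) = n + 1 := addr_mod _ _ (by omega)
  simp [initCell, h1]

lemma initCell_initRec_val (x : ℕ) : initCell n (initRec n x + 1) = .inr x := by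
  have e : initRec n x + 1 = (n + 4) * ((n + 1) * x + n) + (n + 2) := by
    simp only [initRec, recAddr]; ring
  have h1 : (initRec n x + 1) % (n + 4) = n + 2 := by rw [e]; exact addr_mod _ _ (by omega)
  have h2 : (initRec n x + 1) / (n + 4) = (n + 1) * x + n := by
    rw [e]; exact addr_div _ _ (by omega)
  have h3 : ((n + 1) * x + n) % (n + 1) = n := by
    rw [Nat.mul_add_mod, Nat.mod_eq_of_lt (by omega)]
  have h4 : ((n + 1) * x + n) / (n + 1) = x := by
    rw [Nat.mul_add_div (Nat.succ_pos n), Nat.div_eq_of_lt (by omega), add_zero]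
  simp [initCell, h1, h2, h3, h4]

lemma initCell_rec_flag {I : ℕ} (hI : IsRec n I) : initCell n (I + 2) = .inl 0 := by
  obtain ⟨r, rfl⟩ := hI
  have h1 : (recAddr n r + 2) % (n + 4) = n + 3 := addr_mod r (n + 3) (by omega)
  simp [initCell, h1]

end Addresses

/-! ### The simulating code -/

section Code

variable {Op : Type} {v : ℕ} (hv : 16 ≤ v) (n p s : ℕ)

def reg (i : Fin 16) : Fin v := Fin.castLE hv i

/-- `d := c` -/
def kst (d : Fin 16) (c : ℕ) : PInstr Op v := .base (.const (reg hv d) c)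
/-- `d := a + b` -/
def addi (d a b : Fin 16) : PInstr Op v := .base (.alu .add (reg hv d) (reg hv a) (reg hv b))
/-- `d := a * b` -/
def muli (d a b : Fin 16) : PInstr Op v := .base (.alu .mul (reg hv d) (reg hv a) (reg hv b))
def rd (d a : Fin 16) : PInstr Op v := .base (.read (reg hv d) (reg hv a))
def wr (a b : Fin 16) : PInstr Op v := .base (.write (reg hv a) (reg hv b))
def jeq (a b : Fin 16) (l : ℕ) : PInstr Op v := .base (.jumpEq (reg hv a) (reg hv b) l)
def jto (a : Fin 16) : PInstr Op v := .base (.jumpTo (reg hv a))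

/-- The code of the first capsule, which depends on the simulated instruction. -/
def prefixCode : SrcInstr Op → List (PInstr Op v)
  | .base (.const d c) =>
      [kst hv 1 c, kst hv 2 (priv n p (11 + d)), kst hv 3 (s + 1), kst hv 4 (s * 89 + 69),
        jeq hv 0 0 (s * 89 + 36)]
  | .base (.alu f d a b) =>
      [kst hv 0 (priv n p (11 + a)), rd hv 1 0, kst hv 0 (priv n p (11 + b)), rd hv 5 0,
        .base (.alu f (reg hv 1) (reg hv 1) (reg hv 5)),
        kst hv 2 (priv n p (11 + d)), kst hv 3 (s + 1), kst hv 4 (s * 89 + 69),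
        jeq hv 0 0 (s * 89 + 36)]
  | .base (.jumpEq a b l) =>
      [kst hv 0 (priv n p (11 + a)), rd hv 1 0, kst hv 0 (priv n p (11 + b)), rd hv 5 0,
        kst hv 2 (priv n p 10), kst hv 4 (s * 89 + 69), kst hv 3 l,
        jeq hv 1 5 (s * 89 + 36), kst hv 3 (s + 1), jeq hv 0 0 (s * 89 + 36)]
  | .base (.jumpTo a) =>
      [kst hv 0 (priv n p (11 + a)), rd hv 3 0, kst hv 2 (priv n p 10), kst hv 4 (s * 89 + 69),
        jeq hv 0 0 (s * 89 + 36)]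
  | .load d a =>
      [kst hv 0 (priv n p (11 + a)), rd hv 1 0, kst hv 5 (n + 4), muli hv 1 1 5,
        kst hv 5 (priv n p 11), addi hv 1 1 5, rd hv 1 1,
        kst hv 2 (priv n p (11 + d)), kst hv 3 (s + 1), kst hv 4 (s * 89 + 69),
        jeq hv 0 0 (s * 89 + 36)]
  | .store a b =>
      [kst hv 0 (priv n p (11 + b)), rd hv 1 0, kst hv 0 (priv n p (11 + a)), rd hv 2 0,
        kst hv 5 (n + 4), muli hv 2 2 5, kst hv 5 (priv n p 11), addi hv 2 2 5,
        kst hv 3 (s + 1), kst hv 4 (s * 89 + 69), jeq hv 0 0 (s * 89 + 36)]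
  | .base (.read d a) =>
      [kst hv 0 (priv n p (11 + a)), rd hv 1 0, kst hv 5 (n + 4), muli hv 1 1 5,
        kst hv 5 n, addi hv 1 1 5, rd hv 1 1, rd hv 1 1, kst hv 5 1, addi hv 1 1 5, rd hv 1 1,
        kst hv 2 (priv n p (11 + d)), kst hv 3 (s + 1), kst hv 4 (s * 89 + 69),
        jeq hv 0 0 (s * 89 + 36)]
  | .base (.write a b) =>
      [kst hv 0 (priv n p 3), rd hv 8 0, wr hv 8 8,
        kst hv 0 (priv n p (11 + b)), rd hv 1 0, kst hv 5 1, addi hv 5 8 5, wr hv 5 1,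
        kst hv 0 (priv n p (11 + a)), rd hv 6 0, kst hv 5 (n + 4), muli hv 6 6 5,
        kst hv 5 n, addi hv 6 6 5, rd hv 7 6,
        kst hv 0 (priv n p 8), wr hv 0 6, kst hv 0 (priv n p 9), wr hv 0 7,
        kst hv 2 (priv n p 10), kst hv 3 (s + 1), kst hv 4 (s * 89 + 49),
        jeq hv 0 0 (s * 89 + 36)]
  | .base (.cas d a e w) =>
      [kst hv 0 (priv n p 3), rd hv 8 0,
        kst hv 0 (priv n p (11 + w)), rd hv 10 0, kst hv 5 1, addi hv 5 8 5, wr hv 5 10,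
        kst hv 0 (priv n p (11 + a)), rd hv 6 0, kst hv 5 (n + 4), muli hv 6 6 5,
        kst hv 5 n, addi hv 6 6 5, rd hv 6 6,
        kst hv 0 (priv n p (11 + e)), rd hv 9 0,
        kst hv 2 (priv n p (11 + d)), kst hv 3 (s + 1), kst hv 4 (s * 89 + 69),
        rd hv 7 6, kst hv 5 1, addi hv 5 7 5, rd hv 5 5,
        kst hv 1 0, jeq hv 5 9 (s * 89 + 26), jeq hv 0 0 (s * 89 + 36),
        kst hv 1 1, jeq hv 9 10 (s * 89 + 36),
        kst hv 0 (priv n p 8), wr hv 0 6, kst hv 0 (priv n p 9), wr hv 0 7,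
        kst hv 4 (s * 89 + 49), jeq hv 0 0 (s * 89 + 36)]

/-- The common part of all blocks. -/
def suffixCode : List (PInstr Op v) :=
  -- Offset 36, end of the first capsule. The private cells 4 to 7 receive the result, the address
  -- of its destination, the new program counter and the record of this instruction; cells 8 and 9
  -- hold the operands of the second capsule, cell 10 is a dummy destination and the variables start
  -- at cell 11. Register 4 is the restart location of the following capsule.
  [kst hv 0 (priv n p 3), rd hv 8 0, kst hv 0 (priv n p 4), wr hv 0 1,
    kst hv 0 (priv n p 5), wr hv 0 2, kst hv 0 (priv n p 6), wr hv 0 3,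
    kst hv 0 (priv n p 7), wr hv 0 8, kst hv 0 (priv n p 1), wr hv 0 4, jto hv 4,
    -- Offset 49, second capsule: set the flag of the record to be replaced, try the CAS, then
    -- determine its outcome from the cell or, failing that, from the flag of the own record. The
    -- value returned by the hardware CAS is ignored, since it could be lost in a crash.
    kst hv 0 (priv n p 7), rd hv 8 0, kst hv 0 (priv n p 8), rd hv 6 0,
    kst hv 0 (priv n p 9), rd hv 7 0, kst hv 5 2, addi hv 9 7 5, kst hv 10 1, wr hv 9 10,
    .base (.cas (reg hv 11) (reg hv 6) (reg hv 7) (reg hv 8)), rd hv 9 6,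
    jeq hv 9 8 (s * 89 + 64), addi hv 9 8 5, rd hv 10 9,
    kst hv 0 (priv n p 4), wr hv 0 10, kst hv 4 (s * 89 + 69), kst hv 0 (priv n p 1), wr hv 0 4,
    -- Offset 69, third capsule.
    kst hv 0 (priv n p 5), rd hv 1 0, kst hv 0 (priv n p 4), rd hv 2 0, wr hv 1 2,
    kst hv 0 (priv n p 6), rd hv 3 0, kst hv 0 (priv n p 2), wr hv 0 3,
    kst hv 0 (priv n p 7), rd hv 8 0, kst hv 5 ((n + 4) * (n + 1)), addi hv 8 8 5,
    kst hv 0 (priv n p 3), wr hv 0 8, kst hv 5 89, muli hv 3 3 5,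
    kst hv 0 (priv n p 1), wr hv 0 3, jto hv 3]

def blockCode (i : SrcInstr Op) : List (PInstr Op v) :=
  -- The padding is never executed: each prefix ends with an unconditional jump to offset 36. It
  -- puts the common part at the same offset in all blocks.
  prefixCode hv n p s i ++ (List.replicate (36 - (prefixCode hv n p s i).length) (kst hv 0 0) ++
    suffixCode hv n p s)

lemma length_blockCode (i : SrcInstr Op) : (blockCode hv n p s i).length = 89 := by
  rcases i with i | _ | _
  · cases i <;> rfl
  all_goals rfl

end Code

/-- The simulator. -/
def sim (Op : Type) {v : ℕ} (hv : 16 ≤ v) (n : ℕ) : Simulator Op v n where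
  blockLen := 89
  block p s i := blockCode hv n p s i
  length_block p s i := length_blockCode hv n p s i
  boundary := 87
  initMem := initCell n
  pcAddr p := priv n p 2
  varAddr p j := priv n p (11 + j)
  owner := ownerOf n

lemma getElem?_flatten_of_length {α : Type*} (B : ℕ) :
    ∀ (L : List (List α)), (∀ l ∈ L, l.length = B) → ∀ (s j : ℕ), j < B →
      L.flatten[s * B + j]? = (L[s]?).bind (fun l => l[j]?)
  | [], _, s, j, _ => by simp
  | l :: L, h, 0, j, hj => by
      have : l.length = B := h l (by simp)
      simp only [List.flatten_cons, Nat.zero_mul, Nat.zero_add]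
      rw [List.getElem?_append_left (by omega)]
      simp
  | l :: L, h, s + 1, j, hj => by
      have hl : l.length = B := h l (by simp)
      have ih := getElem?_flatten_of_length B L (fun l' hl' => h l' (by simp [hl'])) s j hj
      simp only [List.flatten_cons]
      rw [List.getElem?_append_right (by rw [hl]; nlinarith)]
      rw [show (s + 1) * B + j - l.length = s * B + j by rw [hl, Nat.succ_mul]; omega, ih]
      simp

namespace Setup

variable (Z : Setup)

def S : Simulator Z.Op Z.v Z.n := sim Z.Op Z.hv Z.n

lemma translate_getElem? (p : Fin Z.n) (s j : ℕ) (hj : j < 89) :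
    (Z.S.translate Z.A p)[s * 89 + j]? =
      ((Z.A p)[s]?).bind fun i => (blockCode Z.hv Z.n p s i)[j]? := by
  unfold Simulator.translate
  rw [getElem?_flatten_of_length 89 _ _ s j hj]
  · rw [List.getElem?_mapIdx]
    cases (Z.A p)[s]? <;> rfl
  · intro l hl
    obtain ⟨i, hi, rfl⟩ := List.mem_mapIdx.mp hl
    exact length_blockCode _ _ _ _ _

lemma translate_getElem?_some {p : Fin Z.n} {s j : ℕ} {i : SrcInstr Z.Op}
    (hi : (Z.A p)[s]? = some i) (hj : j < 89) :
    (Z.S.translate Z.A p)[s * 89 + j]? = (blockCode Z.hv Z.n p s i)[j]? := by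
  rw [translate_getElem? Z p s j hj, hi]; rfl

lemma translate_isSome {p : Fin Z.n} {s j : ℕ} {i : SrcInstr Z.Op}
    (hi : (Z.A p)[s]? = some i) (hj : j < 89) :
    (Z.S.translate Z.A p)[s * 89 + j]? ≠ none := by
  rw [translate_getElem?_some Z hi hj]
  have := length_blockCode Z.hv Z.n p s i
  simp only [ne_eq, List.getElem?_eq_none_iff, not_le]
  omega

end Setup

end PPM

namespace PPM

/-! ### Histories -/

/-- A history interleaves the instructions of the simulated program (an instruction may be tagged
with the record that it displaces) and the states of the simulating program. -/
inductive Lbl (v n : ℕ) where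
  | op (p : Fin n) (tag : Option ℕ)
  | snap (x : Simulator.Tracked v n)

section Lists

variable {v n : ℕ}

def ops : List (Lbl v n) → List (Fin n)
  | [] => []
  | .op p _ :: H => p :: ops H
  | .snap _ :: H => ops H

def snaps : List (Lbl v n) → List (Simulator.Tracked v n)
  | [] => []
  | .op _ _ :: H => snaps H
  | .snap x :: H => x :: snaps H

@[simp] lemma ops_nil : ops ([] : List (Lbl v n)) = [] := rfl
@[simp] lemma ops_cons_op (p : Fin n) (t : Option ℕ) (H : List (Lbl v n)) :
    ops (.op p t :: H) = p :: ops H := rfl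
@[simp] lemma ops_cons_snap (x : Simulator.Tracked v n) (H : List (Lbl v n)) :
    ops (.snap x :: H) = ops H := rfl
@[simp] lemma ops_append (H K : List (Lbl v n)) : ops (H ++ K) = ops H ++ ops K := by
  induction H with
  | nil => rfl
  | cons l H ih => cases l <;> simp [ih]
@[simp] lemma snaps_nil : snaps ([] : List (Lbl v n)) = [] := rfl
@[simp] lemma snaps_cons_op (p : Fin n) (t : Option ℕ) (H : List (Lbl v n)) :
    snaps (.op p t :: H) = snaps H := rfl
@[simp] lemma snaps_cons_snap (x : Simulator.Tracked v n) (H : List (Lbl v n)) :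
    snaps (.snap x :: H) = x :: snaps H := rfl
@[simp] lemma snaps_append (H K : List (Lbl v n)) : snaps (H ++ K) = snaps H ++ snaps K := by
  induction H with
  | nil => rfl
  | cons l H ih => cases l <;> simp [ih]

end Lists

namespace Setup

variable (Z : Setup)

abbrev Hist := List (Lbl Z.v Z.n)
abbrev Trk := Simulator.Tracked Z.v Z.n

def srcStep (c : SrcConfig Z.n) (p : Fin Z.n) : Option (SrcConfig Z.n) := Z.A.step Z.interp c p

def runFrom (c : SrcConfig Z.n) (H : Z.Hist) : Option (SrcConfig Z.n) :=
  (ops H).foldlM Z.srcStep c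

/-- The configuration of the simulated program after a history. -/
def cfg (H : Z.Hist) : Option (SrcConfig Z.n) := Z.runFrom (srcStart Z.m₀) H

lemma runFrom_append (c : SrcConfig Z.n) (H K : Z.Hist) :
    Z.runFrom c (H ++ K) = (Z.runFrom c H).bind fun c' => Z.runFrom c' K := by
  simp [runFrom, List.foldlM_append]

lemma cfg_append (H K : Z.Hist) : Z.cfg (H ++ K) = (Z.cfg H).bind fun c' => Z.runFrom c' K :=
  Z.runFrom_append _ H K

@[simp] lemma runFrom_nil (c : SrcConfig Z.n) : Z.runFrom c [] = some c := rfl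
@[simp] lemma runFrom_cons_snap (c : SrcConfig Z.n) (x : Z.Trk) (H : Z.Hist) :
    Z.runFrom c (.snap x :: H) = Z.runFrom c H := rfl
@[simp] lemma runFrom_cons_op (c : SrcConfig Z.n) (p : Fin Z.n) (t : Option ℕ) (H : Z.Hist) :
    Z.runFrom c (.op p t :: H) = (Z.srcStep c p).bind fun c' => Z.runFrom c' H := by
  simp [runFrom, List.foldlM_cons]

lemma srcStep_eq_some {c c' : SrcConfig Z.n} {p : Fin Z.n} (h : Z.srcStep c p = some c') :
    ∃ i, (Z.A p)[(c.proc p).pc]? = some i ∧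
      c' = ⟨Function.update c.proc p (i.exec Z.interp (c.proc p) c.mem).1,
        (i.exec Z.interp (c.proc p) c.mem).2⟩ := by
  simp only [srcStep, SrcProgram.step, Option.map_eq_some_iff] at h
  obtain ⟨i, hi, rfl⟩ := h
  exact ⟨i, hi, rfl⟩

lemma srcStep_of_getElem? {c : SrcConfig Z.n} {p : Fin Z.n} {i : SrcInstr Z.Op}
    (hi : (Z.A p)[(c.proc p).pc]? = some i) :
    Z.srcStep c p = some ⟨Function.update c.proc p (i.exec Z.interp (c.proc p) c.mem).1,
        (i.exec Z.interp (c.proc p) c.mem).2⟩ := by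
  simp [srcStep, SrcProgram.step, hi]

/-- Configurations that differ only in the local state of `p`, which is `s` in the second one. -/
def Differ (p : Fin Z.n) (s : Proc ℕ) (c c' : SrcConfig Z.n) : Prop :=
  c'.proc = Function.update c.proc p s ∧ c'.mem = c.mem

/-- The private state of `p` is accessed only by `p`, so the other processes cannot tell the two
configurations apart. -/
lemma Differ.step {p q : Fin Z.n} {s : Proc ℕ} {c c' c1 : SrcConfig Z.n} (h : Z.Differ p s c c')
    (hq : q ≠ p) (h1 : Z.srcStep c q = some c1) :
    ∃ c1', Z.srcStep c' q = some c1' ∧ Z.Differ p s c1 c1' := by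
  obtain ⟨i, hi, rfl⟩ := Z.srcStep_eq_some h1
  obtain ⟨hp, hm⟩ := h
  have e : c'.proc q = c.proc q := by rw [hp, Function.update_of_ne hq]
  refine ⟨_, Z.srcStep_of_getElem? (i := i) (by rw [e]; exact hi), ?_, ?_⟩
  · simp only [e, hm, hp]
    rw [Function.update_comm hq]
  · simp only [e, hm]

lemma Differ.runFrom {p : Fin Z.n} {s : Proc ℕ} : ∀ {K : Z.Hist} {c c' c1 : SrcConfig Z.n},
    Z.Differ p s c c' → p ∉ ops K → Z.runFrom c K = some c1 →
    ∃ c1', Z.runFrom c' K = some c1' ∧ Z.Differ p s c1 c1'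
  | [], c, c', c1, h, _, h1 => ⟨c', rfl, by simp at h1; exact h1 ▸ h⟩
  | .snap x :: K, c, c', c1, h, hK, h1 => Differ.runFrom (K := K) h hK h1
  | .op q t :: K, c, c', c1, h, hK, h1 => by
      rw [runFrom_cons_op, Option.bind_eq_some_iff] at h1
      obtain ⟨c2, h2, h3⟩ := h1
      simp only [ops_cons_op, List.mem_cons, not_or] at hK
      obtain ⟨c2', h2', hd⟩ := Differ.step Z h (Ne.symm hK.1) h2
      obtain ⟨c1', h4, hd'⟩ := Differ.runFrom (K := K) hd hK.2 h3
      exact ⟨c1', by rw [runFrom_cons_op, h2', Option.bind_some, h4], hd'⟩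

lemma runFrom_proc {p : Fin Z.n} : ∀ {K : Z.Hist} {c c1 : SrcConfig Z.n},
    p ∉ ops K → Z.runFrom c K = some c1 → c1.proc p = c.proc p
  | [], c, c1, _, h1 => by simp at h1; rw [h1]
  | .snap x :: K, c, c1, hK, h1 => runFrom_proc (K := K) hK h1
  | .op q t :: K, c, c1, hK, h1 => by
      rw [runFrom_cons_op, Option.bind_eq_some_iff] at h1
      obtain ⟨c2, h2, h3⟩ := h1
      simp only [ops_cons_op, List.mem_cons, not_or] at hK
      rw [runFrom_proc (K := K) hK.2 h3]
      obtain ⟨i, hi, rfl⟩ := Z.srcStep_eq_some h2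
      simp [Function.update_of_ne hK.1]

/-- The next instruction of `q` is a Write to `x`. -/
def WritesAt (c : SrcConfig Z.n) (q : Fin Z.n) (x : ℕ) : Prop :=
  ∃ a b, (Z.A q)[(c.proc q).pc]? = some (.base (.write a b)) ∧ (c.proc q).vars a = x

/-- Insertion of an instruction of `p` between `K₁` and `K₂` is possible, leads to the local state
`s` of `p`, and has no other effect once the first instruction of `K₂` is executed. -/
def Insertable (p : Fin Z.n) (s : Proc ℕ) (t : Option ℕ) (K₁ K₂ : Z.Hist) : Prop :=
  ∀ L R, K₂ = L ++ R → ∃ c c', Z.cfg (K₁ ++ L) = some c ∧ Z.cfg (K₁ ++ .op p t :: L) = some c' ∧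
    c'.proc = Function.update c.proc p s ∧ (L ≠ [] → c'.mem = c.mem)

/-- An instruction that leaves the memory unchanged is invisible to the others, and `p` itself does
nothing later. -/
lemma insertable_of_mem_eq {p : Fin Z.n} {s : Proc ℕ} {t : Option ℕ} {K₁ K₂ : Z.Hist}
    {c₁ c₂ : SrcConfig Z.n} (h₁ : Z.cfg K₁ = some c₁) (h₂ : Z.cfg (K₁ ++ K₂) = some c₂)
    (hK : p ∉ ops K₂) (hs : Z.srcStep c₁ p = some ⟨Function.update c₁.proc p s, c₁.mem⟩) :
    Z.Insertable p s t K₁ K₂ := by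
  rintro L R rfl
  rw [← List.append_assoc, cfg_append, Option.bind_eq_some_iff] at h₂
  obtain ⟨c, hc, -⟩ := h₂
  have hL := hc
  rw [cfg_append, h₁, Option.bind_some] at hL
  have hd : Z.Differ p s c₁ ⟨Function.update c₁.proc p s, c₁.mem⟩ := ⟨rfl, rfl⟩
  obtain ⟨c', hc', hd'⟩ := Differ.runFrom Z hd (fun hp => hK (by simp [hp])) hL
  refine ⟨c, c', hc, ?_, hd'.1, fun _ => hd'.2⟩
  rw [cfg_append, h₁, Option.bind_some, runFrom_cons_op, hs, Option.bind_some, hc']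

/-- The very next instruction overwrites `x` without looking at it, so a change of `x` just before
it is never noticed. -/
lemma insertable_of_masked {p q : Fin Z.n} {s : Proc ℕ} {t t' : Option ℕ} {K₁ K₂ : Z.Hist}
    {c₁ c₂ : SrcConfig Z.n} {x u : ℕ} (h₁ : Z.cfg K₁ = some c₁)
    (h₂ : Z.cfg (K₁ ++ .op q t' :: K₂) = some c₂)
    (hK : p ∉ ops (.op q t' :: K₂ : Z.Hist)) (hq : Z.WritesAt c₁ q x)
    (hs : Z.srcStep c₁ p = some ⟨Function.update c₁.proc p s, Function.update c₁.mem x u⟩) :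
    Z.Insertable p s t K₁ (.op q t' :: K₂) := by
  rintro L R hLR
  rcases L with _ | ⟨l, L⟩
  -- Between the two Writes the memories differ at `x`; this is the case that `Insertable` exempts
  -- by requiring `L ≠ []`.
  · refine ⟨c₁, ⟨Function.update c₁.proc p s, Function.update c₁.mem x u⟩, by simpa using h₁, ?_,
      rfl, by simp⟩
    · rw [cfg_append, h₁, Option.bind_some, runFrom_cons_op, hs, Option.bind_some]; rfl
  simp only [List.cons_append, List.cons.injEq] at hLR
  obtain ⟨rfl, rfl⟩ := hLR
  simp only [ops_cons_op, List.mem_cons, not_or] at hK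
  rw [← List.cons_append, ← List.append_assoc, cfg_append, Option.bind_eq_some_iff] at h₂
  obtain ⟨c, hc, -⟩ := h₂
  have hL := hc
  rw [cfg_append, h₁, Option.bind_some, runFrom_cons_op, Option.bind_eq_some_iff] at hL
  obtain ⟨c3, h3, h4⟩ := hL
  obtain ⟨a, b, hab, hx⟩ := hq
  have h3' := Z.srcStep_of_getElem? hab
  rw [h3] at h3'
  have e3 := Option.some.inj h3'
  set c1' : SrcConfig Z.n := ⟨Function.update c₁.proc p s, Function.update c₁.mem x u⟩ with hc1'
  have ep : c1'.proc q = c₁.proc q := by simp [hc1', Function.update_of_ne (Ne.symm hK.1)]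
  have h5 := Z.srcStep_of_getElem? (c := c1') (p := q) (by rw [ep]; exact hab)
  have hd : Z.Differ p s c3 ⟨Function.update c1'.proc q
      ((SrcInstr.base (.write a b)).exec Z.interp (c1'.proc q) c1'.mem).1,
        ((SrcInstr.base (.write a b)).exec Z.interp (c1'.proc q) c1'.mem).2⟩ := by
    constructor
    · rw [ep, e3]
      simp only [hc1', SrcInstr.exec, Instr.exec]
      rw [Function.update_comm (Ne.symm hK.1)]
    · rw [ep, e3]
      simp only [hc1', SrcInstr.exec, Instr.exec, hx, Function.update_idem]
  obtain ⟨c', hc', hd'⟩ := Differ.runFrom Z hd (fun hp => hK.2 (by simp [hp])) h4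
  refine ⟨c, c', hc, ?_, hd'.1, fun _ => hd'.2⟩
  rw [cfg_append, h₁, Option.bind_some, runFrom_cons_op, hs, Option.bind_some, runFrom_cons_op,
    h5, Option.bind_some, hc']

/-- Instructions of `p` could be inserted before this label. -/
def OpenLbl (p : Fin Z.n) (m : ℕ) : Lbl Z.v Z.n → Prop
  | .op q _ => q ≠ p
  | .snap x => x.idle p = false ∧ ¬(Z.S.translate Z.A).Halted x.config p ∧ x.completed p = m

def Open (p : Fin Z.n) (m : ℕ) (K : Z.Hist) : Prop := ∀ l ∈ K, Z.OpenLbl p m l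

@[simp] lemma open_nil (p : Fin Z.n) (m : ℕ) : Z.Open p m [] := by simp [Open]

@[simp] lemma open_append {p : Fin Z.n} {m : ℕ} {K L : Z.Hist} :
    Z.Open p m (K ++ L) ↔ Z.Open p m K ∧ Z.Open p m L := by
  simp only [Open, List.mem_append, or_imp, forall_and]

@[simp] lemma open_cons {p : Fin Z.n} {m : ℕ} {l : Lbl Z.v Z.n} {L : Z.Hist} :
    Z.Open p m (l :: L) ↔ Z.OpenLbl p m l ∧ Z.Open p m L := by
  simp [Open]

lemma Open.notMem {p : Fin Z.n} {m : ℕ} : ∀ {K : Z.Hist}, Z.Open p m K → p ∉ ops K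
  | [], _ => by simp
  | .op q t :: K, h => by
      rw [open_cons] at h
      have := Open.notMem (K := K) h.2
      have h1 : q ≠ p := h.1
      simp [this, Ne.symm h1]
  | .snap x :: K, h => by
      rw [open_cons] at h
      exact Open.notMem (K := K) h.2

/-- What has to hold for a state `x` of the simulating program that corresponds to the state `c`
of the simulated one, in which `k p` instructions of `p` have taken effect. -/
def SnapOK (x : Z.Trk) (c : SrcConfig Z.n) (k : Fin Z.n → ℕ) : Prop :=
  ∀ p, x.completed p ≤ k p ∧ k p ≤ x.completed p + 1 ∧
    (x.idle p = true ∨ (Z.S.translate Z.A).Halted x.config p →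
      k p = x.completed p ∧ Z.S.Stores x.config.mem p (c.proc p)) ∧
    ((Z.S.translate Z.A).Halted x.config p → Z.A.Halted c p)

/-- All past states are kept in the history and must be explained by the instructions before them.
An insertion into the past therefore has to respect every state that it precedes. -/
def Valid (H : Z.Hist) : Prop :=
  ∀ H₁ x H₂, H = H₁ ++ .snap x :: H₂ →
    ∃ c, Z.cfg H₁ = some c ∧ Z.SnapOK x c (fun p => (ops H₁).count p)

lemma Valid.snoc {H : Z.Hist} {x : Z.Trk} {c : SrcConfig Z.n} (h : Z.Valid H)
    (hc : Z.cfg H = some c) (hx : Z.SnapOK x c (fun p => (ops H).count p)) :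
    Z.Valid (H ++ [.snap x]) := by
  intro H₁ y H₂ e
  rcases List.eq_nil_or_concat H₂ with rfl | ⟨H₃, l, rfl⟩
  · have := List.append_inj' e rfl
    obtain ⟨rfl, h2⟩ := this
    simp only [List.cons.injEq, Lbl.snap.injEq, and_true] at h2
    exact ⟨c, hc, h2 ▸ hx⟩
  · rw [List.concat_eq_append, ← List.cons_append, ← List.append_assoc] at e
    have := List.append_inj' e rfl
    exact h H₁ y H₃ this.1

/-- At all later states `p` is inside its instruction number `m` and not halted. So the count of `p`
may be `m + 1`, and nothing is required of its stored state. The other processes see no change. -/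
lemma Valid.insert {p : Fin Z.n} {s : Proc ℕ} {t : Option ℕ} {K₁ K₂ : Z.Hist} {m : ℕ}
    (h : Z.Valid (K₁ ++ K₂)) (hi : Z.Insertable p s t K₁ K₂) (ho : Z.Open p m K₂)
    (hm : (ops (K₁ ++ K₂)).count p = m) : Z.Valid (K₁ ++ .op p t :: K₂) := by
  intro H₁ x H₂ e
  rw [List.append_eq_append_iff] at e
  rcases e with ⟨L, rfl, e⟩ | ⟨L, rfl, e⟩
  · rcases L with _ | ⟨l, L⟩
    · simp at e
    · simp only [List.cons_append, List.cons.injEq] at e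
      obtain ⟨rfl, rfl⟩ := e
      obtain ⟨c, hc, hx⟩ := h (K₁ ++ L) x H₂ (by simp)
      obtain ⟨c0, c', hc0, hc', hp, -⟩ := hi L (.snap x :: H₂) rfl
      rw [hc] at hc0
      obtain rfl := Option.some.inj hc0
      rw [open_append, open_cons] at ho
      obtain ⟨ho1, ⟨hx1, hx2, hx3⟩, ho2⟩ := ho
      refine ⟨c', hc', fun q => ?_⟩
      have hq := hx q
      by_cases hqp : q = p
      · subst hqp
        have n1 := Open.notMem Z ho1
        have n2 := Open.notMem Z ho2
        simp only [ops_append, ops_cons_snap, List.count_append, List.count_eq_zero_of_not_mem n1,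
          List.count_eq_zero_of_not_mem n2] at hm
        simp only [ops_append, ops_cons_op, List.count_append, List.count_cons_self,
          List.count_eq_zero_of_not_mem n1]
        exact ⟨by omega, by omega, fun hh => by simp [hx1, hx2] at hh, fun hh => absurd hh hx2⟩
      · have e1 : c'.proc q = c.proc q := by rw [hp, Function.update_of_ne hqp]
        have e2 : (ops (K₁ ++ .op p t :: L)).count q = (ops (K₁ ++ L)).count q := by
          simp [Ne.symm hqp]
        simp only [SrcProgram.Halted, e1, e2]
        exact hq
  · rcases L with _ | ⟨l, L⟩
    · simp at e
    · simp only [List.cons_append, List.cons.injEq] at e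
      obtain ⟨rfl, rfl⟩ := e
      exact h H₁ x (L ++ K₂) (by simp)

end Setup

end PPM

/-! ### Positions in the past, worlds and the rely-guarantee relations -/

namespace PPM
namespace Setup

variable (Z : Setup)

lemma split_cases {α : Type*} {K₁ K₂ H₁ H₂ : List α} (h : K₁ ++ K₂ = H₁ ++ H₂) :
    (∃ L, L ≠ [] ∧ H₁ = K₁ ++ L ∧ K₂ = L ++ H₂) ∨ (∃ L, K₁ = H₁ ++ L ∧ H₂ = L ++ K₂) := by
  rw [List.append_eq_append_iff] at h
  rcases h with ⟨L, h1, h2⟩ | ⟨L, h1, h2⟩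
  · by_cases hL : L = []
    · subst hL; right; exact ⟨[], by simpa using h1.symm, by simpa using h2.symm⟩
    · left; exact ⟨L, hL, h1, h2⟩
  · right; exact ⟨L, h1, h2⟩

/-- There is a position at which an instruction of `p` can be inserted and at which the shared
memory of the simulated program satisfies `φ`. -/
def PosIn (H : Z.Hist) (p : Fin Z.n) (m : ℕ) (φ : (ℕ → ℕ) → Prop) : Prop :=
  ∃ H₁ H₂ c, H = H₁ ++ H₂ ∧ Z.cfg H₁ = some c ∧ Z.Open p m H₂ ∧ φ c.mem

/-- A position strictly behind the insertion sees the same memory as before. A position in front of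
it, or exactly at it, is taken in front, where nothing has changed. -/
lemma PosIn.insert {K₁ K₂ : Z.Hist} {p q : Fin Z.n} {m : ℕ} {φ : (ℕ → ℕ) → Prop} {s : Proc ℕ}
    {t : Option ℕ} (h : Z.PosIn (K₁ ++ K₂) q m φ) (hi : Z.Insertable p s t K₁ K₂) (hpq : p ≠ q) :
    Z.PosIn (K₁ ++ .op p t :: K₂) q m φ := by
  obtain ⟨H₁, H₂, c, e, hc, ho, hφ⟩ := h
  rcases split_cases e with ⟨L, hL, rfl, rfl⟩ | ⟨L, rfl, rfl⟩
  · obtain ⟨c0, c', h0, h', hp, hm⟩ := hi L H₂ rfl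
    rw [hc] at h0
    obtain rfl := Option.some.inj h0
    exact ⟨K₁ ++ .op p t :: L, H₂, c', by simp, h', ho, by rw [hm hL]; exact hφ⟩
  · refine ⟨H₁, L ++ .op p t :: K₂, c, by simp, hc, ?_, hφ⟩
    rw [open_append] at ho ⊢
    exact ⟨ho.1, by rw [open_cons]; exact ⟨hpq, ho.2⟩⟩

lemma PosIn.append {K₁ K₂ : Z.Hist} {q : Fin Z.n} {m : ℕ} {φ : (ℕ → ℕ) → Prop}
    (h : Z.PosIn K₁ q m φ) (ho : Z.Open q m K₂) : Z.PosIn (K₁ ++ K₂) q m φ := by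
  obtain ⟨H₁, H₂, c, rfl, hc, ho', hφ⟩ := h
  exact ⟨H₁, H₂ ++ K₂, c, by simp, hc, by simp [ho', ho], hφ⟩

/-- The record `I` of the shared cell `x` has been displaced by a Write, before which the value
of `x` was `u` and the processes in `R` could still execute an instruction. -/
def DispIn (H : Z.Hist) (I x u : ℕ) (m : Fin Z.n → ℕ) (R : Fin Z.n → Prop) : Prop :=
  ∃ H₁ q H₂ c, H = H₁ ++ .op q (some I) :: H₂ ∧ Z.cfg H₁ = some c ∧ Z.WritesAt c q x ∧
    c.mem x = u ∧ ∀ r, R r → Z.Open r (m r) (.op q (some I) :: H₂)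

lemma DispIn.append {K₁ K₂ : Z.Hist} {I x u : ℕ} {m : Fin Z.n → ℕ} {R R' : Fin Z.n → Prop}
    (h : Z.DispIn K₁ I x u m R) (hR : ∀ r, R' r → R r ∧ Z.Open r (m r) K₂) :
    Z.DispIn (K₁ ++ K₂) I x u m R' := by
  obtain ⟨H₁, q, H₂, c, rfl, hc, hw, hu, ho⟩ := h
  refine ⟨H₁, q, H₂ ++ K₂, c, by simp, hc, hw, hu, fun r hr => ?_⟩
  have := ho r (hR r hr).1
  rw [open_cons] at this
  simp only [open_cons, open_append]
  exact ⟨this.1, this.2, (hR r hr).2⟩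

/-- The critical case is an insertion immediately before the displacing Write, which could alter the
value `x` had at that moment. The hypothesis `hsame` allows it if the memory stays the same, or if
the insertion is itself a Write that takes over the role of displacing `I`. -/
lemma DispIn.insert {K₁ K₂ : Z.Hist} {p : Fin Z.n} {s : Proc ℕ} {t : Option ℕ}
    {I x u : ℕ} {m : Fin Z.n → ℕ} {R R' : Fin Z.n → Prop}
    (h : Z.DispIn (K₁ ++ K₂) I x u m R) (hi : Z.Insertable p s t K₁ K₂) (hK : p ∉ ops K₂)
    (hR : ∀ r, R' r → R r ∧ r ≠ p)
    (hsame : ∀ q K₃, K₂ = .op q (some I) :: K₃ →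
      (∀ c c', Z.cfg K₁ = some c → Z.cfg (K₁ ++ [.op p t]) = some c' → c'.mem = c.mem) ∨
      (t = some I ∧ ∀ c, Z.cfg K₁ = some c → Z.WritesAt c p x)) :
    Z.DispIn (K₁ ++ .op p t :: K₂) I x u m R' := by
  obtain ⟨H₁, q, H₂, c, e, hc, hw, hu, ho⟩ := h
  rcases split_cases e with ⟨L, hL, rfl, rfl⟩ | ⟨L, e1, e2⟩
  · obtain ⟨c0, c', h0, h', hp, hm⟩ := hi L _ rfl
    rw [hc] at h0
    obtain rfl := Option.some.inj h0
    have hqp : q ≠ p := by rintro rfl; simp at hK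
    refine ⟨K₁ ++ .op p t :: L, q, H₂, c', by simp, h', ?_, by rw [hm hL]; exact hu,
      fun r hr => ho r (hR r hr).1⟩
    unfold WritesAt
    rw [hp, Function.update_of_ne hqp]
    exact hw
  · rcases L with _ | ⟨l, L⟩
    · rw [List.append_nil] at e1
      rw [List.nil_append] at e2
      subst e1 e2
      rcases hsame q H₂ rfl with hs | ⟨rfl, hs⟩
      · obtain ⟨c0, c', h0, h', hp, -⟩ := hi [] _ rfl
        have hqp : q ≠ p := by rintro rfl; simp at hK
        rw [List.append_nil] at h0
        have hm := hs _ _ h0 h'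
        rw [hc] at h0
        obtain rfl := Option.some.inj h0
        refine ⟨K₁ ++ [.op p t], q, H₂, c', by simp, h', ?_, by rw [hm]; exact hu,
          fun r hr => ho r (hR r hr).1⟩
        unfold WritesAt
        rw [hp, Function.update_of_ne hqp]
        exact hw
      -- The inserted Write is now the first to displace `I`, and before it `x` still has the value
      -- `u`.
      · refine ⟨K₁, p, .op q (some I) :: H₂, c, by simp, hc, hs c hc, hu, fun r hr => ?_⟩
        rw [open_cons]
        exact ⟨Ne.symm (hR r hr).2, ho r (hR r hr).1⟩
    · simp only [List.cons_append, List.cons.injEq] at e2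
      obtain ⟨rfl, rfl⟩ := e2
      subst e1
      refine ⟨H₁, q, L ++ .op p t :: K₂, c, by simp, hc, hw, hu, fun r hr => ?_⟩
      have := ho r (hR r hr).1
      simp only [open_cons, open_append] at this ⊢
      exact ⟨this.1, this.2.1, Ne.symm (hR r hr).2, this.2.2⟩

/-- The persistent memory together with the state of the simulated program. -/
structure World (Z : Setup) where
  /-- persistent memory -/
  M : ℕ → ℕ
  /-- history up to now -/
  H : Z.Hist
  /-- state of the simulated program after `H` -/
  c : SrcConfig Z.n
  /-- `kind I x`: the record `I` has been written to the cell that represents `x` -/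
  kind : ℕ → ℕ → Prop
  /-- the records that have been made accessible to all processes -/
  inst : ℕ → Prop
  /-- the records that a process has found in cells since it started its current instruction -/
  seen : Fin Z.n → ℕ → Prop
  /-- the number of completed instructions -/
  comp : Fin Z.n → ℕ
  /-- the processes that are inside an instruction -/
  act : Fin Z.n → Prop

variable {Z}

namespace World

/-- The number of instructions of `p` that have taken effect. -/
def cnt (w : World Z) (p : Fin Z.n) : ℕ := (ops w.H).count p

/-- A possible linearization point in the past, kept in reserve until the boundary of the block. -/
def Pos (w : World Z) (p : Fin Z.n) (φ : (ℕ → ℕ) → Prop) : Prop :=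
  w.act p ∧ w.cnt p = w.comp p ∧ Z.PosIn w.H p (w.comp p) φ

/-- The record of the current instruction of `p`. -/
def own (w : World Z) (p : Fin Z.n) : ℕ := freshRec Z.n p (w.comp p)

/-- These are the processes that may still want to place their instruction just before the Write
that displaced `I`. -/
def Interested (w : World Z) (I : ℕ) (p : Fin Z.n) : Prop := w.cnt p = w.comp p ∧ w.seen p I

/-- The global invariant. -/
structure GI (w : World Z) : Prop where
  cfg : Z.cfg w.H = some w.c
  valid : Z.Valid w.H
  kind_fun : ∀ {I x y}, w.kind I x → w.kind I y → x = y
  kind_obj : ∀ x, w.kind (w.M (objAddr Z.n x)) x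
  -- First pointer for Writes, second pointer for CASes.
  value : ∀ x, w.M (w.M (w.M (objAddr Z.n x)) + 1) = w.c.mem x
  kind_inst : ∀ {I x}, w.kind I x → w.inst I
  cell_inst : ∀ {I x}, w.kind I x → w.inst (w.M I)
  -- The value reached through a displaced record remains meaningful: it is the value of `x` just
  -- before the displacing Write.
  disp : ∀ {I x}, w.kind I x → w.M (objAddr Z.n x) ≠ I →
    Z.DispIn w.H I x (w.M (w.M I + 1)) w.comp (w.Interested I)
  -- Together with `inst_form`, this makes a set flag a proof that the owner's instruction has taken
  -- effect.
  flag : ∀ {I}, IsRec Z.n I → ¬w.inst I → w.M (I + 2) = 0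
  inst_form : ∀ {I}, w.inst I → (∃ x, I = initRec Z.n x) ∨
    ∃ p m, I = freshRec Z.n (p : Fin Z.n) m ∧ (m < w.comp p ∨ m = w.comp p ∧ w.cnt p = w.comp p + 1)
  cnt_comp : ∀ p, w.cnt p = w.comp p ∨ w.cnt p = w.comp p + 1
  seen_kind : ∀ {p I}, w.seen p I → ∃ x, w.kind I x
  seen_act : ∀ {p I}, w.seen p I → w.act p
  stores : ∀ p, ¬w.act p → w.cnt p = w.comp p ∧ Z.S.Stores w.M p (w.c.proc p)

lemma GI.isRec {w : World Z} (h : w.GI) {I : ℕ} (hI : w.inst I) : IsRec Z.n I := by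
  rcases h.inst_form hI with ⟨x, rfl⟩ | ⟨p, m, rfl, -⟩
  · exact isRec_initRec x
  · exact isRec_freshRec _ _

lemma isRec_own (w : World Z) (p : Fin Z.n) : IsRec Z.n (w.own p) := isRec_freshRec _ _

/-- The record of a current instruction becomes accessible only when that instruction takes effect.
-/
lemma GI.cnt_of_inst_own {w : World Z} (h : w.GI) {p : Fin Z.n} (hI : w.inst (w.own p)) :
    w.cnt p = w.comp p + 1 := by
  rcases h.inst_form hI with ⟨x, e⟩ | ⟨q, m, e, hm⟩
  · exact absurd e freshRec_ne_initRec
  · obtain ⟨rfl, rfl⟩ := freshRec_inj e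
    omega

lemma GI.not_inst_own {w : World Z} (h : w.GI) {p : Fin Z.n} (hp : w.cnt p = w.comp p) :
    ¬w.inst (w.own p) := fun hI => by
  have := h.cnt_of_inst_own hI
  omega

/-- What `p` can rely on while it does not change its own state itself. -/
structure Ext (p : Fin Z.n) (w w' : World Z) : Prop where
  act : w.act p → w'.act p
  comp : w'.comp p = w.comp p
  proc : w'.c.proc p = w.c.proc p
  cnt : w'.cnt p = w.cnt p
  kind : ∀ {I x}, w.kind I x → w'.kind I x
  inst : ∀ {I}, w.inst I → w'.inst I
  value : ∀ {I}, w.inst I → w'.M (I + 1) = w.M (I + 1)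
  own : w.cnt p = w.comp p → w'.M (w.own p) = w.M (w.own p) ∧
    w'.M (w.own p + 1) = w.M (w.own p + 1)
  seen : ∀ {I}, w.seen p I → w'.seen p I
  pos : ∀ {φ}, w.Pos p φ → w'.Pos p φ
  obj : ∀ {I x}, w.kind I x → w.M (objAddr Z.n x) ≠ I → w'.M (objAddr Z.n x) ≠ I
  -- Only records that were not accessible are ever stored, so an old content never returns.
  cell_ne : ∀ {I x J}, w.kind I x → w.inst J → w.M I ≠ J → w'.M I ≠ J
  -- Whoever replaces the content has set its flag first, and replaces the value by a different one.
  -- The first part informs the owner of the replaced record; the second gives a losing CAS a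
  -- position at which it fails.
  cell : ∀ {I x}, w.kind I x → w'.M I ≠ w.M I → w'.M (w.M I + 2) = 1 ∧
    (w.seen p I → w.act p → w.cnt p = w.comp p → w'.Pos p fun mem => mem x ≠ w.M (w.M I + 1))
  flag : ∀ {I}, w.inst I → w.M (I + 2) = 1 → w'.M (I + 2) = 1

lemma Ext.refl (p : Fin Z.n) (w : World Z) : Ext p w w :=
  ⟨id, rfl, rfl, rfl, id, id, fun _ => rfl, fun _ => ⟨rfl, rfl⟩, id, id, fun _ h => h,
    fun _ _ h => h, fun _ h => absurd rfl h, fun _ h => h⟩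

lemma Ext.own_eq {p : Fin Z.n} {w w' : World Z} (h : Ext p w w') : w'.own p = w.own p := by
  simp only [World.own, h.comp]

lemma Ext.trans {p : Fin Z.n} {w w' w'' : World Z} (hG : w.GI) (h : Ext p w w')
    (h' : Ext p w' w'') : Ext p w w'' where
  act := h'.act ∘ h.act
  comp := h'.comp.trans h.comp
  proc := h'.proc.trans h.proc
  cnt := h'.cnt.trans h.cnt
  kind hk := h'.kind (h.kind hk)
  inst hk := h'.inst (h.inst hk)
  value hI := (h'.value (h.inst hI)).trans (h.value hI)
  own hp := by
    have h1 := h.own hp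
    have h2 := h'.own (by rw [h.cnt, h.comp]; exact hp)
    rw [h.own_eq] at h2
    exact ⟨h2.1.trans h1.1, h2.2.trans h1.2⟩
  seen hs := h'.seen (h.seen hs)
  pos hp := h'.pos (h.pos hp)
  obj hk hn := h'.obj (h.kind hk) (h.obj hk hn)
  cell_ne hk hJ hn := h'.cell_ne (h.kind hk) (h.inst hJ) (h.cell_ne hk hJ hn)
  cell {I x} hk hn := by
    have hJ := hG.cell_inst hk
    by_cases e : w'.M I = w.M I
    -- The content changes only in the second part, so the evidence comes from there; in the other
    -- case it arises in the first part and persists.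
    · have := h'.cell (h.kind hk) (by rw [e]; exact hn)
      rw [e, h.value hJ] at this
      exact ⟨this.1, fun a b c => this.2 (h.seen a) (h.act b) (by rw [h.cnt, h.comp]; exact c)⟩
    · have := h.cell hk e
      exact ⟨h'.flag (h.inst hJ) this.1, fun a b c => h'.pos (this.2 a b c)⟩
  flag hI hf := h'.flag (h.inst hI) (h.flag hI hf)

/-- The effect of a part of a step of `p` on the world. -/
structure Step (p : Fin Z.n) (w w' : World Z) : Prop where
  gi : w'.GI
  ext : ∀ q, q ≠ p → Ext q w w'
  priv : ∀ q, q ≠ p → ∀ j, w'.M (priv Z.n q j) = w.M (priv Z.n q j)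
  act : ∀ q, q ≠ p → (w'.act q ↔ w.act q)
  snaps : snaps w'.H = snaps w.H

lemma Step.refl (p : Fin Z.n) {w : World Z} (h : w.GI) : Step p w w :=
  ⟨h, fun q _ => Ext.refl q w, fun _ _ _ => rfl, fun _ _ => Iff.rfl, rfl⟩

lemma Step.trans {p : Fin Z.n} {w w' w'' : World Z} (hG : w.GI) (h : Step p w w')
    (h' : Step p w' w'') : Step p w w'' where
  gi := h'.gi
  ext q hq := (h.ext q hq).trans hG (h'.ext q hq)
  priv q hq j := (h'.priv q hq j).trans (h.priv q hq j)
  act q hq := (h'.act q hq).trans (h.act q hq)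
  snaps := h'.snaps.trans h.snaps

/-! ### Changes of the persistent memory only -/

def setMem (w : World Z) (M' : ℕ → ℕ) : World Z := { w with M := M' }

/-- The cells that may change freely are those without meaning for the simulated state: private
cells of active processes, records that are not accessible (except their flags), and flags of
accessible records. -/
lemma GI.setMem {w : World Z} (h : w.GI) {M' : ℕ → ℕ}
    (hobj : ∀ x, M' (objAddr Z.n x) = w.M (objAddr Z.n x))
    (hcell : ∀ I x, w.kind I x → M' I = w.M I)
    (hval : ∀ I, w.inst I → M' (I + 1) = w.M (I + 1))
    (hflag : ∀ I, IsRec Z.n I → ¬w.inst I → M' (I + 2) = w.M (I + 2))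
    (hpriv : ∀ q j, ¬w.act q → M' (priv Z.n q j) = w.M (priv Z.n q j)) : (w.setMem M').GI where
  cfg := h.cfg
  valid := h.valid
  kind_fun := h.kind_fun
  kind_obj x := by
    show w.kind (M' _) x
    rw [hobj]; exact h.kind_obj x
  value x := by
    show M' (M' (M' _) + 1) = _
    rw [hobj, hcell _ _ (h.kind_obj x), hval _ (h.cell_inst (h.kind_obj x))]
    exact h.value x
  kind_inst := h.kind_inst
  cell_inst {I x} hk := by
    show w.inst (M' I)
    rw [hcell I x hk]; exact h.cell_inst hk
  disp {I x} hk hn := by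
    have hn' : w.M (objAddr Z.n x) ≠ I := by rw [← hobj]; exact hn
    show Z.DispIn w.H I x (M' (M' I + 1)) w.comp (w.Interested I)
    rw [hcell I x hk, hval _ (h.cell_inst hk)]
    exact h.disp hk hn'
  flag hr hI := (hflag _ hr hI).trans (h.flag hr hI)
  inst_form := h.inst_form
  cnt_comp := h.cnt_comp
  seen_kind := h.seen_kind
  seen_act := h.seen_act
  stores p hp := by
    obtain ⟨h1, h2, h3⟩ := h.stores p hp
    exact ⟨h1, (hpriv p _ hp).trans h2, fun j => (hpriv p _ hp).trans (h3 j)⟩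

lemma Ext.setMem {w : World Z} {q : Fin Z.n} {M' : ℕ → ℕ}
    (hobj : ∀ x, M' (objAddr Z.n x) = w.M (objAddr Z.n x))
    (hcell : ∀ I x, w.kind I x → M' I = w.M I)
    (hval : ∀ I, w.inst I → M' (I + 1) = w.M (I + 1))
    (hown : M' (w.own q) = w.M (w.own q) ∧ M' (w.own q + 1) = w.M (w.own q + 1))
    (hflag : ∀ I, w.inst I → w.M (I + 2) = 1 → M' (I + 2) = 1) : Ext q w (w.setMem M') where
  act := id
  comp := rfl
  proc := rfl
  cnt := rfl
  kind := id
  inst := id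
  value := hval _
  own _ := hown
  seen := id
  pos := id
  obj _ hn := by show M' _ ≠ _; rw [hobj]; exact hn
  cell_ne hk _ hn := by show M' _ ≠ _; rw [hcell _ _ hk]; exact hn
  cell hk hn := absurd (hcell _ _ hk) hn
  flag := hflag _

/-- A write to a private cell. -/
lemma step_priv {w : World Z} (h : w.GI) {p : Fin Z.n} (hp : w.act p) (j u : ℕ) :
    Step p w (w.setMem (Function.update w.M (priv Z.n p j) u)) ∧
      Ext p w (w.setMem (Function.update w.M (priv Z.n p j) u)) := by
  have hobj : ∀ x, Function.update w.M (priv Z.n p j) u (objAddr Z.n x) = w.M (objAddr Z.n x) :=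
    fun x => Function.update_of_ne (Ne.symm (priv_ne_objAddr p j x)) _ _
  have hrec : ∀ I, IsRec Z.n I → ∀ e, e < 3 →
      Function.update w.M (priv Z.n p j) u (I + e) = w.M (I + e) := fun I hI e he =>
    Function.update_of_ne (Ne.symm (priv_ne_rec p j hI e he)) _ _
  have hE : ∀ q, Ext q w (w.setMem (Function.update w.M (priv Z.n p j) u)) := fun q =>
    Ext.setMem hobj (fun I x hk => hrec I (h.isRec (h.kind_inst hk)) 0 (by omega))
      (fun I hI => hrec I (h.isRec hI) 1 (by omega))
      ⟨hrec _ (w.isRec_own q) 0 (by omega), hrec _ (w.isRec_own q) 1 (by omega)⟩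
      (fun I hI hf => by rw [hrec I (h.isRec hI) 2 (by omega)]; exact hf)
  have hpr : ∀ q, q ≠ p → ∀ i,
      Function.update w.M (priv Z.n p j) u (priv Z.n q i) = w.M (priv Z.n q i) :=
    fun q hq i => Function.update_of_ne (fun e => hq (priv_inj e).1) _ _
  refine ⟨⟨?_, fun q _ => hE q, hpr, fun _ _ => Iff.rfl, rfl⟩, hE p⟩
  refine h.setMem hobj (fun I x hk => hrec I (h.isRec (h.kind_inst hk)) 0 (by omega))
      (fun I hI => hrec I (h.isRec hI) 1 (by omega)) (fun I hI _ => hrec I hI 2 (by omega)) ?_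
  intro q i hq
  exact hpr q (by rintro rfl; exact hq hp) i

/-- A write to the record of the current instruction. -/
lemma step_own {w : World Z} (h : w.GI) {p : Fin Z.n} (hp : w.cnt p = w.comp p) {e : ℕ}
    (he : e < 2) (u : ℕ) : Step p w (w.setMem (Function.update w.M (w.own p + e) u)) := by
  have hI0 := w.isRec_own p
  have hobj : ∀ x, Function.update w.M (w.own p + e) u (objAddr Z.n x) = w.M (objAddr Z.n x) :=
    fun x => Function.update_of_ne (objAddr_ne_rec x hI0 e (by omega)) _ _
  have hpriv : ∀ (q : Fin Z.n) j, Function.update w.M (w.own p + e) u (priv Z.n q j) = w.M (priv Z.n q j) :=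
    fun q j => Function.update_of_ne (priv_ne_rec q j hI0 e (by omega)) _ _
  have hrec : ∀ I, IsRec Z.n I → ∀ f, f < 3 → (I ≠ w.own p ∨ f ≠ e) →
      Function.update w.M (w.own p + e) u (I + f) = w.M (I + f) := by
    intro I hI f hf hne
    refine Function.update_of_ne (fun e' => ?_) _ _
    have := rec_inj hI hI0 hf (by omega) e'
    omega
  -- While the instruction is pending its record is not accessible, so no other process depends on
  -- it.
  have hne : ∀ I, w.inst I → I ≠ w.own p := fun I hI e => h.not_inst_own hp (e ▸ hI)
  refine ⟨?_, fun q hq => ?_, fun q _ => hpriv q, fun _ _ => Iff.rfl, rfl⟩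
  · exact h.setMem hobj
      (fun I x hk => hrec I (h.isRec (h.kind_inst hk)) 0 (by omega) (.inl (hne I (h.kind_inst hk))))
      (fun I hI => hrec I (h.isRec hI) 1 (by omega) (.inl (hne I hI)))
      (fun I hI _ => hrec I hI 2 (by omega) (.inr (by omega))) (fun q j _ => hpriv q j)
  · have hq' : w.own q ≠ w.own p := fun e => hq (freshRec_inj e).1
    exact Ext.setMem hobj
      (fun I x hk => hrec I (h.isRec (h.kind_inst hk)) 0 (by omega) (.inl (hne I (h.kind_inst hk))))
      (fun I hI => hrec I (h.isRec hI) 1 (by omega) (.inl (hne I hI)))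
      ⟨hrec _ (w.isRec_own q) 0 (by omega) (.inl hq'), hrec _ (w.isRec_own q) 1 (by omega) (.inl hq')⟩
      (fun I hI hf => by rw [hrec I (h.isRec hI) 2 (by omega) (.inr (by omega))]; exact hf)

/-- Setting the flag of an accessible record. -/
lemma step_flag {w : World Z} (h : w.GI) (p : Fin Z.n) {J : ℕ} (hJ : w.inst J) :
    Step p w (w.setMem (Function.update w.M (J + 2) 1)) ∧
      Ext p w (w.setMem (Function.update w.M (J + 2) 1)) := by
  have hJr := h.isRec hJ
  have hobj : ∀ x, Function.update w.M (J + 2) 1 (objAddr Z.n x) = w.M (objAddr Z.n x) :=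
    fun x => Function.update_of_ne (objAddr_ne_rec x hJr 2 (by omega)) _ _
  have hpriv : ∀ (q : Fin Z.n) j, Function.update w.M (J + 2) 1 (priv Z.n q j) = w.M (priv Z.n q j) :=
    fun q j => Function.update_of_ne (priv_ne_rec q j hJr 2 (by omega)) _ _
  have hrec : ∀ I, IsRec Z.n I → ∀ f, f < 2 →
      Function.update w.M (J + 2) 1 (I + f) = w.M (I + f) := by
    intro I hI f hf
    refine Function.update_of_ne (fun e' => ?_) _ _
    have := rec_inj hI hJr (by omega) (by omega) e'
    omega
  have hE : ∀ q, Ext q w (w.setMem (Function.update w.M (J + 2) 1)) := fun q =>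
    Ext.setMem hobj
      (fun I x hk => hrec I (h.isRec (h.kind_inst hk)) 0 (by omega))
      (fun I hI => hrec I (h.isRec hI) 1 (by omega))
      ⟨hrec _ (w.isRec_own q) 0 (by omega), hrec _ (w.isRec_own q) 1 (by omega)⟩
      (fun I hI hf => by
        rw [Function.update_apply]; split_ifs
        · rfl
        · exact hf)
  refine ⟨⟨?_, fun q _ => hE q, fun q _ => hpriv q, fun _ _ => Iff.rfl, rfl⟩, hE p⟩
  refine h.setMem hobj (fun I x hk => hrec I (h.isRec (h.kind_inst hk)) 0 (by omega))
      (fun I hI => hrec I (h.isRec hI) 1 (by omega)) (fun I hI hn => ?_) (fun q j _ => hpriv q j)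
  refine Function.update_of_ne (fun e' => ?_) _ _
  have := rec_inj hI hJr (by omega) (by omega) e'
  exact hn (this.1 ▸ hJ)

/-! ### Changes of the bookkeeping -/

/-- `p` enters an instruction. -/
def activate (w : World Z) (p : Fin Z.n) : World Z :=
  { w with act := fun q => w.act q ∨ q = p }

/-- Entering an instruction only releases `p` from the obligation to have its state stored. -/
lemma step_activate {w : World Z} (h : w.GI) (p : Fin Z.n) :
    Step p w (w.activate p) ∧ Ext p w (w.activate p) := by
  have hE : ∀ q, Ext q w (w.activate p) := fun q =>
    { Ext.refl q w with
      act := Or.inl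
      pos := fun hh => ⟨Or.inl hh.1, hh.2⟩
      cell := fun _ hn => absurd rfl hn }
  refine ⟨⟨?_, fun q _ => hE q, fun _ _ _ => rfl, fun q hq => by simp [activate, hq], rfl⟩, hE p⟩
  exact { h with
    seen_act := fun hs => Or.inl (h.seen_act hs)
    stores := fun q hq => h.stores q (fun hh => hq (Or.inl hh)) }

/-- `p` reads the cell that represents `x`. -/
def see (w : World Z) (p : Fin Z.n) (I : ℕ) : World Z :=
  { w with seen := fun q J => w.seen q J ∨ q = p ∧ J = I }

/-- The new interest of `p` adds no obligation to `disp`, because the record is read while it is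
current; a later displacement happens in the presence of `p`. -/
lemma step_see {w : World Z} (h : w.GI) {p : Fin Z.n} (hp : w.act p) (x : ℕ) :
    Step p w (w.see p (w.M (objAddr Z.n x))) ∧ Ext p w (w.see p (w.M (objAddr Z.n x))) := by
  have hE : ∀ q, Ext q w (w.see p (w.M (objAddr Z.n x))) := fun q =>
    { Ext.refl q w with
      seen := Or.inl
      pos := fun hh => hh
      cell := fun _ hn => absurd rfl hn }
  refine ⟨⟨?_, fun q _ => hE q, fun _ _ _ => rfl, fun q hq => Iff.rfl, rfl⟩, hE p⟩
  refine { h with seen_kind := ?sk, seen_act := ?sa, disp := ?ds }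
  case sk =>
    rintro q I (hs | ⟨rfl, rfl⟩)
    · exact h.seen_kind hs
    · exact ⟨x, h.kind_obj x⟩
  case sa =>
    rintro q I (hs | ⟨rfl, rfl⟩)
    · exact h.seen_act hs
    · exact hp
  case ds =>
    intro I y hk hn
    obtain ⟨H₁, q, H₂, c, e, hc, hw, hu, ho⟩ := h.disp hk hn
    refine ⟨H₁, q, H₂, c, e, hc, hw, hu, fun r hr => ho r ⟨hr.1, ?_⟩⟩
    rcases hr.2 with hs | ⟨rfl, rfl⟩
    · exact hs
    · obtain rfl := h.kind_fun hk (h.kind_obj x)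
      exact absurd rfl hn

/-- `p` forgets what it has read. -/
def forget (w : World Z) (p : Fin Z.n) (b : Prop) : World Z :=
  { w with
    seen := fun q J => w.seen q J ∧ q ≠ p
    act := fun q => if q = p then b else w.act q }

/-- Used when `p` arrives at the start of a block, by a jump or by a restart. Its simulated state is
still stored, so it may be declared active or inactive at will. -/
lemma step_forget {w : World Z} (h : w.GI) {p : Fin Z.n} (hp : w.cnt p = w.comp p)
    (hs : Z.S.Stores w.M p (w.c.proc p)) (b : Prop) : Step p w (w.forget p b) := by
  refine ⟨?_, fun q hq => ?_, fun _ _ _ => rfl, fun q hq => by simp [forget, hq], rfl⟩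
  · refine { h with seen_kind := fun hh => h.seen_kind hh.1, seen_act := ?sa, disp := ?ds, stores := ?st }
    case sa =>
      intro q I hh
      simpa [forget, hh.2] using h.seen_act hh.1
    case ds =>
      intro I y hk hn
      obtain ⟨H₁, q, H₂, c, e, hc, hw, hu, ho⟩ := h.disp hk hn
      exact ⟨H₁, q, H₂, c, e, hc, hw, hu, fun r hr => ho r ⟨hr.1, hr.2.1⟩⟩
    case st =>
      intro q hq
      by_cases e : q = p
      · subst e; exact ⟨hp, hs⟩
      · exact h.stores q (by simpa [forget, e] using hq)
  · exact
      { Ext.refl q w with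
        act := fun hh => by simpa [forget, hq] using hh
        seen := fun hh => ⟨hh, hq⟩
        pos := fun hh => ⟨by simpa [forget, hq] using hh.1, hh.2⟩
        cell := fun _ hn => absurd rfl hn }

/-- `p` completes an instruction that has taken effect. -/
def complete (w : World Z) (p : Fin Z.n) : World Z :=
  { w with
    seen := fun q J => w.seen q J ∧ q ≠ p
    act := fun q => if q = p then False else w.act q
    comp := Function.update w.comp p (w.comp p + 1) }

/-- The counter `comp` enters `disp` only for interested processes, and `p` is no longer one. -/
lemma step_complete {w : World Z} (h : w.GI) {p : Fin Z.n} (hp : w.cnt p = w.comp p + 1)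
    (hs : Z.S.Stores w.M p (w.c.proc p)) : Step p w (w.complete p) := by
  have hc : ∀ q, q ≠ p → (w.complete p).comp q = w.comp q := fun q hq => by simp [complete, hq]
  have hcp : (w.complete p).comp p = w.comp p + 1 := by simp [complete]
  refine ⟨?_, fun q hq => ?_, fun _ _ _ => rfl, fun q hq => by simp [complete, hq], rfl⟩
  · refine { h with seen_kind := fun hh => h.seen_kind hh.1, seen_act := ?sa, disp := ?ds, stores := ?st, inst_form := ?inf, cnt_comp := ?cc }
    case sa =>
      intro q I hh
      simpa [complete, hh.2] using h.seen_act hh.1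
    case ds =>
      intro I y hk hn
      obtain ⟨H₁, q, H₂, c, e, hc', hw, hu, ho⟩ := h.disp hk hn
      refine ⟨H₁, q, H₂, c, e, hc', hw, hu, fun r hr => ?_⟩
      have hrp : r ≠ p := hr.2.2
      rw [hc r hrp]
      exact ho r ⟨by rw [← hc r hrp]; exact hr.1, hr.2.1⟩
    case st =>
      intro q hq
      by_cases e : q = p
      · subst e; exact ⟨by rw [hcp]; exact hp, hs⟩
      · rw [hc q e]
        exact h.stores q (by simpa [complete, e] using hq)
    case inf =>
      intro I hI
      rcases h.inst_form hI with hx | ⟨q, m, e, hm⟩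
      · exact .inl hx
      · refine .inr ⟨q, m, e, ?_⟩
        by_cases e : q = p
        · subst e; rw [hcp]; left; omega
        · rw [hc q e]; exact hm
    case cc =>
      intro q
      by_cases e : q = p
      · subst e; rw [hcp]; left; exact hp
      · rw [hc q e]; exact h.cnt_comp q
  · exact
      { Ext.refl q w with
        act := fun hh => by simpa [complete, hq] using hh
        comp := hc q hq
        seen := fun hh => ⟨hh, hq⟩
        pos := fun hh => ⟨by simpa [complete, hq] using hh.1, by rw [hc q hq]; exact hh.2⟩
        cell := fun _ hn => absurd rfl hn }

/-- The state `x` of the simulating program is recorded. -/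
def record (w : World Z) (x : Z.Trk) : World Z := { w with H := w.H ++ [.snap x] }

lemma cnt_record (w : World Z) (x : Z.Trk) (p : Fin Z.n) : (w.record x).cnt p = w.cnt p := by
  simp [cnt, record]

/-- A state in which all active processes are inside their instructions is no obstacle to later
insertions before it, so all reserved positions survive. -/
lemma gi_record {w : World Z} (h : w.GI) {x : Z.Trk} (hx : Z.SnapOK x w.c w.cnt)
    (hact : ∀ q, w.act q → Z.OpenLbl q (w.comp q) (.snap x)) :
    (w.record x).GI ∧ ∀ q, Ext q w (w.record x) := by
  constructor
  · refine { h with cfg := ?cf, valid := h.valid.snoc Z h.cfg hx, disp := ?ds, inst_form := ?inf, cnt_comp := ?cc, stores := ?st }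
    case cf =>
      show Z.cfg (w.H ++ [.snap x]) = some w.c
      rw [cfg_append, h.cfg]; rfl
    case ds =>
      intro I y hk hn
      refine (h.disp hk hn).append Z (fun r hr => ?_)
      refine ⟨⟨by rw [← cnt_record w x]; exact hr.1, hr.2⟩, ?_⟩
      simp only [open_cons, open_nil, and_true]
      exact hact r (h.seen_act hr.2)
    case inf =>
      intro I hI
      rcases h.inst_form hI with hx | ⟨q, m, e, hm⟩
      · exact .inl hx
      · exact .inr ⟨q, m, e, by rw [cnt_record]; exact hm⟩
    case cc => intro p; rw [cnt_record]; exact h.cnt_comp p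
    case st => intro p; rw [cnt_record]; exact h.stores p
  · intro q
    have hpos : ∀ φ, w.Pos q φ → (w.record x).Pos q φ := fun φ hh =>
      ⟨hh.1, by rw [cnt_record]; exact hh.2.1, hh.2.2.append Z (by
        simp only [open_cons, open_nil, and_true]; exact hact q hh.1)⟩
    exact { Ext.refl q w with
      cnt := cnt_record w x q
      pos := hpos _
      cell := fun _ hn => absurd rfl hn }

end World
end Setup
end PPM

/-! ### The ways in which an instruction takes effect -/

namespace PPM
namespace Setup
namespace World

variable {Z : Setup}

/-- The history of `w` admits the insertion of an instruction of `p` that has not taken effect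
yet; this leads to the configuration `c'`. -/
structure Ins (w : World Z) (p : Fin Z.n) (s : Proc ℕ) (t : Option ℕ) (K₁ K₂ : Z.Hist)
    (c' : SrcConfig Z.n) : Prop where
  gi : w.GI
  act : w.act p
  cnt : w.cnt p = w.comp p
  split : w.H = K₁ ++ K₂
  op : Z.Open p (w.comp p) K₂
  ins : Z.Insertable p s t K₁ K₂
  cfg : Z.cfg (K₁ ++ .op p t :: K₂) = some c'

section Ins

variable {w : World Z} {p : Fin Z.n} {s : Proc ℕ} {t : Option ℕ} {K₁ K₂ : Z.Hist}
  {c' : SrcConfig Z.n}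

lemma Ins.proc (h : Ins w p s t K₁ K₂ c') : c'.proc = Function.update w.c.proc p s := by
  obtain ⟨c0, c1, h0, h1, hp, -⟩ := h.ins K₂ [] (by simp)
  rw [← h.split, h.gi.cfg] at h0
  rw [h.cfg] at h1
  obtain rfl := Option.some.inj h0
  obtain rfl := Option.some.inj h1
  exact hp

lemma Ins.mem (h : Ins w p s t K₁ K₂ c') (hK : K₂ ≠ []) : c'.mem = w.c.mem := by
  obtain ⟨c0, c1, h0, h1, -, hm⟩ := h.ins K₂ [] (by simp)
  rw [← h.split, h.gi.cfg] at h0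
  rw [h.cfg] at h1
  obtain rfl := Option.some.inj h0
  obtain rfl := Option.some.inj h1
  exact hm hK

lemma Ins.valid (h : Ins w p s t K₁ K₂ c') : Z.Valid (K₁ ++ .op p t :: K₂) :=
  Valid.insert Z (m := w.comp p) (by rw [← h.split]; exact h.gi.valid) h.ins h.op
    (by rw [← h.split]; exact h.cnt)

lemma Ins.count_ne (h : Ins w p s t K₁ K₂ c') {q : Fin Z.n} (hq : q ≠ p) :
    (ops (K₁ ++ .op p t :: K₂)).count q = w.cnt q := by
  unfold World.cnt
  rw [h.split]
  simp [Ne.symm hq]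

lemma Ins.count_self (h : Ins w p s t K₁ K₂ c') :
    (ops (K₁ ++ .op p t :: K₂)).count p = w.comp p + 1 := by
  have := h.cnt
  unfold World.cnt at this
  rw [h.split] at this
  rw [← this]
  simp [add_assoc]

lemma Ins.pos (h : Ins w p s t K₁ K₂ c') {q : Fin Z.n} (hq : q ≠ p) {φ : (ℕ → ℕ) → Prop} {m : ℕ}
    (hP : Z.PosIn w.H q m φ) : Z.PosIn (K₁ ++ .op p t :: K₂) q m φ := by
  rw [h.split] at hP
  exact hP.insert Z h.ins (Ne.symm hq)

lemma Ins.snaps (h : Ins w p s t K₁ K₂ c') : snaps (K₁ ++ .op p t :: K₂) = snaps w.H := by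
  rw [h.split]; simp

lemma Ins.disp (h : Ins w p s t K₁ K₂ c') {I x u : ℕ} {R' : Fin Z.n → Prop}
    (hd : Z.DispIn w.H I x u w.comp (w.Interested I))
    (hR : ∀ r, R' r → w.Interested I r ∧ r ≠ p)
    (hsame : ∀ q K₃, K₂ = .op q (some I) :: K₃ →
      (∀ c c', Z.cfg K₁ = some c → Z.cfg (K₁ ++ [.op p t]) = some c' → c'.mem = c.mem) ∨
      (t = some I ∧ ∀ c, Z.cfg K₁ = some c → Z.WritesAt c p x)) :
    Z.DispIn (K₁ ++ .op p t :: K₂) I x u w.comp R' := by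
  rw [h.split] at hd
  exact hd.insert Z h.ins (Open.notMem Z h.op) hR hsame

lemma Ins.inst_form (h : Ins w p s t K₁ K₂ c') {I : ℕ} (hI : w.inst I ∨ I = w.own p) :
    (∃ x, I = initRec Z.n x) ∨ ∃ q m, I = freshRec Z.n (q : Fin Z.n) m ∧
      (m < w.comp q ∨ m = w.comp q ∧ (ops (K₁ ++ .op p t :: K₂)).count q = w.comp q + 1) := by
  rcases hI with hI | rfl
  · rcases h.gi.inst_form hI with hx | ⟨q, m, e, hm⟩
    · exact .inl hx
    · refine .inr ⟨q, m, e, ?_⟩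
      by_cases hq : q = p
      · subst hq; rw [h.count_self]; omega
      · rw [h.count_ne hq]; exact hm
  · exact .inr ⟨p, _, rfl, .inr ⟨rfl, h.count_self⟩⟩

lemma Ins.cnt_comp (h : Ins w p s t K₁ K₂ c') (q : Fin Z.n) :
    (ops (K₁ ++ .op p t :: K₂)).count q = w.comp q ∨
      (ops (K₁ ++ .op p t :: K₂)).count q = w.comp q + 1 := by
  by_cases hq : q = p
  · subst hq; exact .inr h.count_self
  · rw [h.count_ne hq]; exact h.gi.cnt_comp q

lemma Ins.interested (h : Ins w p s t K₁ K₂ c') {I : ℕ} {r : Fin Z.n}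
    (hr : (ops (K₁ ++ .op p t :: K₂)).count r = w.comp r ∧ w.seen r I) :
    w.Interested I r ∧ r ≠ p := by
  have hrp : r ≠ p := by
    rintro rfl
    have := h.count_self
    omega
  exact ⟨⟨by rw [← h.count_ne hrp]; exact hr.1, hr.2⟩, hrp⟩

lemma Ins.proc_ne (h : Ins w p s t K₁ K₂ c') {q : Fin Z.n} (hq : q ≠ p) :
    c'.proc q = w.c.proc q := by rw [h.proc, Function.update_of_ne hq]

/-- If the insertion does not alter the present simulated memory, the persistent memory represents
it as before, and only the history has to be checked. -/
lemma Ins.step_quiet (h : Ins w p s t K₁ K₂ c') (hm : c'.mem = w.c.mem)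
    (hsame : ∀ I x, w.kind I x → ∀ q K₃, K₂ = .op q (some I) :: K₃ →
      (∀ c c', Z.cfg K₁ = some c → Z.cfg (K₁ ++ [.op p t]) = some c' → c'.mem = c.mem) ∨
      (t = some I ∧ ∀ c, Z.cfg K₁ = some c → Z.WritesAt c p x)) :
    Step p w { w with H := K₁ ++ .op p t :: K₂, c := c' } where
  gi :=
    { h.gi with
      cfg := h.cfg
      valid := h.valid
      value := fun x => by rw [hm]; exact h.gi.value x
      disp := fun hk hn => h.disp (h.gi.disp hk hn) (fun r hr => h.interested hr) (hsame _ _ hk)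
      inst_form := fun hI => h.inst_form (.inl hI)
      cnt_comp := h.cnt_comp
      stores := fun q hq => by
        have hqp : q ≠ p := by rintro rfl; exact hq h.act
        have := h.gi.stores q hq
        exact ⟨(h.count_ne hqp).trans this.1, by rw [h.proc_ne hqp]; exact this.2⟩ }
  ext q hq :=
    { Ext.refl q w with
      proc := h.proc_ne hq
      cnt := h.count_ne hq
      pos := fun hP => ⟨hP.1, (h.count_ne hq).trans hP.2.1, h.pos hq hP.2.2⟩
      cell := fun _ hn => absurd rfl hn }
  priv _ _ _ := rfl
  act _ _ := Iff.rfl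
  snaps := h.snaps

end Ins

/-- `w'` arises from `w` when an instruction of `p` takes effect and leads to the state `s`. -/
structure Commit (p : Fin Z.n) (s : Proc ℕ) (w w' : World Z) : Prop where
  step : Step p w w'
  comp : w'.comp = w.comp
  act : w'.act = w.act
  cnt : w'.cnt p = w.comp p + 1
  proc : w'.c.proc p = s
  seen : w'.seen = w.seen
  kind : ∀ {I x}, w.kind I x → w'.kind I x
  inst : ∀ {I}, w.inst I → w'.inst I

/-- Since `p` has executed nothing after the split, the instruction it would execute there is its
current one. -/
lemma GI.proc_of_split {w : World Z} (h : w.GI) {H₁ H₂ : Z.Hist} (e : w.H = H₁ ++ H₂)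
    {c₁ : SrcConfig Z.n} (h₁ : Z.cfg H₁ = some c₁) {p : Fin Z.n} (hp : p ∉ ops H₂) :
    c₁.proc p = w.c.proc p := by
  have := h.cfg
  rw [e, cfg_append, h₁, Option.bind_some] at this
  exact (Z.runFrom_proc hp this).symm

/-- An instruction that does not change the memory takes effect. -/
lemma commit_pos {w : World Z} (h : w.GI) {p : Fin Z.n} {s : Proc ℕ} {φ : (ℕ → ℕ) → Prop}
    (hP : w.Pos p φ)
    (hs : ∀ c : SrcConfig Z.n, c.proc p = w.c.proc p → φ c.mem →
      Z.srcStep c p = some ⟨Function.update c.proc p s, c.mem⟩) :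
    ∃ w', Commit p s w w' ∧ w'.M = w.M := by
  obtain ⟨ha, hc, H₁, H₂, c₁, e, h₁, ho, hφ⟩ := hP
  have hp := Open.notMem Z ho
  have hs1 := hs c₁ (h.proc_of_split e h₁ hp) hφ
  have hi := Z.insertable_of_mem_eq (t := none) h₁ (by rw [← e]; exact h.cfg) hp hs1
  obtain ⟨c0, c', h0, h', -, hm⟩ := hi H₂ [] (by simp)
  have hI : Ins w p s none H₁ H₂ c' := ⟨h, ha, hc, e, ho, hi, h'⟩
  have hsame : ∀ c c', Z.cfg H₁ = some c → Z.cfg (H₁ ++ [.op p none]) = some c' →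
      c'.mem = c.mem := by
    intro c c' e1 e2
    rw [h₁] at e1
    obtain rfl := Option.some.inj e1
    rw [cfg_append, h₁, Option.bind_some, runFrom_cons_op, hs1] at e2
    simp only [Option.bind_some, runFrom_nil, Option.some.injEq] at e2
    rw [← e2]
  have hmem : c'.mem = w.c.mem := by
    -- `Insertable` controls the memory only behind the first label of the tail, so an insertion at
    -- the end is treated separately.
    by_cases hH : H₂ = []
    · subst hH
      rw [List.append_nil] at e
      have e1 := h.cfg
      rw [e] at e1
      exact hsame _ _ e1 h'
    · exact hI.mem hH
  refine ⟨_, ⟨hI.step_quiet hmem (fun I x _ q K₃ _ => .inl hsame), rfl, rfl, hI.count_self, ?_, rfl, id, id⟩, rfl⟩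
  show c'.proc p = s
  rw [hI.proc, Function.update_self]

/-- A Write takes effect just before the one that displaced the record it wanted to replace. -/
lemma commit_masked {w : World Z} (h : w.GI) {p : Fin Z.n} {s : Proc ℕ} {I x u : ℕ}
    (ha : w.act p) (hc : w.cnt p = w.comp p) (hsn : w.seen p I) (hk : w.kind I x)
    (hn : w.M (objAddr Z.n x) ≠ I)
    (hs : ∀ c : SrcConfig Z.n, c.proc p = w.c.proc p → Z.WritesAt c p x ∧
      Z.srcStep c p = some ⟨Function.update c.proc p s, Function.update c.mem x u⟩) :
    ∃ w', Commit p s w w' ∧ w'.M = w.M := by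
  obtain ⟨H₁, q, H₂, c₁, e, h₁, hw, -, ho⟩ := h.disp hk hn
  have ho' := ho p ⟨hc, hsn⟩
  have hp := Open.notMem Z ho'
  have hs1 := hs c₁ (h.proc_of_split e h₁ hp)
  -- The tag `I` makes the hidden Write the new displacer of `I`, so the recorded value before the
  -- displacement stays right although `x` is overwritten here.
  have hi := Z.insertable_of_masked (t := some I) h₁ (by rw [← e]; exact h.cfg) hp hw hs1.2
  obtain ⟨c0, c', h0, h', -, hm⟩ := hi _ [] (List.append_nil _).symm
  have hI : Ins w p s (some I) H₁ (.op q (some I) :: H₂) c' := ⟨h, ha, hc, e, ho', hi, h'⟩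
  refine ⟨_, ⟨hI.step_quiet (hI.mem (by simp)) ?_, rfl, rfl, hI.count_self, ?_, rfl, id, id⟩, rfl⟩
  · intro J y hJ r K₃ e3
    simp only [List.cons.injEq, Lbl.op.injEq, Option.some.injEq] at e3
    obtain ⟨⟨-, rfl⟩, -⟩ := e3
    obtain rfl := h.kind_fun hJ hk
    refine .inr ⟨rfl, fun c hc => ?_⟩
    rw [h₁] at hc
    obtain rfl := Option.some.inj hc
    exact hs1.1
  · show c'.proc p = s
    rw [hI.proc, Function.update_self]

lemma ins_end {w : World Z} (h : w.GI) {p : Fin Z.n} {s : Proc ℕ} (t : Option ℕ)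
    (ha : w.act p) (hc : w.cnt p = w.comp p) {M' : ℕ → ℕ}
    (hs : Z.srcStep w.c p = some ⟨Function.update w.c.proc p s, M'⟩) :
    Ins w p s t w.H [] ⟨Function.update w.c.proc p s, M'⟩ := by
  have hcfg : Z.cfg (w.H ++ [.op p t]) = some ⟨Function.update w.c.proc p s, M'⟩ := by
    rw [cfg_append, h.cfg, Option.bind_some, runFrom_cons_op, hs]; rfl
  refine ⟨h, ha, hc, by simp, by simp, ?_, hcfg⟩
  intro L R e
  obtain ⟨rfl, rfl⟩ := List.append_eq_nil_iff.mp e.symm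
  exact ⟨w.c, _, by simpa using h.cfg, hcfg, rfl, by simp⟩

/-- A Write takes effect by the replacement of the record of its cell. -/
lemma commit_write {w : World Z} (h : w.GI) {p : Fin Z.n} {s : Proc ℕ} {x u : ℕ}
    (ha : w.act p) (hc : w.cnt p = w.comp p) (hI0 : w.M (w.own p) = w.own p)
    (hI1 : w.M (w.own p + 1) = u) (hw : Z.WritesAt w.c p x)
    (hs : Z.srcStep w.c p = some ⟨Function.update w.c.proc p s, Function.update w.c.mem x u⟩) :
    ∃ w', Commit p s w w' ∧ w'.M = Function.update w.M (objAddr Z.n x) (w.own p) ∧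
      ∀ J y, w.kind J y → w'.M (objAddr Z.n y) = J → w.M (objAddr Z.n y) = J := by
  -- The tag is the record that is displaced at this moment.
  have hI := ins_end h (some (w.M (objAddr Z.n x))) ha hc hs
  set I := w.own p with hIdef
  have hnI : ¬w.inst I := h.not_inst_own hc
  have hIr : IsRec Z.n I := w.isRec_own p
  set M' := Function.update w.M (objAddr Z.n x) I with hM'
  have hrec : ∀ J, IsRec Z.n J → ∀ e, e < 3 → M' (J + e) = w.M (J + e) := fun J hJ e he =>
    Function.update_of_ne (Ne.symm (objAddr_ne_rec x hJ e he)) _ _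
  have hobj : ∀ y, y ≠ x → M' (objAddr Z.n y) = w.M (objAddr Z.n y) := fun y hy =>
    Function.update_of_ne (fun e => hy (objAddr_inj e)) _ _
  have hobjx : M' (objAddr Z.n x) = I := Function.update_self _ _ _
  have hpriv : ∀ (q : Fin Z.n) j, M' (priv Z.n q j) = w.M (priv Z.n q j) := fun q j =>
    Function.update_of_ne (priv_ne_objAddr q j x) _ _
  have hcell : ∀ J, IsRec Z.n J → M' J = w.M J := fun J hJ => hrec J hJ 0 (by omega)
  set w' : World Z := { w with
    M := M', H := w.H ++ [.op p (some (w.M (objAddr Z.n x)))]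
    c := ⟨Function.update w.c.proc p s, Function.update w.c.mem x u⟩
    kind := fun J y => w.kind J y ∨ J = I ∧ y = x
    inst := fun J => w.inst J ∨ J = I } with hw'
  -- The newly stored record was not accessible, so no displaced record becomes current again.
  have hback : ∀ J y, w.kind J y → M' (objAddr Z.n y) = J → w.M (objAddr Z.n y) = J := by
    intro J y hk e
    by_cases hy : y = x
    · subst hy
      rw [hobjx] at e
      exact absurd (e ▸ h.kind_inst hk) hnI
    · rw [hobj y hy] at e; exact e
  have hkfun : ∀ {J y}, (w.kind J y ∨ J = I ∧ y = x) → w.inst J → w.kind J y := by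
    rintro J y (hk | ⟨rfl, rfl⟩) hJ
    · exact hk
    · exact absurd hJ hnI
  refine ⟨w', ⟨⟨?_, fun q hq => ?_, fun q _ j => hpriv q j, fun _ _ => Iff.rfl, hI.snaps⟩, rfl,
    rfl, hI.count_self, Function.update_self _ _ _, rfl, Or.inl, Or.inl⟩, rfl, hback⟩
  · refine { h with cfg := hI.cfg, valid := hI.valid, kind_fun := ?kf, kind_obj := ?ko, value := ?va, kind_inst := ?ki, cell_inst := ?ci, disp := ?di, flag := ?fl, inst_form := fun hJ => hI.inst_form hJ, cnt_comp := hI.cnt_comp, seen_kind := ?sk, stores := ?st }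
    case kf =>
      rintro J y z (hy | ⟨rfl, rfl⟩) (hz | ⟨e, rfl⟩)
      · exact h.kind_fun hy hz
      · exact absurd (e ▸ h.kind_inst hy) hnI
      · exact absurd (h.kind_inst hz) hnI
      · rfl
    case ko =>
      intro y
      by_cases hy : y = x
      · subst hy; exact .inr ⟨hobjx, rfl⟩
      · left; show w.kind (M' _) y; rw [hobj y hy]; exact h.kind_obj y
    case va =>
      intro y
      show M' (M' (M' _) + 1) = Function.update w.c.mem x u y
      by_cases hy : y = x
      · subst hy
        rw [hobjx, hcell I hIr, hI0, hrec I hIr 1 (by omega), hI1, Function.update_self]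
      · have hk := h.kind_obj y
        rw [hobj y hy, hcell _ (h.isRec (h.kind_inst hk)),
          hrec _ (h.isRec (h.cell_inst hk)) 1 (by omega), Function.update_of_ne hy]
        exact h.value y
    case ki =>
      rintro J y (hk | ⟨rfl, rfl⟩)
      · exact .inl (h.kind_inst hk)
      · exact .inr rfl
    case ci =>
      rintro J y (hk | ⟨rfl, rfl⟩)
      · left; show w.inst (M' J); rw [hcell J (h.isRec (h.kind_inst hk))]; exact h.cell_inst hk
      · right; show M' I = I; rw [hcell I hIr, hI0]
    case di =>
      rintro J y (hk | ⟨rfl, rfl⟩) hn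
      · show Z.DispIn _ J y (M' (M' J + 1)) w.comp _
        rw [hcell J (h.isRec (h.kind_inst hk)), hrec _ (h.isRec (h.cell_inst hk)) 1 (by omega)]
        by_cases hJ : w.M (objAddr Z.n y) = J
        · have hyx : y = x := by
            by_contra hy
            exact hn ((hobj y hy).trans hJ)
          subst hyx
          subst hJ
          -- The record displaced just now: the position is the present one, with nothing behind it.
          refine ⟨w.H, p, [], w.c, rfl, h.cfg, hw, (h.value y).symm, fun r hr => ?_⟩
          have := (hI.interested (I := w.M (objAddr Z.n y)) hr).2
          simp only [open_cons, open_nil, and_true]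
          exact Ne.symm this
        · exact hI.disp (h.disp hk hJ) (fun r hr => hI.interested hr) (fun q K₃ e => by simp at e)
      · exact absurd hobjx hn
    case fl =>
      intro J hJ hn
      exact (hrec J hJ 2 (by omega)).trans (h.flag hJ (fun hh => hn (.inl hh)))
    case sk =>
      intro q J hs
      obtain ⟨y, hy⟩ := h.seen_kind hs
      exact ⟨y, .inl hy⟩
    case st =>
      intro q hq
      have hqp : q ≠ p := by rintro rfl; exact hq ha
      obtain ⟨h1, h2, h3⟩ := h.stores q hq
      refine ⟨(hI.count_ne hqp).trans h1, ?_⟩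
      show Z.S.Stores M' q (Function.update w.c.proc p s q)
      rw [Function.update_of_ne hqp]
      exact ⟨(hpriv q _).trans h2, fun j => (hpriv q _).trans (h3 j)⟩
  · exact
      { Ext.refl q w with
        proc := Function.update_of_ne hq _ _
        cnt := hI.count_ne hq
        kind := Or.inl
        inst := Or.inl
        value := fun hJ => hrec _ (h.isRec hJ) 1 (by omega)
        own := fun _ => ⟨hcell _ (w.isRec_own q), hrec _ (w.isRec_own q) 1 (by omega)⟩
        pos := fun hP => ⟨hP.1, (hI.count_ne hq).trans hP.2.1, hI.pos hq hP.2.2⟩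
        obj := fun hk hn e => hn (hback _ _ hk e)
        cell_ne := fun hk _ hn => by
          show M' _ ≠ _
          rw [hcell _ (h.isRec (h.kind_inst hk))]; exact hn
        cell := fun hk hn => absurd (hcell _ (h.isRec (h.kind_inst hk))) hn
        flag := fun hJ hf => (hrec _ (h.isRec hJ) 2 (by omega)).trans hf }

/-- A successful CAS takes effect by the replacement of the record with the value. -/
lemma commit_cas {w : World Z} (h : w.GI) {p : Fin Z.n} {s : Proc ℕ} {W x u : ℕ}
    (ha : w.act p) (hc : w.cnt p = w.comp p) (hsn : w.seen p W) (hk : w.kind W x)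
    (hI1 : w.M (w.own p + 1) = u) (hu : u ≠ w.M (w.M W + 1)) (hf : w.M (w.M W + 2) = 1)
    (hs : ∀ c : SrcConfig Z.n, c.proc p = w.c.proc p → c.mem x = w.M (w.M W + 1) →
      Z.srcStep c p = some ⟨Function.update c.proc p s, Function.update c.mem x u⟩) :
    ∃ w', Commit p s w w' ∧ w'.M = Function.update w.M W (w.own p) := by
  set I := w.own p with hIdef
  have hnI : ¬w.inst I := h.not_inst_own hc
  have hIr : IsRec Z.n I := w.isRec_own p
  have hWr := h.isRec (h.kind_inst hk)
  set M' := Function.update w.M W I with hM'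
  have hobj : ∀ y, M' (objAddr Z.n y) = w.M (objAddr Z.n y) := fun y =>
    Function.update_of_ne (objAddr_ne_rec y hWr 0 (by omega)) _ _
  have hpriv : ∀ (q : Fin Z.n) j, M' (priv Z.n q j) = w.M (priv Z.n q j) := fun q j =>
    Function.update_of_ne (priv_ne_rec q j hWr 0 (by omega)) _ _
  have hcell : ∀ J, J ≠ W → M' J = w.M J := fun J hJ => Function.update_of_ne hJ _ _
  have hcellW : M' W = I := Function.update_self _ _ _
  have hrec : ∀ J, IsRec Z.n J → ∀ e, 0 < e → e < 3 → M' (J + e) = w.M (J + e) :=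
    fun J hJ e h0 he => Function.update_of_ne (fun e' => by
      have := (rec_inj (f := 0) hJ hWr he (by omega) e').2; omega) _ _
  -- the position at which the instruction takes effect
  obtain ⟨K₁, K₂, c₁, c', hI, h₁, hx₁, hop, hnew, hmem, hwt⟩ : ∃ K₁ K₂ c₁ c',
      Ins w p s none K₁ K₂ c' ∧ Z.cfg K₁ = some c₁ ∧ c₁.mem x = w.M (w.M W + 1) ∧
      (∀ q, q ≠ p → w.Interested W q → Z.Open q (w.comp q) K₂) ∧
      (∀ J q K₃, K₂ = .op q (some J) :: K₃ → J = W) ∧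
      (w.M (objAddr Z.n x) = W ∧ c'.mem = Function.update w.c.mem x u ∨
        w.M (objAddr Z.n x) ≠ W ∧ c'.mem = w.c.mem) ∧
      (w.M (objAddr Z.n x) ≠ W → ∃ q K₃, K₂ = .op q (some W) :: K₃ ∧ Z.WritesAt c₁ q x) := by
    -- If `W` is current, the CAS takes effect at the end of the history. Otherwise it goes just
    -- before the Write that displaced `W`, where by `disp` the value of `x` is the one stored
    -- through `W`.
    by_cases hcur : w.M (objAddr Z.n x) = W
    · have hv := h.value x
      rw [hcur] at hv
      have hI := ins_end h none ha hc (hs w.c rfl hv.symm)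
      exact ⟨w.H, [], w.c, _, hI, h.cfg, hv.symm, fun _ _ _ => by simp, by simp,
        .inl ⟨hcur, rfl⟩, fun hh => absurd hcur hh⟩
    · obtain ⟨H₁, q, H₂, c₁, e, h₁, hw, hv, ho⟩ := h.disp hk hcur
      have ho' := ho p ⟨hc, hsn⟩
      have hp := Open.notMem Z ho'
      have hi := Z.insertable_of_masked (t := none) h₁ (by rw [← e]; exact h.cfg) hp hw
        (hs c₁ (h.proc_of_split e h₁ hp) hv)
      obtain ⟨c0, c', h0, h', -, -⟩ := hi _ [] (List.append_nil _).symm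
      have hI : Ins w p s none H₁ (.op q (some W) :: H₂) c' := ⟨h, ha, hc, e, ho', hi, h'⟩
      refine ⟨H₁, _, c₁, c', hI, h₁, hv, fun r _ hr => ho r hr, ?_, .inr ⟨hcur, hI.mem (by simp)⟩,
        fun _ => ⟨q, H₂, rfl, hw⟩⟩
      intro J r K₃ e3
      simp only [List.cons.injEq, Lbl.op.injEq, Option.some.injEq] at e3
      exact e3.1.2.symm
  have hp₁ := h.proc_of_split hI.split h₁ (Open.notMem Z hI.op)
  have hcfg1 : Z.cfg (K₁ ++ [.op p none]) =
      some ⟨Function.update c₁.proc p s, Function.update c₁.mem x u⟩ := by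
    rw [cfg_append, h₁, Option.bind_some, runFrom_cons_op, hs c₁ hp₁ hx₁]; rfl
  set w' : World Z := { w with
    M := M', H := K₁ ++ .op p none :: K₂, c := c'
    inst := fun J => w.inst J ∨ J = I } with hw'
  refine ⟨w', ⟨⟨?_, fun q hq => ?_, fun q _ j => hpriv q j, fun _ _ => Iff.rfl, hI.snaps⟩, rfl,
    rfl, hI.count_self, ?_, rfl, id, Or.inl⟩, rfl⟩
  · refine { h with cfg := hI.cfg, valid := hI.valid, kind_obj := ?ko, value := ?va, kind_inst := fun hk => .inl (h.kind_inst hk), cell_inst := ?ci, disp := ?di, flag := ?fl, inst_form := fun hJ => hI.inst_form hJ, cnt_comp := hI.cnt_comp, stores := ?st }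
    case ko =>
      intro y
      show w.kind (M' _) y
      rw [hobj y]; exact h.kind_obj y
    case va =>
      intro y
      show M' (M' (M' _) + 1) = c'.mem y
      rw [hobj y]
      by_cases hy : w.M (objAddr Z.n y) = W
      · have hky := h.kind_obj y
        rw [hy] at hky
        obtain rfl := h.kind_fun hk hky
        rcases hmem with ⟨-, e⟩ | ⟨e, -⟩
        · rw [hy, hcellW, hrec I hIr 1 (by omega) (by omega), hI1, e, Function.update_self]
        · exact absurd hy e
      · have hky := h.kind_obj y
        rw [hcell _ hy, hrec _ (h.isRec (h.cell_inst hky)) 1 (by omega) (by omega)]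
        rw [h.value y]
        rcases hmem with ⟨e1, e⟩ | ⟨-, e⟩
        · rw [e, Function.update_of_ne]
          rintro rfl
          exact hy e1
        · rw [e]
    case ci =>
      intro J y hkJ
      by_cases hJ : J = W
      · subst hJ; right; exact hcellW
      · left; show w.inst (M' J); rw [hcell J hJ]; exact h.cell_inst hkJ
    case di =>
      intro J y hkJ hn
      have hn' : w.M (objAddr Z.n y) ≠ J := by rw [← hobj]; exact hn
      show Z.DispIn _ J y (M' (M' J + 1)) w.comp _
      by_cases hJ : J = W
      · subst hJ
        obtain rfl := h.kind_fun hk hkJ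
        obtain ⟨q, K₃, rfl, hwq⟩ := hwt hn'
        rw [hcellW, hrec I hIr 1 (by omega) (by omega), hI1]
        have hqp : q ≠ p := by
          have := Open.notMem Z hI.op
          rintro rfl
          simp at this
        -- The position just before the displacing Write moves behind the inserted CAS, in step with
        -- the value reached through `W`, which is now `u`.
        refine ⟨K₁ ++ [.op p none], q, K₃, _, by simp [hw'], hcfg1, ?_, by simp, fun r hr => ?_⟩
        · unfold WritesAt
          simp only [Function.update_of_ne hqp]
          exact hwq
        · obtain ⟨h1, h2⟩ := hI.interested (I := J) hr
          exact hop r h2 h1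
      · rw [hcell J hJ, hrec _ (h.isRec (h.cell_inst hkJ)) 1 (by omega) (by omega)]
        exact hI.disp (h.disp hkJ hn') (fun r hr => hI.interested hr)
          (fun q K₃ e => absurd (hnew _ _ _ e) hJ)
    case fl =>
      intro J hJ hn
      exact (hrec J hJ 2 (by omega) (by omega)).trans (h.flag hJ (fun hh => hn (.inl hh)))
    case st =>
      intro q hq
      have hqp : q ≠ p := by rintro rfl; exact hq ha
      obtain ⟨h1, h2, h3⟩ := h.stores q hq
      refine ⟨(hI.count_ne hqp).trans h1, ?_⟩
      show Z.S.Stores M' q (c'.proc q)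
      rw [hI.proc_ne hqp]
      exact ⟨(hpriv q _).trans h2, fun j => (hpriv q _).trans (h3 j)⟩
  · have hown : w.own q ≠ W ∨ w.cnt q ≠ w.comp q := by
      by_cases e : w.own q = W
      · right
        intro hq'
        exact h.not_inst_own hq' (e ▸ h.kind_inst hk)
      · exact .inl e
    exact
      { Ext.refl q w with
        proc := hI.proc_ne hq
        cnt := hI.count_ne hq
        inst := Or.inl
        value := fun hJ => hrec _ (h.isRec hJ) 1 (by omega) (by omega)
        own := fun hq' => ⟨hcell _ (hown.resolve_right (not_not.mpr hq')),
          hrec _ (w.isRec_own q) 1 (by omega) (by omega)⟩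
        pos := fun hP => ⟨hP.1, (hI.count_ne hq).trans hP.2.1, hI.pos hq hP.2.2⟩
        obj := fun hkJ hn => by show M' _ ≠ _; rw [hobj]; exact hn
        cell_ne := fun {J y J'} hkJ hJ' hn => by
          show M' J ≠ J'
          by_cases e : J = W
          -- The only cell that changes receives a record that was not accessible before.
          · subst e; rw [hcellW]; rintro rfl; exact hnI hJ'
          · rw [hcell J e]; exact hn
        cell := fun {J y} hkJ hn => by
          have e : J = W := by
            by_contra e
            exact hn (hcell J e)
          subst e
          obtain rfl := h.kind_fun hk hkJ
          refine ⟨?_, fun h1 h2 h3 => ⟨h2, (hI.count_ne hq).trans h3, ?_⟩⟩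
          · show M' (w.M J + 2) = 1
            rw [hrec _ (h.isRec (h.cell_inst hk)) 2 (by omega) (by omega)]; exact hf
          -- Right after this CAS the value is `u`, which differs from the replaced one; there a
          -- competing CAS of `q` can fail.
          · exact ⟨K₁ ++ [.op p none], K₂, _, by simp [hw'], hcfg1, hop q hq ⟨h3, h1⟩,
              by simpa using hu⟩
        flag := fun hJ hf' => (hrec _ (h.isRec hJ) 2 (by omega) (by omega)).trans hf' }
  · show c'.proc p = s
    rw [hI.proc, Function.update_self]

end World
end Setup
end PPM

namespace PPM
namespace Setup
namespace World

variable {Z : Setup}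

/-! ### Assertions -/

/-- The private persistent memory of `p`. -/
def view (p : Fin Z.n) (w : World Z) (j : ℕ) : ℕ := w.M (priv Z.n p j)

/-- Stability under interference by the other processes. -/
def Stable (p : Fin Z.n) (Γ : World Z → Prop) : Prop := ∀ w w', Ext p w w' → Γ w → Γ w'

lemma Stable.and {p : Fin Z.n} {Γ Γ' : World Z → Prop} (h : Stable p Γ) (h' : Stable p Γ') :
    Stable p fun w => Γ w ∧ Γ' w := fun w w' he hw => ⟨h w w' he hw.1, h' w w' he hw.2⟩

/-- `p` is in the middle of its Write of `u` to `x`; the record to be replaced is `old`. -/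
def MidWrite (p : Fin Z.n) (st : Proc ℕ) (x old u : ℕ) (w : World Z) : Prop :=
  w.act p ∧ w.seen p old ∧ w.kind old x ∧
    (w.cnt p = w.comp p ∧ w.c.proc p = st ∧ w.M (w.own p) = w.own p ∧ w.M (w.own p + 1) = u ∨
      w.cnt p = w.comp p + 1 ∧ w.c.proc p = ⟨st.pc + 1, st.vars⟩ ∧ w.M (objAddr Z.n x) ≠ old)

lemma stable_midWrite (p : Fin Z.n) (st : Proc ℕ) (x old u : ℕ) :
    Stable p (MidWrite p st x old u) := by
  rintro w w' h ⟨h1, h2, h3, h4⟩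
  refine ⟨h.act h1, h.seen h2, h.kind h3, ?_⟩
  rw [h.cnt, h.comp, h.proc, h.own_eq]
  rcases h4 with ⟨a, b, c, d⟩ | ⟨a, b, c⟩
  · exact .inl ⟨a, b, (h.own a).1.trans c, (h.own a).2.trans d⟩
  · exact .inr ⟨a, b, h.obj h3 c⟩

/-- `p` is in the middle of its CAS on `x` that should change the value `e` to `u`, by the
replacement of `old` in the record `W`. -/
def MidCas (p : Fin Z.n) (st st₁ : Proc ℕ) (x W old e u : ℕ) (w : World Z) : Prop :=
  w.act p ∧ w.seen p W ∧ w.kind W x ∧ w.inst old ∧ w.M (old + 1) = e ∧ u ≠ e ∧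
    (w.cnt p = w.comp p ∧ w.c.proc p = st ∧ w.M (w.own p + 1) = u ∧
        (w.M W = old ∨ w.M W ≠ old ∧ w.Pos p fun mem => mem x ≠ e) ∨
      w.cnt p = w.comp p + 1 ∧ w.c.proc p = st₁ ∧ w.M W ≠ old ∧ w.inst (w.own p) ∧
        (w.M W = w.own p ∨ w.M (w.own p + 2) = 1))

/-- Both disjunctions rest on `Ext.cell`. Before the CAS has taken effect, losing `old` yields a
position at which the value is not `e`; afterwards, losing the own record leaves its flag set. -/
lemma stable_midCas (p : Fin Z.n) (st st₁ : Proc ℕ) (x W old e u : ℕ) :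
    Stable p (MidCas p st st₁ x W old e u) := by
  rintro w w' h ⟨h1, h2, h3, h4, h5, h6, h7⟩
  refine ⟨h.act h1, h.seen h2, h.kind h3, h.inst h4, (h.value h4).trans h5, h6, ?_⟩
  rw [h.cnt, h.comp, h.proc, h.own_eq]
  rcases h7 with ⟨a, b, c, d⟩ | ⟨a, b, c, d, f⟩
  · refine .inl ⟨a, b, (h.own a).2.trans c, ?_⟩
    rcases d with d | ⟨d1, d2⟩
    · by_cases hW : w'.M W = old
      · exact .inl hW
      · have := (h.cell h3 (by rw [d]; exact hW)).2 h2 h1 a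
        rw [d, h5] at this
        exact .inr ⟨hW, this⟩
    · exact .inr ⟨h.cell_ne h3 h4 d1, h.pos d2⟩
  · refine .inr ⟨a, b, h.cell_ne h3 h4 c, h.inst d, ?_⟩
    rcases f with f | f
    · by_cases hW : w'.M W = w.own p
      · exact .inl hW
      · have := (h.cell h3 (by rw [f]; exact hW)).1
        rw [f] at this
        exact .inr this
    · exact .inr (h.flag d f)

/-- The current instruction of `p` has taken effect with the resulting local state `s`, or it can
do so at some earlier time. -/
def CanFinish (p : Fin Z.n) (s : Proc ℕ) (w : World Z) : Prop :=
  w.act p ∧ (w.cnt p = w.comp p + 1 ∧ w.c.proc p = s ∨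
    w.cnt p = w.comp p ∧ ∃ st, w.c.proc p = st ∧
      ((∃ φ, w.Pos p φ ∧ ∀ c : SrcConfig Z.n, c.proc p = st → φ c.mem →
          Z.srcStep c p = some ⟨Function.update c.proc p s, c.mem⟩) ∨
        ∃ I x u, w.seen p I ∧ w.kind I x ∧ w.M (objAddr Z.n x) ≠ I ∧
          ∀ c : SrcConfig Z.n, c.proc p = st → Z.WritesAt c p x ∧
            Z.srcStep c p = some ⟨Function.update c.proc p s, Function.update c.mem x u⟩))

lemma stable_canFinish (p : Fin Z.n) (s : Proc ℕ) : Stable p (CanFinish p s) := by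
  rintro w w' h ⟨h1, h2⟩
  refine ⟨h.act h1, ?_⟩
  rw [h.cnt, h.comp, h.proc]
  rcases h2 with h2 | ⟨a, st, b, ⟨φ, c, d⟩ | ⟨I, x, u, c, d, e, f⟩⟩
  · exact .inl h2
  · exact .inr ⟨a, st, b, .inl ⟨φ, h.pos c, d⟩⟩
  · exact .inr ⟨a, st, b, .inr ⟨I, x, u, h.seen c, h.kind d, h.obj d e, f⟩⟩

/-- The persistent memory does not change, so this can be done at any convenient moment; it is done
at the boundary. -/
lemma CanFinish.commit {p : Fin Z.n} {s : Proc ℕ} {w : World Z} (h : CanFinish p s w)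
    (hG : w.GI) : ∃ w', Commit p s w w' ∧ w'.M = w.M := by
  obtain ⟨ha, ⟨h1, h2⟩ | ⟨a, st, b, ⟨φ, c, d⟩ | ⟨I, x, u, c, d, e, f⟩⟩⟩ := h
  · exact ⟨w, ⟨Step.refl p hG, rfl, rfl, h1, h2, rfl, id, id⟩, rfl⟩
  · exact commit_pos hG c (fun c hc => d c (hc.trans b))
  · exact commit_masked hG ha a c d e (fun c hc => f c (hc.trans b))

/-- `p` is between two instructions or in the first capsule of its current one. -/
def Rec₁ (p : Fin Z.n) (pm : ℕ → ℕ) (w : World Z) : Prop :=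
  ∃ st, pm 0 = priv Z.n p 1 ∧ pm 1 = st.pc * 89 ∧ pm 2 = st.pc ∧ pm 3 = w.own p ∧
    (∀ j, pm (11 + j) = st.vars j) ∧ w.c.proc p = st ∧ w.cnt p = w.comp p

def casState (st : Proc ℕ) (d b : ℕ) : Proc ℕ := ⟨st.pc + 1, Function.update st.vars d b⟩

/-- `p` is in the second capsule of a Write or CAS. -/
def Rec₂ (p : Fin Z.n) (pm : ℕ → ℕ) (w : World Z) : Prop :=
  ∃ st i, (Z.A p)[st.pc]? = some i ∧ pm 0 = priv Z.n p 1 ∧ pm 1 = st.pc * 89 + 49 ∧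
    (∀ j, pm (11 + j) = st.vars j) ∧ pm 6 = st.pc + 1 ∧ pm 7 = w.own p ∧
    ((∃ a b, i = .base (.write a b) ∧ pm 5 = priv Z.n p 10 ∧ pm 8 = objAddr Z.n (st.vars a) ∧
        MidWrite p st (st.vars a) (pm 9) (st.vars b) w) ∨
      ∃ d a e u, i = .base (.cas d a e u) ∧ pm 5 = priv Z.n p (11 + d) ∧
        MidCas p st (casState st d 1) (st.vars a) (pm 8) (pm 9) (st.vars e) (st.vars u) w)

/-- `p` is in the last capsule of its instruction. -/
def Rec₃ (p : Fin Z.n) (pm : ℕ → ℕ) (w : World Z) : Prop :=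
  ∃ s i st k, (Z.A p)[s]? = some i ∧ pm 0 = priv Z.n p 1 ∧ pm 1 = s * 89 + 69 ∧
    10 ≤ k ∧ pm 5 = priv Z.n p k ∧ pm 6 = st.pc ∧
    (∀ j, st.vars j = Function.update pm k (pm 4) (11 + j)) ∧ pm 7 = w.own p ∧ CanFinish p st w

/-- Only private persistent memory is mentioned, never registers: this is what a process can resume
from after losing its volatile memory. -/
def Rec (p : Fin Z.n) (pm : ℕ → ℕ) (w : World Z) : Prop :=
  Rec₁ p pm w ∨ Rec₂ p pm w ∨ Rec₃ p pm w

lemma stable_rec₁ (p : Fin Z.n) (pm : ℕ → ℕ) : Stable p (Rec₁ p pm) := by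
  rintro w w' h ⟨st, h1, h2, h3, h4, h5, h6, h7⟩
  exact ⟨st, h1, h2, h3, by rw [h.own_eq]; exact h4, h5, h.proc.trans h6,
    by rw [h.cnt, h.comp]; exact h7⟩

lemma stable_rec₂ (p : Fin Z.n) (pm : ℕ → ℕ) : Stable p (Rec₂ p pm) := by
  rintro w w' h ⟨st, i, h1, h2, h3, h4, h5, h6, h7⟩
  refine ⟨st, i, h1, h2, h3, h4, h5, by rw [h.own_eq]; exact h6, ?_⟩
  rcases h7 with ⟨a, b, g1, g2, g3, g4⟩ | ⟨d, a, e, u, g1, g2, g3⟩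
  · exact .inl ⟨a, b, g1, g2, g3, stable_midWrite _ _ _ _ _ _ _ h g4⟩
  · exact .inr ⟨d, a, e, u, g1, g2, stable_midCas _ _ _ _ _ _ _ _ _ _ h g3⟩

lemma stable_rec₃ (p : Fin Z.n) (pm : ℕ → ℕ) : Stable p (Rec₃ p pm) := by
  rintro w w' h ⟨s, i, st, k, h1, h2, h3, h4, h5, h6, h7, h8, h9⟩
  exact ⟨s, i, st, k, h1, h2, h3, h4, h5, h6, h7, by rw [h.own_eq]; exact h8,
    stable_canFinish _ _ _ _ h h9⟩

lemma stable_rec (p : Fin Z.n) (pm : ℕ → ℕ) : Stable p (Rec p pm) := by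
  rintro w w' h (h1 | h1 | h1)
  · exact .inl (stable_rec₁ _ _ _ _ h h1)
  · exact .inr (.inl (stable_rec₂ _ _ _ _ h h1))
  · exact .inr (.inr (stable_rec₃ _ _ _ _ h h1))

/-! ### States of the simulating program -/

def Active (x : Z.Trk) (p : Fin Z.n) : Prop :=
  x.idle p = false ∧ ¬(Z.S.translate Z.A).Halted x.config p

/-- The world `w` describes the state `x`. -/
structure Good (x : Z.Trk) (w : World Z) : Prop where
  mem : w.M = x.config.mem
  comp : w.comp = x.completed
  act : ∀ q, w.act q ↔ Active x q
  halt : ∀ q, (Z.S.translate Z.A).Halted x.config q → Z.A.Halted w.c q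
  gi : w.GI

/-- The effect of a step of `p` that leads to the state `y`. -/
structure Trans (p : Fin Z.n) (w w' : World Z) (y : Z.Trk) : Prop where
  good : Good y w'
  ext : ∀ q, q ≠ p → Ext q w w'
  view : ∀ q, q ≠ p → view q w' = view q w
  snaps : snaps w'.H = snaps w.H ++ [y]

/-- All changes of the world caused by one event are collected in `w₁` before the new state is
appended. It then suffices to check the data of `p`. -/
lemma Good.record {x y : Z.Trk} {w w₁ : World Z} {p : Fin Z.n} (h : Good x w) (hs : Step p w w₁)
    (hproc : ∀ q, q ≠ p → y.config.proc q = x.config.proc q)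
    (hidle : ∀ q, q ≠ p → y.idle q = x.idle q)
    (hmem : w₁.M = y.config.mem) (hcomp : w₁.comp = y.completed) (hact : w₁.act p ↔ Active y p)
    (hhalt : (Z.S.translate Z.A).Halted y.config p → Z.A.Halted w₁.c p) :
    Trans p w (w₁.record y) y ∧ Ext p w₁ (w₁.record y) := by
  have hH : ∀ q, q ≠ p → ((Z.S.translate Z.A).Halted y.config q ↔
      (Z.S.translate Z.A).Halted x.config q) := fun q hq => by
    simp only [PProgram.Halted, hproc q hq]
  have hA : ∀ q, w₁.act q ↔ Active y q := fun q => by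
    by_cases hq : q = p
    · subst hq; exact hact
    · rw [hs.act q hq, h.act q]
      simp only [Active, hH q hq, hidle q hq]
  have hhalt' : ∀ q, (Z.S.translate Z.A).Halted y.config q → Z.A.Halted w₁.c q := fun q hh => by
    by_cases hq : q = p
    · subst hq; exact hhalt hh
    · have := h.halt q ((hH q hq).mp hh)
      simpa only [SrcProgram.Halted, (hs.ext q hq).proc] using this
  have hSnap : Z.SnapOK y w₁.c w₁.cnt := fun q => by
    have h1 := hs.gi.cnt_comp q
    rw [← hcomp]
    refine ⟨by omega, by omega, fun hh => ?_, hhalt' q⟩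
    have := hs.gi.stores q (by
      rw [hA q, Active]
      rcases hh with hh | hh
      · simp [hh]
      · simp [hh])
    rw [hmem] at this
    exact this
  obtain ⟨g1, g2⟩ := gi_record hs.gi hSnap (fun q hq => by
    have := (hA q).mp hq
    exact ⟨this.1, this.2, by rw [hcomp]⟩)
  refine ⟨⟨⟨hmem, hcomp, hA, hhalt', g1⟩, fun q hq => (hs.ext q hq).trans h.gi (g2 q),
    fun q hq => funext fun j => hs.priv q hq j, ?_⟩, g2 p⟩
  show snaps (w₁.H ++ [.snap y]) = _
  rw [snaps_append, hs.snaps]; rfl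

/-- The accesses to persistent memory respect locality. -/
def LocOK (p : Fin Z.n) (i : SrcInstr Z.Op) (ins : PInstr Z.Op Z.v) (vars : Fin Z.v → ℕ) : Prop :=
  ∀ a, ins.address vars = some a →
    (∀ q, ownerOf Z.n a = some q → q = p) ∧ (i.isLocal = true → ownerOf Z.n a = some p)

/-- `p` has just executed a capsule boundary. -/
def AfterB (p : Fin Z.n) (x : Z.Trk) (w : World Z) : Prop :=
  Rec₁ p (view p w) w ∧ ∃ s i, (Z.A p)[s]? = some i ∧ (x.config.proc p).pc = s * 89 + 88 ∧
    (x.config.proc p).vars (reg Z.hv 3) = view p w 1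

/-- The state of the simulating program after an event. -/
def track (x : Z.Trk) (e : Event Z.v Z.n) : Option Z.Trk := Z.S.track Z.interp Z.ctx Z.A x e

/-- Whatever the other processes do, `p` completes its current instruction within `m` steps unless
it crashes. -/
def Safe (p : Fin Z.n) : ℕ → Z.Trk → World Z → Prop
  | 0, _, _ => False
  | m + 1, x, w => Rec p (view p w) w ∧ ∀ x' w', Ext p w w' → view p w' = view p w →
      x'.config.proc p = x.config.proc p → Good x' w' →
      ∃ s j i ins, (x.config.proc p).pc = s * 89 + j ∧ j < 89 ∧ (Z.A p)[s]? = some i ∧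
        (blockCode Z.hv Z.n p s i)[j]? = some ins ∧ LocOK p i ins (x.config.proc p).vars ∧
        ∀ y, track x' (.step p) = some y → ∃ w'', Trans p w' w'' y ∧
          ((j = 87 ∧ AfterB p y w'') ∨ (j ≠ 87 ∧ Safe p m y w''))

/-- Interference is built into `Safe`, so moves of other processes cost `p` none of its remaining
steps. -/
lemma Safe.ext {p : Fin Z.n} {m : ℕ} {x x' : Z.Trk} {w w' : World Z} (h : Safe p m x w)
    (hG : w.GI) (he : Ext p w w') (hv : view p w' = view p w)
    (hx : x'.config.proc p = x.config.proc p) : Safe p m x' w' := by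
  cases m with
  | zero => exact h
  | succ m =>
    refine ⟨by rw [hv]; exact stable_rec _ _ _ _ he h.1, fun x'' w'' he' hv' hx' hg => ?_⟩
    rw [hx]
    exact h.2 x'' w'' (he.trans hG he') (hv'.trans hv) (hx'.trans hx) hg

lemma Safe.mono {p : Fin Z.n} : ∀ {m k : ℕ} {x : Z.Trk} {w : World Z}, Safe p m x w → m ≤ k →
    Safe p k x w
  | 0, _, _, _, h, _ => h.elim
  | m + 1, 0, _, _, _, hk => by omega
  | m + 1, k + 1, x, w, h, hk => by
      refine ⟨h.1, fun x' w' a b c d => ?_⟩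
      obtain ⟨s, j, i, ins, h1, h2, h3, h4, h5, h6⟩ := h.2 x' w' a b c d
      refine ⟨s, j, i, ins, h1, h2, h3, h4, h5, fun y hy => ?_⟩
      obtain ⟨w'', g1, g2⟩ := h6 y hy
      exact ⟨w'', g1, g2.imp id (fun g => ⟨g.1, Safe.mono g.2 (by omega)⟩)⟩

/-- The result of a step at offset `j` of a block. -/
lemma track_step {x y : Z.Trk} {p : Fin Z.n} {s j : ℕ} {i : SrcInstr Z.Op}
    {I : Instr Z.Op (Fin Z.v)} (hi : (Z.A p)[s]? = some i) (hj : j < 89)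
    (hpc : (x.config.proc p).pc = s * 89 + j)
    (hc : (blockCode Z.hv Z.n p s i)[j]? = some (.base I)) (hy : track x (.step p) = some y) :
    y = ⟨⟨Function.update x.config.proc p (I.exec Z.interp (x.config.proc p) x.config.mem).1,
        x.config.flag, (I.exec Z.interp (x.config.proc p) x.config.mem).2⟩,
      if j = 87 then Function.update x.completed p (x.completed p + 1) else x.completed,
      Function.update x.idle p (decide (j = 87))⟩ := by
  have h1 : (Z.S.translate Z.A p)[(x.config.proc p).pc]? = some (.base I) := by
    rw [hpc, Z.translate_getElem?_some hi hj, hc]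
  have h2 : Z.S.AtBoundary x.config p ↔ j = 87 := by
    show (x.config.proc p).pc % 89 = 87 ↔ j = 87
    rw [hpc, Nat.mul_add_mod_self_right, Nat.mod_eq_of_lt hj]
  simp only [track, Simulator.track, PProgram.next, h1, Option.map_some, Option.some.injEq,
    h2] at hy
  rw [← hy]
  split_ifs with h <;> simp [h]

/-! ### Rules for the steps inside a block -/

section Rules

variable (p : Fin Z.n) (s : ℕ) (i : SrcInstr Z.Op)

/-- If `p` is at offset `j` of its block with registers `rv`, private memory `pm` and
assertion `Γ`, then it completes its instruction within `m` steps. -/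
def T (m j : ℕ) (rv : Fin 16 → ℕ) (pm : ℕ → ℕ) (Γ : World Z → Prop) : Prop :=
  ∀ x w, Good x w → view p w = pm → Γ w → (x.config.proc p).pc = s * 89 + j →
    (∀ k, (x.config.proc p).vars (reg Z.hv k) = rv k) → Safe p m x w

/-- The assertion is stable and allows a restart. -/
structure Ok (pm : ℕ → ℕ) (Γ : World Z → Prop) : Prop where
  stable : Stable p Γ
  rc : ∀ w, w.GI → Γ w → Rec p pm w

/-- The result of executing an instruction in the world `w`. -/
def Next (m : ℕ) (w : World Z) (r : Proc (Fin Z.v) × (ℕ → ℕ)) : Prop :=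
  ∃ (w₁ : World Z) (j : ℕ) (rv : Fin 16 → ℕ) (pm : ℕ → ℕ) (Γ : World Z → Prop),
    Step p w w₁ ∧ w₁.M = r.2 ∧ w₁.comp = w.comp ∧ w₁.act p ∧ view p w₁ = pm ∧ Stable p Γ ∧ Γ w₁ ∧
    r.1.pc = s * 89 + j ∧ j < 89 ∧ (∀ k, r.1.vars (reg Z.hv k) = rv k) ∧ T p s m j rv pm Γ

variable {p s i}

/-- The general rule for one instruction before the boundary: interference, the change `Next` made
by `p`, then recording of the new state. -/
lemma T.step (hi : (Z.A p)[s]? = some i) {m j : ℕ} {rv : Fin 16 → ℕ} {pm : ℕ → ℕ}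
    {Γ : World Z → Prop} {I : Instr Z.Op (Fin Z.v)}
    (hc : (blockCode Z.hv Z.n p s i)[j]? = some (.base I)) (hj : j < 87) (hok : Ok p pm Γ)
    (hloc : ∀ (w : World Z) vars, w.GI → Γ w → (∀ k, vars (reg Z.hv k) = rv k) →
      LocOK p i (.base I) vars)
    (hnext : ∀ (w : World Z) vars, w.GI → w.act p → view p w = pm → Γ w →
      (∀ k, vars (reg Z.hv k) = rv k) →
      Next p s m w (I.exec Z.interp ⟨s * 89 + j, vars⟩ w.M)) :
    T p s (m + 1) j rv pm Γ := by
  intro x w hg hv hΓ hpc hr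
  refine ⟨by rw [hv]; exact hok.rc w hg.gi hΓ, fun x' w' he hv' hx hg' => ?_⟩
  have hΓ' := hok.stable _ _ he hΓ
  refine ⟨s, j, i, .base I, hpc, by omega, hi, hc, hloc w _ hg.gi hΓ hr, fun y hy => ?_⟩
  have hy' := track_step hi (by omega) (by rw [hx]; exact hpc) hc hy
  -- Any such step ends idleness; the activation has no effect if `p` is active already.
  obtain ⟨ha1, ha2⟩ := step_activate hg'.gi p
  have hΓ2 := hok.stable _ _ ha2 hΓ'
  obtain ⟨w₁, j', rv', pm', Γ', n1, n2, n3, n4, n5, n6, n7, n8, n9, n10, n11⟩ :=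
    hnext (w'.activate p) (x.config.proc p).vars ha1.gi (.inr rfl) (hv'.trans hv) hΓ2 hr
  have hpr : x'.config.proc p = ⟨s * 89 + j, (x.config.proc p).vars⟩ := by
    rw [hx, ← hpc]
  have hm : (w'.activate p).M = x'.config.mem := hg'.mem
  rw [hm, ← hpr] at n2 n8 n10
  have hproc : y.config.proc p = (I.exec Z.interp (x'.config.proc p) x'.config.mem).1 := by
    rw [hy']; simp
  have hnh : ¬(Z.S.translate Z.A).Halted y.config p := by
    unfold PProgram.Halted
    rw [hproc, n8]
    exact Z.translate_isSome hi n9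
  have hj87 : j ≠ 87 := by omega
  obtain ⟨t1, t2⟩ := hg'.record (y := y) (ha1.trans hg'.gi n1)
    (fun q hq => by rw [hy']; exact Function.update_of_ne hq _ _)
    (fun q hq => by rw [hy']; exact Function.update_of_ne hq _ _)
    (by rw [hy']; exact n2)
    (by rw [hy', n3]; simp only [hj87, if_false]; exact hg'.comp)
    (by
      refine ⟨fun _ => ⟨?_, hnh⟩, fun _ => n4⟩
      rw [hy']; simp [hj87])
    (fun hh => absurd hh hnh)
  refine ⟨_, t1, .inr ⟨hj87, n11 _ _ t1.good n5 (n6 _ _ t2 n7) (by rw [hproc]; exact n8)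
    (fun k => by rw [hproc]; exact n10 k)⟩⟩

lemma T.weaken {m j : ℕ} {rv : Fin 16 → ℕ} {pm : ℕ → ℕ} {Γ Γ' : World Z → Prop}
    (h : T p s m j rv pm Γ') (hw : ∀ w : World Z, w.GI → view p w = pm → Γ w → Γ' w) :
    T p s m j rv pm Γ := fun x w hg hv hΓ => h x w hg hv (hw w hg.gi hv hΓ)

lemma T.mono {m k j : ℕ} {rv : Fin 16 → ℕ} {pm : ℕ → ℕ} {Γ : World Z → Prop}
    (h : T p s m j rv pm Γ) (hk : m ≤ k) : T p s k j rv pm Γ :=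
  fun x w hg hv hΓ hpc hr => (h x w hg hv hΓ hpc hr).mono hk

lemma reg_ne {k d : Fin 16} (h : k ≠ d) : reg Z.hv k ≠ reg Z.hv d := fun e =>
  h (Fin.castLE_injective Z.hv e)

lemma update_reg {vars : Fin Z.v → ℕ} {rv : Fin 16 → ℕ} (h : ∀ k, vars (reg Z.hv k) = rv k)
    (d : Fin 16) (u : ℕ) (k : Fin 16) :
    Function.update vars (reg Z.hv d) u (reg Z.hv k) = Function.update rv d u k := by
  by_cases e : k = d
  · subst e; simp
  · rw [Function.update_of_ne (reg_ne e), Function.update_of_ne e, h]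

lemma locOK_of_none {I : PInstr Z.Op Z.v} (vars : Fin Z.v → ℕ) (h : I.address vars = none) :
    LocOK p i I vars := fun a ha => by rw [h] at ha; simp at ha

lemma locOK_of_priv {I : PInstr Z.Op Z.v} (vars : Fin Z.v → ℕ) {j : ℕ}
    (h : I.address vars = some (priv Z.n p j)) : LocOK p i I vars := fun a ha => by
  rw [h] at ha
  obtain rfl := Option.some.inj ha
  rw [ownerOf_priv]
  exact ⟨fun q hq => (Option.some.inj hq).symm, fun _ => rfl⟩

lemma locOK_of_shared {I : PInstr Z.Op Z.v} (vars : Fin Z.v → ℕ) {a : ℕ}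
    (h : I.address vars = some a) (ha : ownerOf Z.n a = none) (hi : i.isLocal = false) :
    LocOK p i I vars := fun b hb => by
  rw [h] at hb
  obtain rfl := Option.some.inj hb
  rw [ha, hi]
  simp

section Basic

variable {m j : ℕ} {rv : Fin 16 → ℕ} {pm : ℕ → ℕ} {Γ : World Z → Prop} {d a b e : Fin 16}

lemma T.silent (hi : (Z.A p)[s]? = some i) {I : Instr Z.Op (Fin Z.v)}
    (hc : (blockCode Z.hv Z.n p s i)[j]? = some (.base I)) (hj : j < 87) (hok : Ok p pm Γ)
    (hloc : ∀ vars, (∀ k, vars (reg Z.hv k) = rv k) → LocOK p i (.base I) vars)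
    (j' : ℕ) (rv' : Fin 16 → ℕ) (hj' : j' < 89)
    (hnext : ∀ (w : World Z) vars, view p w = pm → (∀ k, vars (reg Z.hv k) = rv k) →
      ∃ vars', I.exec Z.interp ⟨s * 89 + j, vars⟩ w.M = (⟨s * 89 + j', vars'⟩, w.M) ∧
        ∀ k, vars' (reg Z.hv k) = rv' k)
    (h : T p s m j' rv' pm Γ) : T p s (m + 1) j rv pm Γ := by
  refine T.step hi hc hj hok (fun w vars _ _ hr => hloc vars hr) (fun w vars hG ha hv hΓ hr => ?_)
  obtain ⟨vars', e1, e2⟩ := hnext w vars hv hr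
  rw [e1]
  exact ⟨w, j', rv', pm, Γ, Step.refl p hG, rfl, rfl, ha, hv, hok.stable, hΓ, rfl, hj', e2, h⟩

lemma T.const (hi : (Z.A p)[s]? = some i) {u : ℕ}
    (hc : (blockCode Z.hv Z.n p s i)[j]? = some (.base (.const (reg Z.hv d) u))) (hj : j < 87)
    (hok : Ok p pm Γ) (h : T p s m (j + 1) (Function.update rv d u) pm Γ) :
    T p s (m + 1) j rv pm Γ :=
  T.silent hi hc hj hok (fun vars _ => locOK_of_none vars rfl) _ _ (by omega)
    (fun _ _ _ hr => ⟨_, rfl, update_reg hr d u⟩) h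

lemma T.alu (hi : (Z.A p)[s]? = some i) {f : Alu Z.Op}
    (hc : (blockCode Z.hv Z.n p s i)[j]? =
      some (.base (.alu f (reg Z.hv d) (reg Z.hv a) (reg Z.hv b)))) (hj : j < 87)
    (hok : Ok p pm Γ) {u : ℕ} (hu : f.eval Z.interp (rv a) (rv b) = u)
    (h : T p s m (j + 1) (Function.update rv d u) pm Γ) :
    T p s (m + 1) j rv pm Γ :=
  T.silent hi hc hj hok (fun vars _ => locOK_of_none vars rfl) _ _ (by omega)
    (fun _ _ _ hr => ⟨_, rfl, fun k => by rw [← hu, ← hr a, ← hr b]; exact update_reg hr d _ k⟩) h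

lemma T.jump_eq (hi : (Z.A p)[s]? = some i) {l : ℕ}
    (hc : (blockCode Z.hv Z.n p s i)[j]? =
      some (.base (.jumpEq (reg Z.hv a) (reg Z.hv b) (s * 89 + l)))) (hj : j < 87)
    (hok : Ok p pm Γ) (hl : l < 89) (hab : rv a = rv b) (h : T p s m l rv pm Γ) :
    T p s (m + 1) j rv pm Γ :=
  T.silent hi hc hj hok (fun vars _ => locOK_of_none vars rfl) _ _ hl
    (fun _ vars _ hr => ⟨vars, by simp [Instr.exec, hr, hab], hr⟩) h

lemma T.jump_ne (hi : (Z.A p)[s]? = some i) {l : ℕ}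
    (hc : (blockCode Z.hv Z.n p s i)[j]? =
      some (.base (.jumpEq (reg Z.hv a) (reg Z.hv b) l))) (hj : j < 87)
    (hok : Ok p pm Γ) (hab : rv a ≠ rv b) (h : T p s m (j + 1) rv pm Γ) :
    T p s (m + 1) j rv pm Γ :=
  T.silent hi hc hj hok (fun vars _ => locOK_of_none vars rfl) (j + 1) _ (by omega)
    (fun _ vars _ hr => ⟨vars, by simp [Instr.exec, hr, hab, add_assoc], hr⟩) h

lemma T.jump_to (hi : (Z.A p)[s]? = some i) {l : ℕ}
    (hc : (blockCode Z.hv Z.n p s i)[j]? = some (.base (.jumpTo (reg Z.hv a)))) (hj : j < 87)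
    (hok : Ok p pm Γ) (hl : l < 89) (ha : rv a = s * 89 + l) (h : T p s m l rv pm Γ) :
    T p s (m + 1) j rv pm Γ :=
  T.silent hi hc hj hok (fun vars _ => locOK_of_none vars rfl) _ _ hl
    (fun _ vars _ hr => ⟨vars, by simp [Instr.exec, hr, ha], hr⟩) h

lemma T.read_priv (hi : (Z.A p)[s]? = some i) (k : ℕ)
    (hc : (blockCode Z.hv Z.n p s i)[j]? =
      some (.base (.read (reg Z.hv d) (reg Z.hv a)))) (hj : j < 87)
    (hok : Ok p pm Γ) (ha : rv a = priv Z.n p k)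
    {u : ℕ} (hu : pm k = u) (h : T p s m (j + 1) (Function.update rv d u) pm Γ) : T p s (m + 1) j rv pm Γ :=
  T.silent hi hc hj hok
    (fun vars hr => locOK_of_priv vars (j := k) (by simp [PInstr.address, Instr.address, hr, ha]))
    _ _ (by omega)
    (fun w vars hv hr => ⟨_, rfl, fun k => by
      rw [update_reg hr]
      simp only [hr a, ha]
      rw [← hu, ← hv]; rfl⟩) h

lemma view_update_priv (w : World Z) (k u : ℕ) :
    view p (w.setMem (Function.update w.M (priv Z.n p k) u)) =
      Function.update (view p w) k u := by
  funext j
  by_cases e : j = k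
  · subst e; simp [view, setMem]
  · simp [view, setMem, e]

lemma T.write_priv (hi : (Z.A p)[s]? = some i) (k : ℕ)
    (hc : (blockCode Z.hv Z.n p s i)[j]? =
      some (.base (.write (reg Z.hv a) (reg Z.hv b)))) (hj : j < 87)
    (hok : Ok p pm Γ) (ha : rv a = priv Z.n p k)
    {u : ℕ} (hb : rv b = u) (h : T p s m (j + 1) rv (Function.update pm k u) Γ) : T p s (m + 1) j rv pm Γ := by
  refine T.step hi hc hj hok (fun w vars _ _ hr => locOK_of_priv vars (j := k)
    (by simp [PInstr.address, Instr.address, hr, ha])) (fun w vars hG hact hv hΓ hr => ?_)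
  subst hb
  obtain ⟨h1, h2⟩ := step_priv hG hact k (rv b)
  refine ⟨_, j + 1, rv, _, Γ, h1, ?_, rfl, hact, ?_, hok.stable, hok.stable _ _ h2 hΓ, rfl,
    by omega, hr, h⟩
  · simp only [Instr.exec, hr, ha]; rfl
  · rw [view_update_priv, hv]

lemma view_eq_of_step {w w' : World Z} {a u : ℕ} (h : w'.M = Function.update w.M a u)
    (ha : ownerOf Z.n a = none) : view p w' = view p w := by
  funext j
  unfold view
  rw [h, Function.update_of_ne]
  rintro rfl
  rw [ownerOf_priv] at ha
  simp at ha

/-- The new assertion depends on the word that is read, and the bookkeeping may change at the same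
instant, for example to note that a record has been seen. -/
lemma T.read_shared (hi : (Z.A p)[s]? = some i) {Γ' : ℕ → World Z → Prop}
    (hc : (blockCode Z.hv Z.n p s i)[j]? =
      some (.base (.read (reg Z.hv d) (reg Z.hv a)))) (hj : j < 87)
    (hok : Ok p pm Γ) (hil : i.isLocal = false)
    (ho : ∀ w : World Z, w.GI → Γ w → ownerOf Z.n (rv a) = none)
    (hst : ∀ u, Stable p (Γ' u))
    (hstep : ∀ w : World Z, w.GI → w.act p → Γ w → ∃ w₁, Step p w w₁ ∧ w₁.M = w.M ∧
      w₁.comp = w.comp ∧ w₁.act p ∧ Γ' (w.M (rv a)) w₁)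
    (h : ∀ u, T p s m (j + 1) (Function.update rv d u) pm (Γ' u)) : T p s (m + 1) j rv pm Γ := by
  refine T.step hi hc hj hok (fun w vars hG hΓ hr => locOK_of_shared vars (a := rv a)
    (by simp [PInstr.address, Instr.address, hr]) (ho w hG hΓ) hil)
    (fun w vars hG hact hv hΓ hr => ?_)
  obtain ⟨w₁, s1, s2, s3, s4, s5⟩ := hstep w hG hact hΓ
  refine ⟨w₁, j + 1, _, pm, _, s1, s2, s3, s4, ?_, hst _, s5, rfl, by omega, ?_, h _⟩
  · rw [← hv]; unfold view; rw [s2]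
  · intro k
    simp only [Instr.exec, hr a]
    exact update_reg hr d _ k

lemma T.write_shared (hi : (Z.A p)[s]? = some i) {Γ' : World Z → Prop}
    (hc : (blockCode Z.hv Z.n p s i)[j]? =
      some (.base (.write (reg Z.hv a) (reg Z.hv b)))) (hj : j < 87)
    (hok : Ok p pm Γ) (hil : i.isLocal = false)
    (ho : ∀ w : World Z, w.GI → Γ w → ownerOf Z.n (rv a) = none)
    (hst : Stable p Γ')
    (hstep : ∀ w : World Z, w.GI → w.act p → Γ w → ∃ w₁, Step p w w₁ ∧
      w₁.M = Function.update w.M (rv a) (rv b) ∧ w₁.comp = w.comp ∧ w₁.act p ∧ Γ' w₁)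
    (h : T p s m (j + 1) rv pm Γ') : T p s (m + 1) j rv pm Γ := by
  refine T.step hi hc hj hok (fun w vars hG hΓ hr => locOK_of_shared vars (a := rv a)
    (by simp [PInstr.address, Instr.address, hr]) (ho w hG hΓ) hil)
    (fun w vars hG hact hv hΓ hr => ?_)
  obtain ⟨w₁, s1, s2, s3, s4, s5⟩ := hstep w hG hact hΓ
  refine ⟨w₁, j + 1, _, pm, _, s1, ?_, s3, s4, ?_, hst, s5, rfl, by omega, hr, h⟩
  · rw [s2]; simp only [Instr.exec, hr]
  · rw [view_eq_of_step s2 (ho w hG hΓ), hv]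

lemma T.cas_shared (hi : (Z.A p)[s]? = some i) {f : Fin 16} {Γ' : World Z → Prop}
    (hc : (blockCode Z.hv Z.n p s i)[j]? =
      some (.base (.cas (reg Z.hv d) (reg Z.hv a) (reg Z.hv e) (reg Z.hv f)))) (hj : j < 87)
    (hok : Ok p pm Γ) (hil : i.isLocal = false)
    (ho : ∀ w : World Z, w.GI → Γ w → ownerOf Z.n (rv a) = none)
    (hst : Stable p Γ')
    (hstep : ∀ w : World Z, w.GI → w.act p → Γ w → ∃ w₁, Step p w w₁ ∧
      w₁.M = (if w.M (rv a) = rv e then Function.update w.M (rv a) (rv f) else w.M) ∧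
      w₁.comp = w.comp ∧ w₁.act p ∧ Γ' w₁)
    (h : ∀ u, T p s m (j + 1) (Function.update rv d u) pm Γ') : T p s (m + 1) j rv pm Γ := by
  refine T.step hi hc hj hok (fun w vars hG hΓ hr => locOK_of_shared vars (a := rv a)
    (by simp [PInstr.address, Instr.address, hr]) (ho w hG hΓ) hil)
    (fun w vars hG hact hv hΓ hr => ?_)
  obtain ⟨w₁, s1, s2, s3, s4, s5⟩ := hstep w hG hact hΓ
  simp only [Instr.exec, hr]
  split_ifs at s2 ⊢ with hcas
  · exact ⟨w₁, j + 1, _, pm, _, s1, s2, s3, s4, by rw [view_eq_of_step s2 (ho w hG hΓ), hv], hst,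
      s5, rfl, by omega, update_reg hr d 1, h 1⟩
  · exact ⟨w₁, j + 1, _, pm, _, s1, s2, s3, s4, by rw [← hv]; unfold view; rw [s2], hst,
      s5, rfl, by omega, update_reg hr d 0, h 0⟩

end Basic

end Rules

end World
end Setup
end PPM

/-! ### The last capsule and the boundary -/

namespace PPM

lemma blockCode_suffix {Op : Type} {v : ℕ} (hv : 16 ≤ v) (n p s : ℕ) (i : SrcInstr Op) {j : ℕ}
    (hj : 36 ≤ j) {I : PInstr Op v} (h : (suffixCode hv n p s)[j - 36]? = some I) :
    (blockCode hv n p s i)[j]? = some I := by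
  have hl : (prefixCode hv n p s i).length ≤ 36 := by
    rcases i with i | _ | _
    · cases i <;> simp [prefixCode]
    all_goals simp [prefixCode]
  unfold blockCode
  rw [← List.append_assoc, List.getElem?_append_right]
  · rw [List.length_append, List.length_replicate, Nat.add_sub_cancel' hl]
    exact h
  · rw [List.length_append, List.length_replicate, Nat.add_sub_cancel' hl]
    exact hj

namespace Setup
namespace World

variable {Z : Setup} {p : Fin Z.n} {s : ℕ} {i : SrcInstr Z.Op}

/-- One atomic write moves the restart location to the next block. A pending effect is committed at
this same event, so a crash leads back either into the last capsule or to the next instruction. -/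
lemma T.boundary (hi : (Z.A p)[s]? = some i) {m : ℕ} {rv : Fin 16 → ℕ} {pm : ℕ → ℕ}
    {Γ : World Z → Prop} {st : Proc ℕ} (hok : Ok p pm Γ)
    (hΓ : ∀ w : World Z, w.GI → Γ w → CanFinish p st w ∧ pm 3 = freshRec Z.n p (w.comp p + 1))
    (h0 : pm 0 = priv Z.n p 1) (h2 : pm 2 = st.pc) (hvars : ∀ j, pm (11 + j) = st.vars j)
    (hr0 : rv 0 = priv Z.n p 1) (hr3 : rv 3 = st.pc * 89) : T p s (m + 1) 87 rv pm Γ := by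
  intro x w hg hv hw hpc hr
  refine ⟨by rw [hv]; exact hok.rc w hg.gi hw, fun x' w' he hv' hx hg' => ?_⟩
  obtain ⟨hcf, h3⟩ := hΓ w' hg'.gi (hok.stable _ _ he hw)
  have hc : (blockCode Z.hv Z.n p s i)[87]? =
      some (.base (.write (reg Z.hv 0) (reg Z.hv 3))) :=
    blockCode_suffix _ _ _ _ _ (by norm_num) rfl
  refine ⟨s, 87, i, _, hpc, by omega, hi, hc,
    locOK_of_priv _ (j := 1) (by simp [PInstr.address, Instr.address, hr, hr0]), fun y hy => ?_⟩
  have hy' := track_step hi (by omega) (by rw [hx]; exact hpc) hc hy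
  rw [hx] at hy'
  simp only [Instr.exec, hr, hr0, hr3, hpc] at hy'
  obtain ⟨w₁, hcm, hM⟩ := hcf.commit hg'.gi
  have ha1 : w₁.act p := by rw [hcm.act]; exact hcf.1
  obtain ⟨g1, g2⟩ := step_priv hcm.step.gi ha1 1 (st.pc * 89)
  set w₂ := w₁.setMem (Function.update w₁.M (priv Z.n p 1) (st.pc * 89)) with hw₂
  have hview : ∀ j, view p w₂ j = Function.update pm 1 (st.pc * 89) j := fun j => by
    rw [hw₂, view_update_priv, ← hv, ← hv']
    have : view p w₁ = view p w' := by funext j; unfold view; rw [hM]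
    rw [this]
  have hproc₂ : w₂.c.proc p = st := hcm.proc
  have hcomp₂ : w₂.comp = w'.comp := hcm.comp
  have hcnt₂ : w₂.cnt p = w₂.comp p + 1 := by rw [hcomp₂]; exact hcm.cnt
  have hstores : Z.S.Stores w₂.M p (w₂.c.proc p) := by
    rw [hproc₂]
    refine ⟨?_, fun j => ?_⟩
    · show view p w₂ 2 = st.pc
      rw [hview]; simpa using h2
    · show view p w₂ (11 + j) = _
      rw [hview, Function.update_of_ne (by omega)]; exact hvars j
  have g3 := step_complete g1.gi hcnt₂ hstores
  have hnh : ¬(Z.S.translate Z.A).Halted y.config p := by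
    unfold PProgram.Halted
    rw [hy']
    simp only [Function.update_self]
    exact Z.translate_isSome (j := 88) hi (by omega)
  obtain ⟨t1, t2⟩ := hg'.record (y := y) ((hcm.step.trans hg'.gi g1).trans hg'.gi g3)
    (fun q hq => by rw [hy']; exact Function.update_of_ne hq _ _)
    (fun q hq => by rw [hy']; exact Function.update_of_ne hq _ _)
    (by
      rw [hy', ← hg'.mem, ← hM]; rfl)
    (by
      rw [hy', ← hg'.comp]
      show Function.update w₂.comp p _ = _
      rw [hcomp₂]; rfl)
    (by
      constructor
      · intro h; simp [complete] at h
      · intro h; have := h.1; rw [hy'] at this; simp at this)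
    (fun hh => absurd hh hnh)
  refine ⟨_, t1, .inl ⟨rfl, ?_, s, i, hi, ?_, ?_⟩⟩
  · refine ⟨st, ?_, ?_, ?_, ?_, fun j => ?_, hproc₂, ?_⟩
    · exact (hview 0).trans (by simpa using h0)
    · exact (hview 1).trans (by simp)
    · exact (hview 2).trans (by simpa using h2)
    · refine (hview 3).trans ?_
      rw [Function.update_of_ne (by omega), h3]
      simp [own, record, complete, hcomp₂]
    · exact (hview _).trans (by rw [Function.update_of_ne (by omega)]; exact hvars j)
    · rw [cnt_record]
      show w₂.cnt p = (w₂.complete p).comp p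
      rw [hcnt₂]; simp [complete]
  · rw [hy']; simp
  · rw [hy']
    simp only [Function.update_self, hr, hr3]
    exact ((hview 1).trans (by simp)).symm

/-- The private memory in the last capsule. -/
structure FinMem (p : Fin Z.n) (s : ℕ) (st : Proc ℕ) (k N : ℕ) (pm : ℕ → ℕ) : Prop where
  ptr : pm 0 = priv Z.n p 1
  ctx : pm 1 = s * 89 + 69
  le : 10 ≤ k
  dst : pm 5 = priv Z.n p k
  pc : pm 6 = st.pc
  vars : ∀ j, st.vars j = Function.update pm k (pm 4) (11 + j)
  new : pm 7 = N

def FinAssert (p : Fin Z.n) (st : Proc ℕ) (N : ℕ) (w : World Z) : Prop :=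
  w.own p = N ∧ CanFinish p st w

lemma stable_finAssert (p : Fin Z.n) (st : Proc ℕ) (N : ℕ) : Stable p (FinAssert p st N) :=
  fun w w' h hw => ⟨h.own_eq.trans hw.1, stable_canFinish p st w w' h hw.2⟩

lemma FinMem.ok (hi : (Z.A p)[s]? = some i) {st : Proc ℕ} {k N : ℕ} {pm : ℕ → ℕ}
    (h : FinMem p s st k N pm) : Ok p pm (FinAssert p st N) :=
  ⟨stable_finAssert p st N, fun _ _ hw => .inr (.inr ⟨s, i, st, k, hi, h.ptr, h.ctx, h.le, h.dst,
    h.pc, h.vars, h.new.trans hw.1.symm, hw.2⟩)⟩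

/-- The variables are described as they are after the copy to cell `k`, a description that the copy
itself does not change. Hence the capsule may be restarted after it. -/
lemma FinMem.write_dst {st : Proc ℕ} {k N : ℕ} {pm : ℕ → ℕ} (h : FinMem p s st k N pm) :
    FinMem p s st k N (Function.update pm k (pm 4)) := by
  have := h.le
  have e : ∀ j, j < 10 → Function.update pm k (pm 4) j = pm j := fun j hj =>
    Function.update_of_ne (by omega) _ _
  constructor
  · rw [e 0 (by omega)]; exact h.ptr
  · rw [e 1 (by omega)]; exact h.ctx
  · exact h.le
  · rw [e 5 (by omega)]; exact h.dst
  · rw [e 6 (by omega)]; exact h.pc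
  · intro j; rw [e 4 (by omega), Function.update_idem]; exact h.vars j
  · rw [e 7 (by omega)]; exact h.new

lemma FinMem.write {st : Proc ℕ} {k N : ℕ} {pm : ℕ → ℕ} (h : FinMem p s st k N pm) {a : ℕ}
    (ha : a = 2 ∨ a = 3) (u : ℕ) : FinMem p s st k N (Function.update pm a u) := by
  have := h.le
  have e : ∀ j, j ≠ a → Function.update pm a u j = pm j := fun j hj =>
    Function.update_of_ne hj _ _
  constructor
  · rw [e 0 (by omega)]; exact h.ptr
  · rw [e 1 (by omega)]; exact h.ctx
  · exact h.le
  · rw [e 5 (by omega)]; exact h.dst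
  · rw [e 6 (by omega)]; exact h.pc
  · intro j
    rw [e 4 (by omega), Function.update_comm (by omega), Function.update_of_ne (by omega)]
    exact h.vars j
  · rw [e 7 (by omega)]; exact h.new

/-- The offsets 69 to 87 are executed once each. The registers are arbitrary, as after a restart. -/
lemma T_fin (hi : (Z.A p)[s]? = some i) {st : Proc ℕ} {k N : ℕ} {pm : ℕ → ℕ}
    (h : FinMem p s st k N pm) (rv : Fin 16 → ℕ) : T p s 19 69 rv pm (FinAssert p st N) := by
  have hk := h.le
  refine T.const hi (blockCode_suffix _ _ _ _ _ (by norm_num) rfl) (by norm_num) (h.ok hi) ?_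
  refine T.read_priv hi 5 (blockCode_suffix _ _ _ _ _ (by norm_num) rfl) (by norm_num) (h.ok hi) rfl (u := priv Z.n p k) h.dst ?_
  refine T.const hi (blockCode_suffix _ _ _ _ _ (by norm_num) rfl) (by norm_num) (h.ok hi) ?_
  refine T.read_priv hi 4 (blockCode_suffix _ _ _ _ _ (by norm_num) rfl) (by norm_num) (h.ok hi) rfl (u := pm 4) rfl ?_
  refine T.write_priv hi k (blockCode_suffix _ _ _ _ _ (by norm_num) rfl) (by norm_num) (h.ok hi) rfl (u := pm 4) rfl ?_
  have h1 := h.write_dst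
  refine T.const hi (blockCode_suffix _ _ _ _ _ (by norm_num) rfl) (by norm_num) (h1.ok hi) ?_
  refine T.read_priv hi 6 (blockCode_suffix _ _ _ _ _ (by norm_num) rfl) (by norm_num) (h1.ok hi) rfl (u := st.pc) h1.pc ?_
  refine T.const hi (blockCode_suffix _ _ _ _ _ (by norm_num) rfl) (by norm_num) (h1.ok hi) ?_
  refine T.write_priv hi 2 (blockCode_suffix _ _ _ _ _ (by norm_num) rfl) (by norm_num) (h1.ok hi) rfl (u := st.pc) rfl ?_
  have h2 := h1.write (.inl rfl) st.pc
  refine T.const hi (blockCode_suffix _ _ _ _ _ (by norm_num) rfl) (by norm_num) (h2.ok hi) ?_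
  refine T.read_priv hi 7 (blockCode_suffix _ _ _ _ _ (by norm_num) rfl) (by norm_num) (h2.ok hi) rfl (u := N) h2.new ?_
  refine T.const hi (blockCode_suffix _ _ _ _ _ (by norm_num) rfl) (by norm_num) (h2.ok hi) ?_
  refine T.alu hi (blockCode_suffix _ _ _ _ _ (by norm_num) rfl) (by norm_num) (h2.ok hi) (u := N + (Z.n + 4) * (Z.n + 1)) rfl ?_
  refine T.const hi (blockCode_suffix _ _ _ _ _ (by norm_num) rfl) (by norm_num) (h2.ok hi) ?_
  refine T.write_priv hi 3 (blockCode_suffix _ _ _ _ _ (by norm_num) rfl) (by norm_num) (h2.ok hi) rfl (u := N + (Z.n + 4) * (Z.n + 1)) rfl ?_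
  have h3 := h2.write (.inr rfl) (N + (Z.n + 4) * (Z.n + 1))
  refine T.const hi (blockCode_suffix _ _ _ _ _ (by norm_num) rfl) (by norm_num) (h3.ok hi) ?_
  refine T.alu hi (blockCode_suffix _ _ _ _ _ (by norm_num) rfl) (by norm_num) (h3.ok hi) (u := st.pc * 89) rfl ?_
  refine T.const hi (blockCode_suffix _ _ _ _ _ (by norm_num) rfl) (by norm_num) (h3.ok hi) ?_
  refine T.boundary hi (st := st) (h3.ok hi) (fun w _ hw => ⟨hw.2, ?_⟩) h3.ptr ?_ (fun j => ?_) rfl rfl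
  · rw [Function.update_self, ← hw.1]
    exact freshRec_succ _ _
  · simp
  · rw [Function.update_of_ne (by omega), Function.update_of_ne (by omega)]
    exact (h.vars j).symm

end World
end Setup
end PPM

namespace PPM
namespace Setup
namespace World

variable {Z : Setup} {p : Fin Z.n} {s : ℕ} {i : SrcInstr Z.Op}

/-! ### The second capsule -/

section SrcSteps

variable {c : SrcConfig Z.n} {st : Proc ℕ}

lemma srcStep_of_proc (hi : (Z.A p)[st.pc]? = some i) (hc : c.proc p = st) :
    Z.srcStep c p = some ⟨Function.update c.proc p (i.exec Z.interp st c.mem).1,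
      (i.exec Z.interp st c.mem).2⟩ := by
  subst hc; exact Z.srcStep_of_getElem? hi

lemma srcStep_write {a b : ℕ} (hi : (Z.A p)[st.pc]? = some (.base (.write a b)))
    (hc : c.proc p = st) : Z.WritesAt c p (st.vars a) ∧
      Z.srcStep c p = some ⟨Function.update c.proc p ⟨st.pc + 1, st.vars⟩,
        Function.update c.mem (st.vars a) (st.vars b)⟩ :=
  ⟨⟨a, b, by rw [hc]; exact hi, by rw [hc]⟩, srcStep_of_proc hi hc⟩

lemma srcStep_cas_eq {d a e b : ℕ} (hi : (Z.A p)[st.pc]? = some (.base (.cas d a e b)))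
    (hc : c.proc p = st) (h : c.mem (st.vars a) = st.vars e) :
    Z.srcStep c p = some ⟨Function.update c.proc p (casState st d 1),
        Function.update c.mem (st.vars a) (st.vars b)⟩ := by
  rw [srcStep_of_proc hi hc]
  simp [SrcInstr.exec, Instr.exec, h, casState]

lemma srcStep_cas_ne {d a e b : ℕ} (hi : (Z.A p)[st.pc]? = some (.base (.cas d a e b)))
    (hc : c.proc p = st) (h : c.mem (st.vars a) ≠ st.vars e) :
    Z.srcStep c p = some ⟨Function.update c.proc p (casState st d 0), c.mem⟩ := by
  rw [srcStep_of_proc hi hc]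
  simp [SrcInstr.exec, Instr.exec, h, casState]

end SrcSteps

/-- The private memory in the second capsule. -/
structure MidMem (p : Fin Z.n) (st : Proc ℕ) (N : ℕ) (pm : ℕ → ℕ) : Prop where
  ptr : pm 0 = priv Z.n p 1
  ctx : pm 1 = st.pc * 89 + 49
  vars : ∀ j, pm (11 + j) = st.vars j
  pc : pm 6 = st.pc + 1
  new : pm 7 = N

lemma MidMem.update {st : Proc ℕ} {N : ℕ} {pm : ℕ → ℕ} (h : MidMem p st N pm) (u : ℕ) :
    MidMem p st N (Function.update pm 4 u) :=
  ⟨h.ptr, h.ctx, fun j => by rw [Function.update_of_ne (by omega)]; exact h.vars j, h.pc, h.new⟩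

lemma MidMem.fin {st st' : Proc ℕ} {N k u : ℕ} {pm : ℕ → ℕ} (h : MidMem p st N pm)
    (hk : 10 ≤ k) (h5 : pm 5 = priv Z.n p k) (hpc : st'.pc = st.pc + 1)
    (hv : ∀ j, st'.vars j = if 11 + j = k then u else st.vars j) :
    FinMem p st.pc st' k N (Function.update (Function.update pm 4 u) 1 (st.pc * 89 + 69)) where
  ptr := h.ptr
  ctx := rfl
  le := hk
  dst := h5
  pc := h.pc.trans hpc.symm
  vars j := by
    rw [hv]
    by_cases e : 11 + j = k
    · subst e; simp
    · rw [if_neg e, Function.update_of_ne e, Function.update_of_ne (by omega),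
        Function.update_of_ne (by omega), h.vars]
  new := h.new

/-- Storing the result keeps the second capsule restartable; only the following write of the restart
location makes it final. -/
lemma T_mid_end (hi : (Z.A p)[s]? = some i) {rv : Fin 16 → ℕ} {pm : ℕ → ℕ} {u k N : ℕ}
    {st : Proc ℕ} {Γ : World Z → Prop} (hu : rv 10 = u) (hok : Ok p pm Γ)
    (hok' : Ok p (Function.update pm 4 u) Γ)
    (hfin : FinMem p s st k N (Function.update (Function.update pm 4 u) 1 (s * 89 + 69)))
    (hw : ∀ w : World Z, w.GI → Γ w → FinAssert p st N w) : T p s 24 64 rv pm Γ := by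
  refine T.const hi (blockCode_suffix _ _ _ _ _ (by norm_num) rfl) (by norm_num) hok ?_
  refine T.write_priv hi 4 (blockCode_suffix _ _ _ _ _ (by norm_num) rfl) (by norm_num) hok rfl (u := u) hu ?_
  refine T.const hi (blockCode_suffix _ _ _ _ _ (by norm_num) rfl) (by norm_num) hok' ?_
  refine T.const hi (blockCode_suffix _ _ _ _ _ (by norm_num) rfl) (by norm_num) hok' ?_
  refine T.write_priv hi 1 (blockCode_suffix _ _ _ _ _ (by norm_num) rfl) (by norm_num) hok' rfl (u := s * 89 + 69) rfl ?_
  exact (T_fin hi hfin _).weaken (fun w hG _ hΓ => hw w hG hΓ)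

lemma stable_own (p : Fin Z.n) (N : ℕ) : Stable p fun w : World Z => w.own p = N :=
  fun _ _ h hw => h.own_eq.trans hw

/-- The assertion of the second capsule of a Write before the CAS instruction. -/
def WrA (p : Fin Z.n) (st : Proc ℕ) (a b old N : ℕ) (w : World Z) : Prop :=
  w.own p = N ∧ MidWrite p st (st.vars a) old (st.vars b) w

/-- The assertion of the second capsule of a Write after the CAS instruction. -/
def WrB (p : Fin Z.n) (st : Proc ℕ) (a b old N : ℕ) (w : World Z) : Prop :=
  WrA p st a b old N w ∧ (w.cnt p = w.comp p → w.M (objAddr Z.n (st.vars a)) ≠ old)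

lemma stable_wrA (st : Proc ℕ) (a b old N : ℕ) : Stable p (WrA p st a b old N) :=
  (stable_own p N).and (stable_midWrite p st _ old _)

lemma stable_wrB (st : Proc ℕ) (a b old N : ℕ) : Stable p (WrB p st a b old N) := by
  rintro w w' h ⟨h1, h2⟩
  refine ⟨stable_wrA st a b old N _ _ h h1, fun hc => h.obj h1.2.2.2.1 (h2 ?_)⟩
  rwa [h.cnt, h.comp] at hc

lemma MidMem.ok_write {st : Proc ℕ} {a b N : ℕ} {pm : ℕ → ℕ} {Γ : World Z → Prop}
    (hi : (Z.A p)[st.pc]? = some (.base (.write a b))) (h : MidMem p st N pm)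
    (h5 : pm 5 = priv Z.n p 10) (h8 : pm 8 = objAddr Z.n (st.vars a)) (hs : Stable p Γ)
    (hΓ : ∀ w : World Z, Γ w → WrA p st a b (pm 9) N w) : Ok p pm Γ :=
  ⟨hs, fun w _ hw => .inr (.inl ⟨st, _, hi, h.ptr, h.ctx, h.vars, h.pc,
    h.new.trans (hΓ w hw).1.symm, .inl ⟨a, b, rfl, h5, h8, (hΓ w hw).2⟩⟩)⟩

/-- If the cell still contains `old`, the Write is pending and takes effect now. If not, either it
was done before a crash or another Write has displaced `old`, which hides this one. -/
lemma wrA_cas {st : Proc ℕ} {a b old N : ℕ}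
    (hi : (Z.A p)[st.pc]? = some (.base (.write a b))) {w : World Z} (hG : w.GI)
    (h : WrA p st a b old N w) : ∃ w₁, Step p w w₁ ∧
      w₁.M = (if w.M (objAddr Z.n (st.vars a)) = old then
        Function.update w.M (objAddr Z.n (st.vars a)) N else w.M) ∧
      w₁.comp = w.comp ∧ w₁.act p ∧ WrB p st a b old N w₁ := by
  obtain ⟨rfl, h1, h2, h3, h4⟩ := id h
  by_cases hx : w.M (objAddr Z.n (st.vars a)) = old
  · rcases h4 with ⟨a1, a2, a3, a4⟩ | ⟨a1, a2, a3⟩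
    · obtain ⟨g1, g2⟩ := srcStep_write hi a2
      obtain ⟨w₁, hc, hM, -⟩ := commit_write hG h1 a1 a3 a4 g1 g2
      have hown : w₁.own p = w.own p := by simp only [own, hc.comp]
      have hcnt : w₁.cnt p = w₁.comp p + 1 := by rw [hc.comp]; exact hc.cnt
      have hact : w₁.act p := by rw [hc.act]; exact h1
      refine ⟨w₁, hc.step, by rw [if_pos hx]; exact hM, hc.comp, hact,
        ⟨hown, hact, by rw [hc.seen]; exact h2, hc.kind h3, .inr ⟨hcnt, hc.proc, ?_⟩⟩, fun hh => ?_⟩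
      · rw [hM, Function.update_self]
        intro e
        exact hG.not_inst_own a1 (e ▸ hG.kind_inst h3)
      · rw [hcnt] at hh; omega
    · exact absurd hx a3
  · exact ⟨w, Step.refl p hG, by rw [if_neg hx], rfl, h1, h, fun _ => hx⟩

/-- A Write that is still pending is masked by the one that displaced `old`. -/
lemma WrB.fin {st : Proc ℕ} {a b old N : ℕ}
    (hi : (Z.A p)[st.pc]? = some (.base (.write a b))) {w : World Z}
    (h : WrB p st a b old N w) : FinAssert p ⟨st.pc + 1, st.vars⟩ N w := by
  obtain ⟨⟨h0, h1, h2, h3, h4⟩, h5⟩ := h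
  refine ⟨h0, h1, ?_⟩
  rcases h4 with ⟨a1, a2, a3, a4⟩ | ⟨a1, a2, a3⟩
  · exact .inr ⟨a1, st, a2, .inr ⟨old, _, _, h2, h3, h5 a1, fun c hc => srcStep_write hi hc⟩⟩
  · exact .inl ⟨a1, a2⟩

lemma T_mid_write {st : Proc ℕ} {a b N : ℕ} {pm : ℕ → ℕ}
    (hi : (Z.A p)[st.pc]? = some (.base (.write a b))) (h : MidMem p st N pm)
    (h5 : pm 5 = priv Z.n p 10) (h8 : pm 8 = objAddr Z.n (st.vars a)) (hN : IsRec Z.n N)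
    (rv : Fin 16 → ℕ) : T p st.pc 39 49 rv pm (WrA p st a b (pm 9) N) := by
  have hA : Ok p pm (WrA p st a b (pm 9) N) :=
    h.ok_write hi h5 h8 (stable_wrA st a b _ N) (fun w hw => hw)
  have hB : Ok p pm (WrB p st a b (pm 9) N) :=
    h.ok_write hi h5 h8 (stable_wrB st a b _ N) (fun w hw => hw.1)
  have hB' : ∀ u, Ok p (Function.update pm 4 u) (WrB p st a b (pm 9) N) := fun u =>
    (h.update u).ok_write hi h5 h8 (stable_wrB st a b _ N) (fun w hw => hw.1)
  have hfin : ∀ u, FinMem p st.pc ⟨st.pc + 1, st.vars⟩ 10 N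
      (Function.update (Function.update pm 4 u) 1 (st.pc * 89 + 69)) := fun u =>
    h.fin le_rfl h5 rfl (fun j => by rw [if_neg (by omega)])
  refine T.const hi (blockCode_suffix _ _ _ _ _ (by norm_num) rfl) (by norm_num) hA ?_
  refine T.read_priv hi 7 (blockCode_suffix _ _ _ _ _ (by norm_num) rfl) (by norm_num) hA rfl (u := N) h.new ?_
  refine T.const hi (blockCode_suffix _ _ _ _ _ (by norm_num) rfl) (by norm_num) hA ?_
  refine T.read_priv hi 8 (blockCode_suffix _ _ _ _ _ (by norm_num) rfl) (by norm_num) hA rfl (u := objAddr Z.n (st.vars a)) h8 ?_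
  refine T.const hi (blockCode_suffix _ _ _ _ _ (by norm_num) rfl) (by norm_num) hA ?_
  refine T.read_priv hi 9 (blockCode_suffix _ _ _ _ _ (by norm_num) rfl) (by norm_num) hA rfl (u := pm 9) rfl ?_
  refine T.const hi (blockCode_suffix _ _ _ _ _ (by norm_num) rfl) (by norm_num) hA ?_
  refine T.alu hi (blockCode_suffix _ _ _ _ _ (by norm_num) rfl) (by norm_num) hA (u := pm 9 + 2) rfl ?_
  refine T.const hi (blockCode_suffix _ _ _ _ _ (by norm_num) rfl) (by norm_num) hA ?_
  refine T.write_shared hi (Γ' := WrA p st a b (pm 9) N)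
    (blockCode_suffix _ _ _ _ _ (by norm_num) rfl) (by norm_num) hA rfl
    (fun w hG hw => ownerOf_rec (hG.isRec (hG.kind_inst hw.2.2.2.1)) 2 (by omega)) hA.stable
    (fun w hG hact hw => ?_) ?_
  · obtain ⟨g1, g2⟩ := step_flag hG p (hG.kind_inst hw.2.2.2.1)
    exact ⟨_, g1, rfl, rfl, hact, hA.stable _ _ g2 hw⟩
  refine T.cas_shared hi (Γ' := WrB p st a b (pm 9) N)
    (blockCode_suffix _ _ _ _ _ (by norm_num) rfl) (by norm_num) hA rfl
    (fun w hG hw => ownerOf_objAddr _) hB.stable (fun w hG hact hw => wrA_cas hi hG hw)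
    (fun r => ?_)
  refine T.read_shared hi (Γ' := fun _ => WrB p st a b (pm 9) N)
    (blockCode_suffix _ _ _ _ _ (by norm_num) rfl) (by norm_num) hB rfl
    (fun w hG hw => ownerOf_objAddr _) (fun _ => hB.stable)
    (fun w hG hact hw => ⟨w, Step.refl p hG, rfl, rfl, hact, hw⟩) (fun t => ?_)
  -- The outcome is irrelevant for a Write: its destination is the dummy cell 10. The test is there
  -- because the capsule is shared with CAS.
  by_cases ht : t = N
  · refine T.jump_eq hi (l := 64) (blockCode_suffix _ _ _ _ _ (by norm_num) rfl) (by norm_num) hB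
      (by norm_num) ht ?_
    exact (T_mid_end hi rfl hB (hB' 1) (hfin 1) (fun w _ hw => hw.fin hi)).mono (by norm_num)
  · refine T.jump_ne hi (blockCode_suffix _ _ _ _ _ (by norm_num) rfl) (by norm_num) hB ht ?_
    refine T.alu hi (blockCode_suffix _ _ _ _ _ (by norm_num) rfl) (by norm_num) hB
      (u := N + 2) rfl ?_
    refine T.read_shared hi (Γ' := fun _ => WrB p st a b (pm 9) N)
      (blockCode_suffix _ _ _ _ _ (by norm_num) rfl) (by norm_num) hB rfl
      (fun w hG hw => ownerOf_rec hN 2 (by omega)) (fun _ => hB.stable)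
      (fun w hG hact hw => ⟨w, Step.refl p hG, rfl, rfl, hact, hw⟩) (fun f => ?_)
    exact T_mid_end hi rfl hB (hB' f) (hfin f) (fun w _ hw => hw.fin hi)

/-- The assertion at the start of the second capsule of a CAS. -/
def CasA (p : Fin Z.n) (st : Proc ℕ) (d a e b W old N : ℕ) (w : World Z) : Prop :=
  w.own p = N ∧ MidCas p st (casState st d 1) (st.vars a) W old (st.vars e) (st.vars b) w

/-- The assertion after the flag of the record to be replaced has been set. -/
def CasB (p : Fin Z.n) (st : Proc ℕ) (d a e b W old N : ℕ) (w : World Z) : Prop :=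
  CasA p st d a e b W old N w ∧ w.M (old + 2) = 1

/-- The assertion after the CAS instruction. -/
def CasC (p : Fin Z.n) (st : Proc ℕ) (d a e b W old N : ℕ) (w : World Z) : Prop :=
  CasA p st d a e b W old N w ∧
    (w.cnt p = w.comp p → w.Pos p fun mem => mem (st.vars a) ≠ st.vars e)

/-- The assertion after the content `t` of the record `W` has been read. -/
def CasD (p : Fin Z.n) (st : Proc ℕ) (d a e b W old N t : ℕ) (w : World Z) : Prop :=
  CasC p st d a e b W old N w ∧ (t = N → w.cnt p = w.comp p + 1) ∧
    (t ≠ N → w.cnt p = w.comp p + 1 → w.M (w.own p + 2) = 1)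

/-- The assertion when the result `f` of the CAS is known. -/
def CasE (p : Fin Z.n) (st : Proc ℕ) (d a e b W old N f : ℕ) (w : World Z) : Prop :=
  CasC p st d a e b W old N w ∧ (w.cnt p = w.comp p → f = 0) ∧ (w.cnt p = w.comp p + 1 → f = 1)

section Cas

variable {st : Proc ℕ} {d a e b W old N : ℕ}

lemma stable_casA : Stable p (CasA p st d a e b W old N) :=
  (stable_own p N).and (stable_midCas p st _ _ W old _ _)

lemma stable_casB : Stable p (CasB p st d a e b W old N) := by
  rintro w w' h ⟨h1, h2⟩
  exact ⟨stable_casA _ _ h h1, h.flag h1.2.2.2.2.1 h2⟩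

lemma stable_casC : Stable p (CasC p st d a e b W old N) := by
  rintro w w' h ⟨h1, h2⟩
  refine ⟨stable_casA _ _ h h1, fun hc => h.pos (h2 ?_)⟩
  rwa [h.cnt, h.comp] at hc

lemma stable_casD (t : ℕ) : Stable p (CasD p st d a e b W old N t) := by
  rintro w w' h ⟨h1, h2, h3⟩
  refine ⟨stable_casC _ _ h h1, ?_, ?_⟩
  · rw [h.cnt, h.comp]; exact h2
  · rw [h.cnt, h.comp, h.own_eq]
    intro ht hc
    refine h.flag ?_ (h3 ht hc)
    rcases h1.1.2.2.2.2.2.2.2 with ⟨g, -⟩ | ⟨-, -, -, g, -⟩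
    · omega
    · exact g

lemma stable_casE (f : ℕ) : Stable p (CasE p st d a e b W old N f) := by
  rintro w w' h ⟨h1, h2, h3⟩
  refine ⟨stable_casC _ _ h h1, ?_, ?_⟩
  · rw [h.cnt, h.comp]; exact h2
  · rw [h.cnt, h.comp]; exact h3

lemma MidMem.ok_cas {pm : ℕ → ℕ} {Γ : World Z → Prop}
    (hi : (Z.A p)[st.pc]? = some (.base (.cas d a e b))) (h : MidMem p st N pm)
    (h5 : pm 5 = priv Z.n p (11 + d)) (hs : Stable p Γ)
    (hΓ : ∀ w : World Z, Γ w → CasA p st d a e b (pm 8) (pm 9) N w) : Ok p pm Γ :=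
  ⟨hs, fun w _ hw => .inr (.inl ⟨st, _, hi, h.ptr, h.ctx, h.vars, h.pc,
    h.new.trans (hΓ w hw).1.symm, .inr ⟨d, a, e, b, rfl, h5, (hΓ w hw).2⟩⟩)⟩

/-- Finding `old` in `W` shows that the instruction is pending, since an accessible record never
returns once replaced. So a repetition after a crash cannot succeed a second time. -/
lemma casB_cas (hi : (Z.A p)[st.pc]? = some (.base (.cas d a e b))) {w : World Z} (hG : w.GI)
    (h : CasB p st d a e b W old N w) : ∃ w₁, Step p w w₁ ∧
      w₁.M = (if w.M W = old then Function.update w.M W N else w.M) ∧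
      w₁.comp = w.comp ∧ w₁.act p ∧ CasC p st d a e b W old N w₁ := by
  obtain ⟨⟨rfl, h1, h2, h3, h4, h5, h6, h7⟩, h8⟩ := id h
  by_cases hx : w.M W = old
  · rcases h7 with ⟨a1, a2, a3, a4⟩ | ⟨a1, a2, a3, a4⟩
    · obtain ⟨w₁, hc, hM⟩ := commit_cas (s := casState st d 1) hG h1 a1 h2 h3 a3
        (by rw [hx, h5]; exact h6) (by rw [hx]; exact h8) (fun c hp hm => by
          rw [hx, h5] at hm
          exact srcStep_cas_eq hi (hp.trans a2) hm)
      have hown : w₁.own p = w.own p := by simp only [own, hc.comp]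
      have hcnt : w₁.cnt p = w₁.comp p + 1 := by rw [hc.comp]; exact hc.cnt
      have hact : w₁.act p := by rw [hc.act]; exact h1
      have hW : w₁.M W = w.own p := by rw [hM, Function.update_self]
      have hk := hc.kind h3
      refine ⟨w₁, hc.step, by rw [if_pos hx]; exact hM, hc.comp, hact,
        ⟨hown, hact, by rw [hc.seen]; exact h2, hk, hc.inst h4, ?_, h6,
          .inr ⟨hcnt, hc.proc, ?_, ?_, .inl (hW.trans hown.symm)⟩⟩, fun hh => ?_⟩
      · rw [hM, Function.update_of_ne, h5]
        intro e'
        have := rec_inj (e := 1) (f := 0) (hG.isRec h4) (hG.isRec (hG.kind_inst h3)) (by omega)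
          (by omega) e'
        omega
      · rw [hW]
        intro e'
        exact hG.not_inst_own a1 (e' ▸ h4)
      · rw [hown, ← hW]
        exact hc.step.gi.cell_inst hk
      · rw [hcnt] at hh; omega
    · exact absurd hx a3
  · refine ⟨w, Step.refl p hG, by rw [if_neg hx], rfl, h1, h.1, fun hh => ?_⟩
    rcases h7 with ⟨a1, a2, a3, a4 | a4⟩ | ⟨a1, -⟩
    · exact absurd a4 hx
    · exact a4.2
    · omega

/-- If `W` contains the own record, that record is accessible and the CAS has taken effect. If it
has taken effect but the record is gone, its replacer has set the flag. -/
lemma CasC.read {w : World Z} (hG : w.GI) (h : CasC p st d a e b W old N w) :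
    CasD p st d a e b W old N (w.M W) w := by
  refine ⟨h, fun hh => ?_, fun hh hc => ?_⟩
  · apply hG.cnt_of_inst_own
    rw [h.1.1, ← hh]
    exact hG.cell_inst h.1.2.2.2.1
  · rcases h.1.2.2.2.2.2.2.2 with ⟨g, -⟩ | ⟨-, -, -, -, g | g⟩
    · omega
    · exact absurd (g.trans h.1.1) hh
    · exact g

/-- The flag decides: it is 0 as long as the own record is not accessible. No other process can
change whether the instruction has taken effect, so the two reads need not be simultaneous. -/
lemma CasD.read {t : ℕ} (ht : t ≠ N) {w : World Z} (hG : w.GI)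
    (h : CasD p st d a e b W old N t w) : CasE p st d a e b W old N (w.M (N + 2)) w := by
  refine ⟨h.1, fun hc => ?_, fun hc => ?_⟩
  · rw [← h.1.1.1]
    exact hG.flag (w.isRec_own p) (hG.not_inst_own hc)
  · rw [← h.1.1.1]
    exact h.2.2 ht hc

/-- A pending CAS returns 0 and uses the reserved position at which the value differs from the
expected one. -/
lemma CasE.fin {f : ℕ} (hi : (Z.A p)[st.pc]? = some (.base (.cas d a e b))) {w : World Z}
    (h : CasE p st d a e b W old N f w) : FinAssert p (casState st d f) N w := by
  obtain ⟨⟨⟨h0, h1, -, -, -, -, -, h7⟩, h8⟩, h9, h10⟩ := h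
  refine ⟨h0, h1, ?_⟩
  rcases h7 with ⟨a1, a2, -⟩ | ⟨a1, a2, -⟩
  · rw [h9 a1]
    exact .inr ⟨a1, st, a2, .inl ⟨_, h8 a1, fun c hc hm => srcStep_cas_ne hi hc hm⟩⟩
  · rw [h10 a1]
    exact .inl ⟨a1, a2⟩

lemma T_mid_cas {pm : ℕ → ℕ} (hi : (Z.A p)[st.pc]? = some (.base (.cas d a e b)))
    (h : MidMem p st N pm) (h5 : pm 5 = priv Z.n p (11 + d)) (hN : IsRec Z.n N)
    (rv : Fin 16 → ℕ) : T p st.pc 39 49 rv pm (CasA p st d a e b (pm 8) (pm 9) N) := by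
  have hA : Ok p pm (CasA p st d a e b (pm 8) (pm 9) N) :=
    h.ok_cas hi h5 stable_casA (fun w hw => hw)
  have hB : Ok p pm (CasB p st d a e b (pm 8) (pm 9) N) :=
    h.ok_cas hi h5 stable_casB (fun w hw => hw.1)
  have hC : Ok p pm (CasC p st d a e b (pm 8) (pm 9) N) :=
    h.ok_cas hi h5 stable_casC (fun w hw => hw.1)
  have hD : ∀ t, Ok p pm (CasD p st d a e b (pm 8) (pm 9) N t) := fun t =>
    h.ok_cas hi h5 (stable_casD t) (fun w hw => hw.1.1)
  have hE : ∀ f, Ok p pm (CasE p st d a e b (pm 8) (pm 9) N f) := fun f =>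
    h.ok_cas hi h5 (stable_casE f) (fun w hw => hw.1.1)
  have hE' : ∀ f, Ok p (Function.update pm 4 f) (CasE p st d a e b (pm 8) (pm 9) N f) := fun f =>
    (h.update f).ok_cas hi h5 (stable_casE f) (fun w hw => hw.1.1)
  have hfin : ∀ u, FinMem p st.pc (casState st d u) (11 + d) N
      (Function.update (Function.update pm 4 u) 1 (st.pc * 89 + 69)) := fun u =>
    h.fin (by omega) h5 rfl (fun j => by simp [casState, Function.update_apply])
  have hk : ∀ {w : World Z}, CasA p st d a e b (pm 8) (pm 9) N w → w.kind (pm 8) (st.vars a) :=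
    fun hw => hw.2.2.2.1
  refine T.const hi (blockCode_suffix _ _ _ _ _ (by norm_num) rfl) (by norm_num) hA ?_
  refine T.read_priv hi 7 (blockCode_suffix _ _ _ _ _ (by norm_num) rfl) (by norm_num) hA rfl (u := N) h.new ?_
  refine T.const hi (blockCode_suffix _ _ _ _ _ (by norm_num) rfl) (by norm_num) hA ?_
  refine T.read_priv hi 8 (blockCode_suffix _ _ _ _ _ (by norm_num) rfl) (by norm_num) hA rfl (u := pm 8) rfl ?_
  refine T.const hi (blockCode_suffix _ _ _ _ _ (by norm_num) rfl) (by norm_num) hA ?_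
  refine T.read_priv hi 9 (blockCode_suffix _ _ _ _ _ (by norm_num) rfl) (by norm_num) hA rfl (u := pm 9) rfl ?_
  refine T.const hi (blockCode_suffix _ _ _ _ _ (by norm_num) rfl) (by norm_num) hA ?_
  refine T.alu hi (blockCode_suffix _ _ _ _ _ (by norm_num) rfl) (by norm_num) hA (u := pm 9 + 2) rfl ?_
  refine T.const hi (blockCode_suffix _ _ _ _ _ (by norm_num) rfl) (by norm_num) hA ?_
  refine T.write_shared hi (Γ' := CasB p st d a e b (pm 8) (pm 9) N)
    (blockCode_suffix _ _ _ _ _ (by norm_num) rfl) (by norm_num) hA rfl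
    (fun w hG hw => ownerOf_rec (hG.isRec hw.2.2.2.2.1) 2 (by omega)) hB.stable
    (fun w hG hact hw => ?_) ?_
  · obtain ⟨g1, g2⟩ := step_flag hG p hw.2.2.2.2.1
    exact ⟨_, g1, rfl, rfl, hact, hA.stable _ _ g2 hw, Function.update_self _ _ _⟩
  refine T.cas_shared hi (Γ' := CasC p st d a e b (pm 8) (pm 9) N)
    (blockCode_suffix _ _ _ _ _ (by norm_num) rfl) (by norm_num) hB rfl
    (fun w hG hw => ownerOf_rec (hG.isRec (hG.kind_inst (hk hw.1))) 0 (by omega)) hC.stable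
    (fun w hG hact hw => casB_cas hi hG hw) (fun r => ?_)
  refine T.read_shared hi (Γ' := CasD p st d a e b (pm 8) (pm 9) N)
    (blockCode_suffix _ _ _ _ _ (by norm_num) rfl) (by norm_num) hC rfl
    (fun w hG hw => ownerOf_rec (hG.isRec (hG.kind_inst (hk hw.1))) 0 (by omega))
    (fun t => (hD t).stable)
    (fun w hG hact hw => ⟨w, Step.refl p hG, rfl, rfl, hact, hw.read hG⟩) (fun t => ?_)
  by_cases ht : t = N
  · refine T.jump_eq hi (l := 64) (blockCode_suffix _ _ _ _ _ (by norm_num) rfl) (by norm_num)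
      (hD t) (by norm_num) ht ?_
    -- Register 10 still contains the 1 that was written to the flag, and serves as the result.
    refine ((T_mid_end hi rfl (hE 1) (hE' 1) (hfin 1) (fun w _ hw => hw.fin hi)).weaken
      (fun w _ _ hw => ⟨hw.1, fun hc => ?_, fun _ => rfl⟩)).mono (by norm_num)
    have := hw.2.1 ht
    omega
  · refine T.jump_ne hi (blockCode_suffix _ _ _ _ _ (by norm_num) rfl) (by norm_num) (hD t) ht ?_
    refine T.alu hi (blockCode_suffix _ _ _ _ _ (by norm_num) rfl) (by norm_num) (hD t)
      (u := N + 2) rfl ?_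
    refine T.read_shared hi (Γ' := CasE p st d a e b (pm 8) (pm 9) N)
      (blockCode_suffix _ _ _ _ _ (by norm_num) rfl) (by norm_num) (hD t) rfl
      (fun w hG hw => ownerOf_rec hN 2 (by omega)) (fun f => (hE f).stable)
      (fun w hG hact hw => ⟨w, Step.refl p hG, rfl, rfl, hact, hw.read ht hG⟩) (fun f => ?_)
    exact T_mid_end hi rfl (hE f) (hE' f) (hfin f) (fun w _ hw => hw.fin hi)

end Cas

end World
end Setup
end PPM

namespace PPM
namespace Setup
namespace World

variable {Z : Setup} {p : Fin Z.n} {i : SrcInstr Z.Op} {st st' : Proc ℕ} {N : ℕ} {pm : ℕ → ℕ}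
  {rv : Fin 16 → ℕ} {Γ : World Z → Prop}

/-! ### The first capsule -/

/-- The private memory in the first capsule. -/
structure StartMem (p : Fin Z.n) (st : Proc ℕ) (N : ℕ) (pm : ℕ → ℕ) : Prop where
  ptr : pm 0 = priv Z.n p 1
  ctx : pm 1 = st.pc * 89
  pc : pm 2 = st.pc
  seq : pm 3 = N
  vars : ∀ j, pm (11 + j) = st.vars j

lemma StartMem.update (h : StartMem p st N pm) {a : ℕ} (ha : 4 ≤ a ∧ a < 11) (u : ℕ) :
    StartMem p st N (Function.update pm a u) := by
  have e : ∀ j, j ≠ a → Function.update pm a u j = pm j := fun j hj =>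
    Function.update_of_ne hj _ _
  constructor
  · rw [e 0 (by omega)]; exact h.ptr
  · rw [e 1 (by omega)]; exact h.ctx
  · rw [e 2 (by omega)]; exact h.pc
  · rw [e 3 (by omega)]; exact h.seq
  · intro j; rw [e _ (by omega)]; exact h.vars j

/-- The current instruction of `p` has not taken effect. -/
def Base (p : Fin Z.n) (st : Proc ℕ) (N : ℕ) (w : World Z) : Prop :=
  w.own p = N ∧ w.c.proc p = st ∧ w.cnt p = w.comp p

/-- `p` is inside an instruction that has not taken effect. -/
def BaseA (p : Fin Z.n) (st : Proc ℕ) (N : ℕ) (w : World Z) : Prop := w.act p ∧ Base p st N w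

lemma stable_base (p : Fin Z.n) (st : Proc ℕ) (N : ℕ) : Stable p (Base p st N) :=
  fun _ _ h hw => ⟨h.own_eq.trans hw.1, h.proc.trans hw.2.1, by rw [h.cnt, h.comp]; exact hw.2.2⟩

lemma stable_baseA (p : Fin Z.n) (st : Proc ℕ) (N : ℕ) : Stable p (BaseA p st N) :=
  fun _ _ h hw => ⟨h.act hw.1, stable_base p st N _ _ h hw.2⟩

lemma StartMem.ok (h : StartMem p st N pm) (hs : Stable p Γ)
    (hΓ : ∀ w : World Z, Γ w → Base p st N w) : Ok p pm Γ :=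
  ⟨hs, fun w _ hw => .inl ⟨st, h.ptr, h.ctx, h.pc, h.seq.trans (hΓ w hw).1.symm, h.vars,
    (hΓ w hw).2.1, (hΓ w hw).2.2⟩⟩

/-- Before its first step `p` may be idle, so only `Base` is available; the step itself makes it
active. -/
lemma T_start (hi : (Z.A p)[st.pc]? = some i) (h : StartMem p st N pm) {m u : ℕ} {d : Fin 16}
    (hc : (blockCode Z.hv Z.n p st.pc i)[0]? = some (.base (.const (reg Z.hv d) u)))
    (hT : T p st.pc m 1 (Function.update rv d u) pm (BaseA p st N)) :
    T p st.pc (m + 1) 0 rv pm (Base p st N) := by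
  refine T.step hi hc (by norm_num) (h.ok (stable_base p st N) fun _ hw => hw)
    (fun w vars _ _ _ => locOK_of_none vars rfl) (fun w vars hG ha hv hΓ hr => ?_)
  exact ⟨w, 1, _, pm, BaseA p st N, Step.refl p hG, rfl, rfl, ha, hv, stable_baseA p st N,
    ⟨ha, hΓ⟩, rfl, by omega, update_reg hr d u, hT⟩

/-- The private memory at the end of the first capsule. -/
def tailMem (pm : ℕ → ℕ) (u d npc N a : ℕ) : ℕ → ℕ :=
  Function.update (Function.update (Function.update (Function.update (Function.update pm 4 u)
    5 d) 6 npc) 7 N) 1 a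

/-- The writes to the cells 4 to 7 do not touch what the first capsule starts from, so until the
restart location moves it can be repeated from scratch. -/
lemma T_tail (hi : (Z.A p)[st.pc]? = some i) (h : StartMem p st N pm) (hs : Stable p Γ)
    (hΓ : ∀ w : World Z, Γ w → Base p st N w) {u d npc l m : ℕ} (h1 : rv 1 = u) (h2 : rv 2 = d)
    (h3 : rv 3 = npc) (h4 : rv 4 = st.pc * 89 + l) (hl : l < 89)
    (hok : Ok p (tailMem pm u d npc N (st.pc * 89 + l)) Γ)
    (hT : ∀ rv, T p st.pc m l rv (tailMem pm u d npc N (st.pc * 89 + l)) Γ) :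
    T p st.pc (m + 13) 36 rv pm Γ := by
  have hok0 := h.ok hs hΓ
  have g1 := h.update (a := 4) (by omega) u
  have hok1 := g1.ok hs hΓ
  have g2 := g1.update (a := 5) (by omega) d
  have hok2 := g2.ok hs hΓ
  have g3 := g2.update (a := 6) (by omega) npc
  have hok3 := g3.ok hs hΓ
  have g4 := g3.update (a := 7) (by omega) N
  have hok4 := g4.ok hs hΓ
  refine T.const hi (blockCode_suffix _ _ _ _ _ (by norm_num) rfl) (by norm_num) hok0 ?_
  refine T.read_priv hi 3 (blockCode_suffix _ _ _ _ _ (by norm_num) rfl) (by norm_num) hok0 rfl (u := N) h.seq ?_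
  refine T.const hi (blockCode_suffix _ _ _ _ _ (by norm_num) rfl) (by norm_num) hok0 ?_
  refine T.write_priv hi 4 (blockCode_suffix _ _ _ _ _ (by norm_num) rfl) (by norm_num) hok0 rfl (u := u) h1 ?_
  refine T.const hi (blockCode_suffix _ _ _ _ _ (by norm_num) rfl) (by norm_num) hok1 ?_
  refine T.write_priv hi 5 (blockCode_suffix _ _ _ _ _ (by norm_num) rfl) (by norm_num) hok1 rfl (u := d) h2 ?_
  refine T.const hi (blockCode_suffix _ _ _ _ _ (by norm_num) rfl) (by norm_num) hok2 ?_
  refine T.write_priv hi 6 (blockCode_suffix _ _ _ _ _ (by norm_num) rfl) (by norm_num) hok2 rfl (u := npc) h3 ?_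
  refine T.const hi (blockCode_suffix _ _ _ _ _ (by norm_num) rfl) (by norm_num) hok3 ?_
  refine T.write_priv hi 7 (blockCode_suffix _ _ _ _ _ (by norm_num) rfl) (by norm_num) hok3 rfl (u := N) rfl ?_
  refine T.const hi (blockCode_suffix _ _ _ _ _ (by norm_num) rfl) (by norm_num) hok4 ?_
  refine T.write_priv hi 1 (blockCode_suffix _ _ _ _ _ (by norm_num) rfl) (by norm_num) hok4 rfl (u := st.pc * 89 + l) h4 ?_
  exact T.jump_to hi (blockCode_suffix _ _ _ _ _ (by norm_num) rfl) (by norm_num) hok hl h4 (hT _)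

lemma StartMem.fin (h : StartMem p st N pm) {u k : ℕ} (hk : 10 ≤ k)
    (hv : ∀ j, st'.vars j = if 11 + j = k then u else st.vars j) :
    FinMem p st.pc st' k N (tailMem pm u (priv Z.n p k) st'.pc N (st.pc * 89 + 69)) where
  ptr := h.ptr
  ctx := rfl
  le := hk
  dst := rfl
  pc := rfl
  vars j := by
    rw [hv]
    by_cases e : 11 + j = k
    · subst e; simp [tailMem]
    · rw [if_neg e, Function.update_of_ne e]
      unfold tailMem
      iterate 5 rw [Function.update_of_ne (by omega)]
      exact (h.vars j).symm
  new := rfl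

/-- For instructions without a second capsule: the effect is already possible and waits for the
boundary. The bound 32 is 13 steps of the tail and 19 of the last capsule. -/
lemma T_tail_fin (hi : (Z.A p)[st.pc]? = some i) (h : StartMem p st N pm) (hs : Stable p Γ)
    (hΓ : ∀ w : World Z, Γ w → BaseA p st N w)
    (hf : ∀ w : World Z, w.GI → Γ w → CanFinish p st' w) {u k : ℕ} (hk : 10 ≤ k)
    (hv : ∀ j, st'.vars j = if 11 + j = k then u else st.vars j)
    (h1 : rv 1 = u) (h2 : rv 2 = priv Z.n p k) (h3 : rv 3 = st'.pc)
    (h4 : rv 4 = st.pc * 89 + 69) : T p st.pc 32 36 rv pm Γ := by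
  have hfin := h.fin hk hv
  refine T_tail hi h hs (fun w hw => (hΓ w hw).2) h1 h2 h3 h4 (by norm_num) ⟨hs, fun w hG hw => ?_⟩
    (fun rv' => (T_fin hi hfin rv').weaken fun w hG _ hw => ⟨(hΓ w hw).2.1, hf w hG hw⟩)
  exact (hfin.ok hi).rc w hG ⟨(hΓ w hw).2.1, hf w hG hw⟩

lemma BaseA.pos {w : World Z} (hG : w.GI) (h : BaseA p st N w) {φ : (ℕ → ℕ) → Prop}
    (hφ : φ w.c.mem) : w.Pos p φ :=
  ⟨h.1, h.2.2.2, w.H, [], w.c, by simp, hG.cfg, by simp, hφ⟩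

lemma BaseA.canFinish {w : World Z} (hi : (Z.A p)[st.pc]? = some i) (h : BaseA p st N w)
    {φ : (ℕ → ℕ) → Prop} (hp : w.Pos p φ) (he : ∀ mem, φ mem → i.exec Z.interp st mem = (st', mem)) :
    CanFinish p st' w :=
  ⟨h.1, .inr ⟨h.2.2.2, st, h.2.2.1, .inl ⟨φ, hp, fun c hc hm => by
    rw [srcStep_of_proc hi hc, he _ hm]⟩⟩⟩

lemma T_tail_local (hi : (Z.A p)[st.pc]? = some i) (h : StartMem p st N pm)
    (he : ∀ mem, i.exec Z.interp st mem = (st', mem)) {u k : ℕ} (hk : 10 ≤ k)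
    (hv : ∀ j, st'.vars j = if 11 + j = k then u else st.vars j)
    (h1 : rv 1 = u) (h2 : rv 2 = priv Z.n p k) (h3 : rv 3 = st'.pc)
    (h4 : rv 4 = st.pc * 89 + 69) : T p st.pc 32 36 rv pm (BaseA p st N) :=
  T_tail_fin hi h (stable_baseA p st N) (fun _ hw => hw)
    (fun _ hG hw => hw.canFinish hi (hw.pos hG (φ := fun _ => True) trivial) fun mem _ => he mem)
    hk hv h1 h2 h3 h4

lemma update_var (vars : ℕ → ℕ) (d u j : ℕ) :
    Function.update vars d u j = if 11 + j = 11 + d then u else vars j := by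
  simp [Function.update_apply]

/-- Private cell 10 lies below all variables, so instructions without a result use it as
destination. -/
lemma var_of_ten (vars : ℕ → ℕ) (u j : ℕ) : vars j = if 11 + j = 10 then u else vars j := by
  rw [if_neg (by omega)]

lemma priv_var (n p x : ℕ) : (n + 4) * x + priv n p 11 = priv n p (11 + x) := by
  simp only [priv]; ring

lemma T_const {d c : ℕ} (hi : (Z.A p)[st.pc]? = some (.base (.const d c)))
    (h : StartMem p st N pm) : T p st.pc 37 0 rv pm (Base p st N) := by
  have hok := h.ok (stable_baseA p st N) fun _ hw => hw.2
  refine T_start hi h rfl ?_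
  refine T.const hi rfl (by norm_num) hok ?_
  refine T.const hi rfl (by norm_num) hok ?_
  refine T.const hi rfl (by norm_num) hok ?_
  refine T.jump_eq hi (l := 36) rfl (by norm_num) hok (by norm_num) rfl ?_
  exact T_tail_local hi h (fun _ => rfl) (by omega) (update_var _ d c) rfl rfl rfl rfl

lemma T_alu {f : Alu Z.Op} {d a b : ℕ} (hi : (Z.A p)[st.pc]? = some (.base (.alu f d a b)))
    (h : StartMem p st N pm) : T p st.pc 41 0 rv pm (Base p st N) := by
  have hok := h.ok (stable_baseA p st N) fun _ hw => hw.2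
  refine T_start hi h rfl ?_
  refine T.read_priv hi (11 + a) rfl (by norm_num) hok rfl (u := st.vars a) (h.vars a) ?_
  refine T.const hi rfl (by norm_num) hok ?_
  refine T.read_priv hi (11 + b) rfl (by norm_num) hok rfl (u := st.vars b) (h.vars b) ?_
  refine T.alu hi rfl (by norm_num) hok (u := f.eval Z.interp (st.vars a) (st.vars b)) rfl ?_
  refine T.const hi rfl (by norm_num) hok ?_
  refine T.const hi rfl (by norm_num) hok ?_
  refine T.const hi rfl (by norm_num) hok ?_
  refine T.jump_eq hi (l := 36) rfl (by norm_num) hok (by norm_num) rfl ?_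
  exact T_tail_local hi h (fun _ => rfl) (by omega) (update_var _ d _) rfl rfl rfl rfl

lemma T_jumpEq {a b l : ℕ} (hi : (Z.A p)[st.pc]? = some (.base (.jumpEq a b l)))
    (h : StartMem p st N pm) : T p st.pc 42 0 rv pm (Base p st N) := by
  have hok := h.ok (stable_baseA p st N) fun _ hw => hw.2
  refine T_start hi h rfl ?_
  refine T.read_priv hi (11 + a) rfl (by norm_num) hok rfl (u := st.vars a) (h.vars a) ?_
  refine T.const hi rfl (by norm_num) hok ?_
  refine T.read_priv hi (11 + b) rfl (by norm_num) hok rfl (u := st.vars b) (h.vars b) ?_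
  refine T.const hi rfl (by norm_num) hok ?_
  refine T.const hi rfl (by norm_num) hok ?_
  refine T.const hi rfl (by norm_num) hok ?_
  by_cases hab : st.vars a = st.vars b
  · refine (T.jump_eq hi (l := 36) rfl (by norm_num) hok (by norm_num) hab ?_).mono
      (by norm_num : 33 ≤ 35)
    exact T_tail_local (st' := ⟨l, st.vars⟩) hi h
      (fun _ => by simp [SrcInstr.exec, Instr.exec, hab]) (by omega) (var_of_ten _ _) rfl rfl rfl
      rfl
  · refine T.jump_ne hi rfl (by norm_num) hok hab ?_
    refine T.const hi rfl (by norm_num) hok ?_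
    refine T.jump_eq hi (l := 36) rfl (by norm_num) hok (by norm_num) rfl ?_
    exact T_tail_local (st' := ⟨st.pc + 1, st.vars⟩) hi h
      (fun _ => by simp [SrcInstr.exec, Instr.exec, hab]) (by omega) (var_of_ten _ _) rfl rfl rfl
      rfl

lemma T_jumpTo {a : ℕ} (hi : (Z.A p)[st.pc]? = some (.base (.jumpTo a)))
    (h : StartMem p st N pm) : T p st.pc 37 0 rv pm (Base p st N) := by
  have hok := h.ok (stable_baseA p st N) fun _ hw => hw.2
  refine T_start hi h rfl ?_
  refine T.read_priv hi (11 + a) rfl (by norm_num) hok rfl (u := st.vars a) (h.vars a) ?_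
  refine T.const hi rfl (by norm_num) hok ?_
  refine T.const hi rfl (by norm_num) hok ?_
  refine T.jump_eq hi (l := 36) rfl (by norm_num) hok (by norm_num) rfl ?_
  exact T_tail_local hi h (fun _ => rfl) (by omega) (var_of_ten _ _) rfl rfl rfl rfl

lemma T_load {d a : ℕ} (hi : (Z.A p)[st.pc]? = some (.load d a))
    (h : StartMem p st N pm) : T p st.pc 43 0 rv pm (Base p st N) := by
  have hok := h.ok (stable_baseA p st N) fun _ hw => hw.2
  refine T_start hi h rfl ?_
  refine T.read_priv hi (11 + a) rfl (by norm_num) hok rfl (u := st.vars a) (h.vars a) ?_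
  refine T.const hi rfl (by norm_num) hok ?_
  refine T.alu hi rfl (by norm_num) hok (u := (Z.n + 4) * st.vars a) (Nat.mul_comm _ _) ?_
  refine T.const hi rfl (by norm_num) hok ?_
  refine T.alu hi rfl (by norm_num) hok (u := priv Z.n p (11 + st.vars a)) (priv_var _ _ _) ?_
  refine T.read_priv hi (11 + st.vars a) rfl (by norm_num) hok rfl (u := st.vars (st.vars a)) (h.vars _) ?_
  refine T.const hi rfl (by norm_num) hok ?_
  refine T.const hi rfl (by norm_num) hok ?_
  refine T.const hi rfl (by norm_num) hok ?_
  refine T.jump_eq hi (l := 36) rfl (by norm_num) hok (by norm_num) rfl ?_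
  exact T_tail_local hi h (fun _ => rfl) (by omega) (update_var _ d _) rfl rfl rfl rfl

lemma T_store {a b : ℕ} (hi : (Z.A p)[st.pc]? = some (.store a b))
    (h : StartMem p st N pm) : T p st.pc 43 0 rv pm (Base p st N) := by
  have hok := h.ok (stable_baseA p st N) fun _ hw => hw.2
  refine T_start hi h rfl ?_
  refine T.read_priv hi (11 + b) rfl (by norm_num) hok rfl (u := st.vars b) (h.vars b) ?_
  refine T.const hi rfl (by norm_num) hok ?_
  refine T.read_priv hi (11 + a) rfl (by norm_num) hok rfl (u := st.vars a) (h.vars a) ?_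
  refine T.const hi rfl (by norm_num) hok ?_
  refine T.alu hi rfl (by norm_num) hok (u := (Z.n + 4) * st.vars a) (Nat.mul_comm _ _) ?_
  refine T.const hi rfl (by norm_num) hok ?_
  refine T.alu hi rfl (by norm_num) hok (u := priv Z.n p (11 + st.vars a)) (priv_var _ _ _) ?_
  refine T.const hi rfl (by norm_num) hok ?_
  refine T.const hi rfl (by norm_num) hok ?_
  refine T.jump_eq hi (l := 36) rfl (by norm_num) hok (by norm_num) rfl ?_
  exact T_tail_local hi h (fun _ => rfl) (by omega) (update_var _ (st.vars a) _) rfl rfl rfl rfl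

end World
end Setup
end PPM

/-! ### The first capsule of Read, Write and CAS -/

namespace PPM
namespace Setup
namespace World

variable {Z : Setup} {p : Fin Z.n} {i : SrcInstr Z.Op} {st st' : Proc ℕ} {N : ℕ} {pm : ℕ → ℕ}
  {rv : Fin 16 → ℕ} {Γ : World Z → Prop}

/-- `p` has found the record `I` in the cell that represents `x`. -/
def Saw (p : Fin Z.n) (I x : ℕ) (w : World Z) : Prop := w.seen p I ∧ w.kind I x

lemma stable_saw (p : Fin Z.n) (I x : ℕ) : Stable p (Saw p I x) :=
  fun _ _ h hw => ⟨h.seen hw.1, h.kind hw.2⟩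

/-- When `p` could still have executed its instruction, `x` had the value `u`, which is stored in
the record `J`. -/
def HadValue (p : Fin Z.n) (x J u : ℕ) (w : World Z) : Prop :=
  w.inst J ∧ w.M (J + 1) = u ∧ w.Pos p fun mem => mem x = u

lemma stable_hadValue (p : Fin Z.n) (x J u : ℕ) : Stable p (HadValue p x J u) :=
  fun _ _ h hw => ⟨h.inst hw.1, (h.value hw.1).trans hw.2.1, h.pos hw.2.2⟩

lemma stable_exists {α : Type} {Γ : α → World Z → Prop} (h : ∀ a, Stable p (Γ a)) :
    Stable p fun w => ∃ a, Γ a w := fun _ _ he ⟨a, hw⟩ => ⟨a, h a _ _ he hw⟩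

lemma BaseA.see {w : World Z} (hG : w.GI) (h : BaseA p st N w) (hs : Stable p Γ) (hΓ : Γ w)
    (x : ℕ) : ∃ w₁, Step p w w₁ ∧ w₁.M = w.M ∧ w₁.comp = w.comp ∧ w₁.act p ∧
      (Γ w₁ ∧ Saw p (w.M (objAddr Z.n x)) x w₁) := by
  obtain ⟨h1, h2⟩ := step_see hG h.1 x
  exact ⟨_, h1, rfl, rfl, h.1, hs _ _ h2 hΓ, .inr ⟨rfl, rfl⟩, hG.kind_obj x⟩

/-- If `I` is still current, the value is the present one. If it has been displaced, the value
belongs to the moment before the displacing Write, which lies inside the instruction of `p` because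
`p` has seen `I`. -/
lemma BaseA.hadValue {w : World Z} (hG : w.GI) (h : BaseA p st N w) {I x : ℕ}
    (hs : Saw p I x w) : HadValue p x (w.M I) (w.M (w.M I + 1)) w := by
  refine ⟨hG.cell_inst hs.2, rfl, ?_⟩
  by_cases hx : w.M (objAddr Z.n x) = I
  · exact h.pos hG (by rw [← hG.value x, hx])
  · obtain ⟨H₁, q, H₂, c, e1, hc, -, hu, ho⟩ := hG.disp hs.2 hx
    exact ⟨h.1, h.2.2.2, H₁, _, c, e1, hc, ho p ⟨h.2.2.2, hs.1⟩, hu⟩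

lemma ownerOf_saw {w : World Z} (hG : w.GI) {I x : ℕ} (hs : Saw p I x w) :
    ownerOf Z.n I = none :=
  ownerOf_rec (hG.isRec (hG.kind_inst hs.2)) 0 (by omega)

lemma ownerOf_inst {w : World Z} (hG : w.GI) {J : ℕ} (hJ : w.inst J) :
    ownerOf Z.n (J + 1) = none :=
  ownerOf_rec (hG.isRec hJ) 1 (by omega)

lemma T_read {d a : ℕ} (hi : (Z.A p)[st.pc]? = some (.base (.read d a)))
    (h : StartMem p st N pm) : T p st.pc 47 0 rv pm (Base p st N) := by
  have hs0 := stable_baseA p st N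
  have hok := h.ok hs0 fun _ hw => hw.2
  have hok1 : ∀ I, Ok p pm fun w => BaseA p st N w ∧ Saw p I (st.vars a) w := fun I =>
    h.ok (hs0.and (stable_saw p I _)) fun _ hw => hw.1.2
  -- The position is fixed when `J` is read, before the value is known; the value word of an
  -- accessible record never changes, so it can be read later.
  have hok2' : ∀ J, Ok p pm fun w => BaseA p st N w ∧ ∃ u, HadValue p (st.vars a) J u w := fun J =>
    h.ok (hs0.and (stable_exists fun u => stable_hadValue p _ J u)) fun _ hw => hw.1.2
  have hok3' : ∀ J u, Ok p pm fun w => BaseA p st N w ∧ HadValue p (st.vars a) J u w := fun J u =>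
    h.ok (hs0.and (stable_hadValue p _ J u)) fun _ hw => hw.1.2
  refine T_start hi h rfl ?_
  refine T.read_priv hi (11 + a) rfl (by norm_num) hok rfl (u := st.vars a) (h.vars a) ?_
  refine T.const hi rfl (by norm_num) hok ?_
  refine T.alu hi rfl (by norm_num) hok (u := (Z.n + 4) * st.vars a) (Nat.mul_comm _ _) ?_
  refine T.const hi rfl (by norm_num) hok ?_
  refine T.alu hi rfl (by norm_num) hok (u := objAddr Z.n (st.vars a)) rfl ?_
  refine T.read_shared hi (Γ' := fun I w => BaseA p st N w ∧ Saw p I (st.vars a) w) rfl (by norm_num)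
    hok rfl (fun w hG hw => ownerOf_objAddr _) (fun I => (hok1 I).stable)
    (fun w hG hact hw => hw.see hG hs0 hw _) (fun I => ?_)
  refine T.read_shared hi
    (Γ' := fun J w => BaseA p st N w ∧ ∃ u, HadValue p (st.vars a) J u w) rfl (by norm_num)
    (hok1 I) rfl (fun w hG hw => ownerOf_saw hG hw.2) (fun J => (hok2' J).stable)
    (fun w hG hact hw => ⟨w, Step.refl p hG, rfl, rfl, hact, hw.1, _, hw.1.hadValue hG hw.2⟩)
    (fun J => ?_)
  have hok2 := hok2' J
  refine T.const hi rfl (by norm_num) hok2 ?_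
  refine T.alu hi rfl (by norm_num) hok2 (u := J + 1) rfl ?_
  refine T.read_shared hi
    (Γ' := fun u w => BaseA p st N w ∧ HadValue p (st.vars a) J u w) rfl (by norm_num)
    hok2 rfl (fun w hG ⟨_, _, hw⟩ => ownerOf_inst hG hw.1) (fun u => (hok3' J u).stable)
    (fun w hG hact ⟨hw, u, hu⟩ => ⟨w, Step.refl p hG, rfl, rfl, hact, hw, ?_⟩)
    (fun u => ?_)
  · exact hu.2.1.symm ▸ hu
  have hok3 := hok3' J u
  refine T.const hi rfl (by norm_num) hok3 ?_
  refine T.const hi rfl (by norm_num) hok3 ?_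
  refine T.const hi rfl (by norm_num) hok3 ?_
  refine T.jump_eq hi (l := 36) rfl (by norm_num) hok3 (by norm_num) rfl ?_
  exact T_tail_fin (st' := casState st d u) hi h hok3.stable (fun _ hw => hw.1)
    (fun _ hG hw => hw.1.canFinish hi hw.2.2.2 fun mem hm => by
      simp [SrcInstr.exec, Instr.exec, hm, casState])
    (by omega) (update_var _ d u) rfl rfl rfl rfl

lemma StartMem.mid (h : StartMem p st N pm) (u d : ℕ) :
    MidMem p st N (tailMem pm u d (st.pc + 1) N (st.pc * 89 + 49)) where
  ptr := h.ptr
  ctx := rfl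
  vars j := by
    unfold tailMem
    iterate 5 rw [Function.update_of_ne (by omega)]
    exact h.vars j
  pc := rfl
  new := rfl

/-- The private memory after the operands of the second capsule have been stored. -/
lemma StartMem.operands (h : StartMem p st N pm) (u d : ℕ) :
    StartMem p st N (Function.update (Function.update pm 8 u) 9 d) :=
  (h.update (by omega) u).update (by omega) d

lemma BaseA.write_own {w : World Z} (hG : w.GI) (h : BaseA p st N w) {e : ℕ} (he : e < 2) (u : ℕ) :
    ∃ w₁, Step p w w₁ ∧ w₁.M = Function.update w.M (N + e) u ∧ w₁.comp = w.comp ∧ w₁.act p ∧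
      BaseA p st N w₁ ∧ w₁.M = Function.update w.M (w₁.own p + e) u := by
  obtain ⟨h1, rfl, h3, h4⟩ := h
  exact ⟨_, step_own hG h4 he u, rfl, rfl, h1, ⟨h1, rfl, h3, h4⟩, rfl⟩

/-- The record of the current instruction of `p` contains `u` in the place `e`. -/
def OwnHas (p : Fin Z.n) (e u : ℕ) (w : World Z) : Prop := w.M (w.own p + e) = u

lemma stable_ownHas {e : ℕ} (he : e < 2) (u : ℕ) :
    Stable p fun w => BaseA p st N w ∧ OwnHas p e u w := by
  rintro w w' h ⟨h1, h2⟩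
  refine ⟨stable_baseA p st N _ _ h h1, ?_⟩
  have h3 := h.own h1.2.2.2
  unfold OwnHas
  rw [h.own_eq]
  interval_cases e
  · exact h3.1.trans h2
  · exact h3.2.trans h2

/-- `p` has initialized its record for a Write of `u`. -/
def OwnReady (p : Fin Z.n) (st : Proc ℕ) (N u : ℕ) (w : World Z) : Prop :=
  (BaseA p st N w ∧ OwnHas p 0 N w) ∧ BaseA p st N w ∧ OwnHas p 1 u w

lemma stable_ownReady (u : ℕ) : Stable p (OwnReady p st N u) :=
  (stable_ownHas (by norm_num) N).and (stable_ownHas (by norm_num) u)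

/-- The record is made to contain itself and the new value before the current record of the cell is
read; nobody can reach it yet, so a restart may repeat all of this. The bound is 23 steps of the
prefix, 13 of the tail and 39 from the second capsule on. -/
lemma T_write {a b : ℕ} (hi : (Z.A p)[st.pc]? = some (.base (.write a b)))
    (h : StartMem p st N pm) : T p st.pc 75 0 rv pm (Base p st N) := by
  have hs0 := stable_baseA p st N
  have hok := h.ok hs0 fun _ hw => hw.2
  have hs1 := stable_ownHas (p := p) (st := st) (N := N) (e := 0) (by norm_num) N
  have hok1 := h.ok hs1 fun _ hw => hw.1.2
  have hs2 := stable_ownReady (p := p) (st := st) (N := N) (st.vars b)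
  have hok2 := h.ok hs2 fun _ hw => hw.1.1.2
  have hs3 : ∀ old, Stable p fun w => OwnReady p st N (st.vars b) w ∧ Saw p old (st.vars a) w :=
    fun old => hs2.and (stable_saw p old _)
  refine T_start hi h rfl ?_
  refine T.read_priv hi 3 rfl (by norm_num) hok rfl (u := N) h.seq ?_
  refine T.write_shared hi (Γ' := fun w => BaseA p st N w ∧ OwnHas p 0 N w) rfl (by norm_num) hok rfl
    (fun w hG hw => hw.2.1 ▸ ownerOf_rec (w.isRec_own p) 0 (by omega)) hs1
    (fun w hG hact hw => ?_) ?_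
  · obtain ⟨w₁, g1, g2, g3, g4, g5, g6⟩ := hw.write_own hG (e := 0) (by omega) N
    exact ⟨w₁, g1, g2, g3, g4, g5, by unfold OwnHas; rw [g6, Function.update_self]⟩
  refine T.const hi rfl (by norm_num) hok1 ?_
  refine T.read_priv hi (11 + b) rfl (by norm_num) hok1 rfl (u := st.vars b) (h.vars b) ?_
  refine T.const hi rfl (by norm_num) hok1 ?_
  refine T.alu hi rfl (by norm_num) hok1 (u := N + 1) rfl ?_
  refine T.write_shared hi (Γ' := OwnReady p st N (st.vars b)) rfl (by norm_num) hok1 rfl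
    (fun w hG hw => hw.1.2.1 ▸ ownerOf_rec (w.isRec_own p) 1 (by omega)) hs2
    (fun w hG hact hw => ?_) ?_
  · obtain ⟨w₁, g1, g2, g3, g4, g5, g6⟩ := hw.1.write_own hG (e := 1) (by omega) (st.vars b)
    refine ⟨w₁, g1, g2, g3, g4, ⟨g5, ?_⟩, g5, by unfold OwnHas; rw [g6, Function.update_self]⟩
    have := hw.2
    unfold OwnHas at this ⊢
    rw [g6, Function.update_of_ne (by omega), g5.2.1, ← hw.1.2.1]
    exact this.trans hw.1.2.1.symm
  refine T.const hi rfl (by norm_num) hok2 ?_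
  refine T.read_priv hi (11 + a) rfl (by norm_num) hok2 rfl (u := st.vars a) (h.vars a) ?_
  refine T.const hi rfl (by norm_num) hok2 ?_
  refine T.alu hi rfl (by norm_num) hok2 (u := (Z.n + 4) * st.vars a) (Nat.mul_comm _ _) ?_
  refine T.const hi rfl (by norm_num) hok2 ?_
  refine T.alu hi rfl (by norm_num) hok2 (u := objAddr Z.n (st.vars a)) rfl ?_
  refine T.read_shared hi
    (Γ' := fun old w => OwnReady p st N (st.vars b) w ∧ Saw p old (st.vars a) w) rfl (by norm_num)
    hok2 rfl (fun w hG hw => ownerOf_objAddr _) hs3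
    (fun w hG hact hw => hw.1.1.see hG hs2 hw _) (fun old => ?_)
  have hok3 := h.ok (hs3 old) fun _ hw => hw.1.1.1.2
  have hok4 := (h.update (a := 8) (by omega) (objAddr Z.n (st.vars a))).ok (hs3 old)
    fun _ hw => hw.1.1.1.2
  have h5 := h.operands (objAddr Z.n (st.vars a)) old
  have hok5 := h5.ok (hs3 old) fun _ hw => hw.1.1.1.2
  refine T.const hi rfl (by norm_num) hok3 ?_
  refine T.write_priv hi 8 rfl (by norm_num) hok3 rfl (u := objAddr Z.n (st.vars a)) rfl ?_
  refine T.const hi rfl (by norm_num) hok4 ?_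
  refine T.write_priv hi 9 rfl (by norm_num) hok4 rfl (u := old) rfl ?_
  refine T.const hi rfl (by norm_num) hok5 ?_
  refine T.const hi rfl (by norm_num) hok5 ?_
  refine T.const hi rfl (by norm_num) hok5 ?_
  refine T.jump_eq hi (l := 36) rfl (by norm_num) hok5 (by norm_num) rfl ?_
  have hA : ∀ w : World Z, OwnReady p st N (st.vars b) w ∧ Saw p old (st.vars a) w →
      WrA p st a b old N w := fun w hw => by
    obtain ⟨⟨⟨⟨g1, g2, g3, g4⟩, g5⟩, -, g6⟩, g7, g8⟩ := hw
    exact ⟨g2, g1, g7, g8, .inl ⟨g4, g3, g5.trans g2.symm, g6⟩⟩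
  refine T_tail (l := 49) (m := 39) hi h5 (hs3 old) (fun _ hw => hw.1.1.1.2) rfl rfl rfl rfl
    (by norm_num) ⟨hs3 old, fun w hG hw => ?_⟩ (fun rv' => ?_)
  · exact ((h5.mid _ _).ok_write hi rfl rfl (stable_wrA st a b old N) (fun _ hw => hw)).rc w hG
      (hA w hw)
  · intro x w hG hv hw
    refine T_mid_write hi (h5.mid _ _) rfl rfl ?_ rv' x w hG hv (hA w hw)
    rw [← hw.1.1.1.2.1]
    exact w.isRec_own p

/-- What `p` knows during its CAS on `x` after it has read the record `old` in the record `W`. -/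
def CasRead (p : Fin Z.n) (x W old e : ℕ) (w : World Z) : Prop :=
  HadValue p x old e w ∧ Saw p W x w ∧
    (w.M W = old ∨ w.M W ≠ old ∧ w.Pos p fun mem => mem x ≠ e)

/-- As soon as another CAS replaces `old` in `W`, `Ext.cell` supplies a position where the value is
not `e`; `cell_ne` then keeps `old` away. -/
lemma stable_casRead (x W old e : ℕ) : Stable p (CasRead p x W old e) := by
  rintro w w' h ⟨h1, h2, h3⟩
  refine ⟨stable_hadValue _ _ _ _ _ _ h h1, stable_saw _ _ _ _ _ h h2, ?_⟩
  rcases h3 with d | ⟨d1, d2⟩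
  · by_cases hW : w'.M W = old
    · exact .inl hW
    · have := (h.cell h2.2 (by rw [d]; exact hW)).2 h2.1 h1.2.2.1 h1.2.2.2.1
      rw [d, h1.2.1] at this
      exact .inr ⟨hW, this⟩
  · exact .inr ⟨h.cell_ne h2.2 h1.1 d1, h.pos d2⟩

/-- The assertion in the first capsule of a CAS after the record `old` has been read. -/
def CasQ (p : Fin Z.n) (st : Proc ℕ) (N x u W old e : ℕ) (w : World Z) : Prop :=
  (BaseA p st N w ∧ OwnHas p 1 u w) ∧ CasRead p x W old e w

lemma stable_casQ (x u W old e : ℕ) : Stable p (CasQ p st N x u W old e) :=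
  (stable_ownHas (by norm_num) u).and (stable_casRead x W old e)

/-- The CAS first acts like a Read. Its second capsule is needed only if the value is the expected
one and would really change. -/
lemma T_cas {d a e b : ℕ} (hi : (Z.A p)[st.pc]? = some (.base (.cas d a e b)))
    (h : StartMem p st N pm) : T p st.pc 85 0 rv pm (Base p st N) := by
  have hs0 := stable_baseA p st N
  have hok := h.ok hs0 fun _ hw => hw.2
  have hs1 := stable_ownHas (p := p) (st := st) (N := N) (e := 1) (by norm_num) (st.vars b)
  have hok1 := h.ok hs1 fun _ hw => hw.1.2
  have hs2 := fun W => hs1.and (stable_saw p W (st.vars a))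
  have hs4 := fun W old u => stable_casQ (p := p) (st := st) (N := N) (st.vars a) (st.vars b) W old u
  have hs3 := fun W old => stable_exists (hs4 W old)
  refine T_start hi h rfl ?_
  refine T.read_priv hi 3 rfl (by norm_num) hok rfl (u := N) h.seq ?_
  refine T.const hi rfl (by norm_num) hok ?_
  refine T.read_priv hi (11 + b) rfl (by norm_num) hok rfl (u := st.vars b) (h.vars b) ?_
  refine T.const hi rfl (by norm_num) hok ?_
  refine T.alu hi rfl (by norm_num) hok (u := N + 1) rfl ?_
  refine T.write_shared hi (Γ' := fun w => BaseA p st N w ∧ OwnHas p 1 (st.vars b) w) rfl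
    (by norm_num) hok rfl
    (fun w hG hw => hw.2.1 ▸ ownerOf_rec (w.isRec_own p) 1 (by omega)) hs1
    (fun w hG hact hw => ?_) ?_
  · obtain ⟨w₁, g1, g2, g3, g4, g5, g6⟩ := hw.write_own hG (e := 1) (by omega) (st.vars b)
    exact ⟨w₁, g1, g2, g3, g4, g5, by unfold OwnHas; rw [g6, Function.update_self]⟩
  refine T.const hi rfl (by norm_num) hok1 ?_
  refine T.read_priv hi (11 + a) rfl (by norm_num) hok1 rfl (u := st.vars a) (h.vars a) ?_
  refine T.const hi rfl (by norm_num) hok1 ?_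
  refine T.alu hi rfl (by norm_num) hok1 (u := (Z.n + 4) * st.vars a) (Nat.mul_comm _ _) ?_
  refine T.const hi rfl (by norm_num) hok1 ?_
  refine T.alu hi rfl (by norm_num) hok1 (u := objAddr Z.n (st.vars a)) rfl ?_
  refine T.read_shared hi
    (Γ' := fun W w => (BaseA p st N w ∧ OwnHas p 1 (st.vars b) w) ∧ Saw p W (st.vars a) w) rfl
    (by norm_num) hok1 rfl (fun w hG hw => ownerOf_objAddr _) hs2
    (fun w hG hact hw => hw.1.see hG hs1 hw _) (fun W => ?_)
  have hok2 := h.ok (hs2 W) fun _ hw => hw.1.1.2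
  refine T.const hi rfl (by norm_num) hok2 ?_
  refine T.read_priv hi (11 + e) rfl (by norm_num) hok2 rfl (u := st.vars e) (h.vars e) ?_
  refine T.const hi rfl (by norm_num) hok2 ?_
  refine T.const hi rfl (by norm_num) hok2 ?_
  refine T.const hi rfl (by norm_num) hok2 ?_
  refine T.read_shared hi
    (Γ' := fun old w => ∃ u, CasQ p st N (st.vars a) (st.vars b) W old u w) rfl
    (by norm_num) hok2 rfl (fun w hG hw => ownerOf_saw hG hw.2) (hs3 W)
    (fun w hG hact hw => ⟨w, Step.refl p hG, rfl, rfl, hact, _, hw.1, hw.1.1.hadValue hG hw.2,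
      hw.2, .inl rfl⟩) (fun old => ?_)
  have hok3 := h.ok (hs3 W old) fun _ ⟨_, hw⟩ => hw.1.1.2
  refine T.const hi rfl (by norm_num) hok3 ?_
  refine T.alu hi rfl (by norm_num) hok3 (u := old + 1) rfl ?_
  refine T.read_shared hi (Γ' := CasQ p st N (st.vars a) (st.vars b) W old) rfl
    (by norm_num) hok3 rfl (fun w hG ⟨_, hw⟩ => ownerOf_inst hG hw.2.1.1) (hs4 W old)
    (fun w hG hact ⟨u, hw⟩ => ⟨w, Step.refl p hG, rfl, rfl, hact, ?_⟩) (fun u => ?_)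
  · exact hw.2.1.2.1.symm ▸ hw
  have hok4 := h.ok (hs4 W old u) fun _ hw => hw.1.1.2
  refine T.const hi rfl (by norm_num) hok4 ?_
  by_cases hu : u = st.vars e
  swap
  -- The value read differs from the expected one: the CAS fails at the position of the Read.
  · refine T.jump_ne hi rfl (by norm_num) hok4 hu ?_
    refine (T.jump_eq hi (l := 36) rfl (by norm_num) hok4 (by norm_num) rfl ?_).mono
      (by norm_num : 33 ≤ 60)
    exact T_tail_fin (st' := casState st d 0) hi h hok4.stable (fun _ hw => hw.1.1)
      (fun _ hG hw => hw.1.1.canFinish hi hw.2.1.2.2 fun mem hm => by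
        simp [SrcInstr.exec, Instr.exec, hm, hu, casState])
      (by omega) (update_var _ d 0) rfl rfl rfl rfl
  refine T.jump_eq hi (l := 26) rfl (by norm_num) hok4 (by norm_num) hu ?_
  refine T.const hi rfl (by norm_num) hok4 ?_
  by_cases hb : st.vars e = st.vars b
  -- The new value is the expected one: the CAS succeeds at the position of the Read without
  -- changing the memory. Excluding this case guarantees that each hardware CAS on a record changes
  -- the value.
  · refine (T.jump_eq hi (l := 36) rfl (by norm_num) hok4 (by norm_num) hb ?_).mono
      (by norm_num : 33 ≤ 59)
    exact T_tail_fin (st' := casState st d 1) hi h hok4.stable (fun _ hw => hw.1.1)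
      (fun _ hG hw => hw.1.1.canFinish hi hw.2.1.2.2 fun mem hm => by
        simp [SrcInstr.exec, Instr.exec, hm, hu, casState, ← hb])
      (by omega) (update_var _ d 1) rfl rfl rfl rfl
  · refine T.jump_ne hi rfl (by norm_num) hok4 hb ?_
    have hok5 := (h.update (a := 8) (by omega) W).ok (hs4 W old u) fun _ hw => hw.1.1.2
    have h6 := h.operands W old
    have hok6 := h6.ok (hs4 W old u) fun _ hw => hw.1.1.2
    refine T.const hi rfl (by norm_num) hok4 ?_
    refine T.write_priv hi 8 rfl (by norm_num) hok4 rfl (u := W) rfl ?_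
    refine T.const hi rfl (by norm_num) hok5 ?_
    refine T.write_priv hi 9 rfl (by norm_num) hok5 rfl (u := old) rfl ?_
    refine T.const hi rfl (by norm_num) hok6 ?_
    refine T.jump_eq hi (l := 36) rfl (by norm_num) hok6 (by norm_num) rfl ?_
    have hA : ∀ w : World Z, CasQ p st N (st.vars a) (st.vars b) W old u w →
        CasA p st d a e b W old N w := fun w hw => by
      obtain ⟨⟨⟨g1, g2, g3, g4⟩, g5⟩, ⟨k1, k2, k3⟩, k4, k5⟩ := hw
      subst hu
      exact ⟨g2, g1, k4.1, k4.2, k1, k2, Ne.symm hb, .inl ⟨g4, g3, g5, k5⟩⟩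
    refine T_tail (l := 49) (m := 39) hi h6 (hs4 W old u) (fun _ hw => hw.1.1.2) rfl rfl rfl rfl
      (by norm_num) ⟨hs4 W old u, fun w hG hw => ?_⟩ (fun rv' => ?_)
    · exact ((h6.mid _ _).ok_cas hi rfl stable_casA (fun _ hw => hw)).rc w hG (hA w hw)
    · intro x w hG hv hw
      refine T_mid_cas hi (h6.mid _ _) rfl ?_ rv' x w hG hv (hA w hw)
      rw [← hw.1.1.2.1]
      exact w.isRec_own p

lemma T_block (hi : (Z.A p)[st.pc]? = some i) (h : StartMem p st N pm) (rv : Fin 16 → ℕ) :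
    T p st.pc 89 0 rv pm (Base p st N) := by
  rcases i with (_ | _ | _ | _ | _ | _ | _) | _ | _
  · exact (T_const hi h).mono (by norm_num)
  · exact (T_alu hi h).mono (by norm_num)
  · exact (T_jumpEq hi h).mono (by norm_num)
  · exact (T_jumpTo hi h).mono (by norm_num)
  · exact (T_read hi h).mono (by norm_num)
  · exact (T_write hi h).mono (by norm_num)
  · exact (T_cas hi h).mono (by norm_num)
  · exact (T_load hi h).mono (by norm_num)
  · exact (T_store hi h).mono (by norm_num)

end World
end Setup
end PPM

namespace PPM
namespace Setup
namespace World

variable {Z : Setup} {p : Fin Z.n} {x y : Z.Trk} {w w' : World Z}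

/-! ### The invariant -/

/-- `p` is at the restart location of its first capsule, and the simulated process has halted. -/
def AtEnd (p : Fin Z.n) (x : Z.Trk) (w : World Z) : Prop :=
  Rec₁ p (view p w) w ∧ (x.config.proc p).pc = (w.c.proc p).pc * 89 ∧
    (Z.A p)[(w.c.proc p).pc]? = none

/-- Unless `p` has halted or crashes, it completes its current instruction within `r` steps. -/
def Within (p : Fin Z.n) (r : ℕ) (x : Z.Trk) (w : World Z) : Prop :=
  (∃ m ≤ r, Safe p m x w) ∨ (AfterB p x w ∧ 90 ≤ r) ∨ AtEnd p x w

lemma Within.rc {r : ℕ} (h : Within p r x w) : Rec p (view p w) w := by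
  rcases h with ⟨m, -, h⟩ | ⟨h, -⟩ | h
  · cases m with
    | zero => exact h.elim
    | succ m => exact h.1
  · exact .inl h.1
  · exact .inl h.1

lemma rec₁_ext (h : Rec₁ p (view p w) w) (he : Ext p w w') (hv : view p w' = view p w) :
    Rec₁ p (view p w') w' := by
  rw [hv]; exact stable_rec₁ p _ _ _ he h

lemma Within.ext {r : ℕ} (h : Within p r x w) (hG : w.GI) (he : Ext p w w')
    (hv : view p w' = view p w) (hp : y.config.proc p = x.config.proc p) : Within p r y w' := by
  rcases h with ⟨m, hm, h⟩ | ⟨⟨h1, h2⟩, hr⟩ | ⟨h1, h2, h3⟩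
  · exact .inl ⟨m, hm, h.ext hG he hv hp⟩
  · refine .inr (.inl ⟨⟨rec₁_ext h1 he hv, ?_⟩, hr⟩)
    rw [hv, hp]; exact h2
  · refine .inr (.inr ⟨rec₁_ext h1 he hv, ?_, ?_⟩)
    · rw [hp, he.proc]; exact h2
    · rw [he.proc]; exact h3

/-- Either there is a next instruction and `T_block` applies, or the simulated process has halted.
-/
lemma Rec₁.within (h : Rec₁ p (view p w) w) (hg : Good x w)
    (hpc : (x.config.proc p).pc = view p w 1) : Within p 89 x w := by
  obtain ⟨st, h1, h2, h3, h4, h5, h6, h7⟩ := id h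
  cases hi : (Z.A p)[st.pc]? with
  | none => exact .inr (.inr ⟨h, by rw [hpc, h2, h6], by rw [h6]; exact hi⟩)
  | some i =>
    exact .inl ⟨89, le_rfl, T_block hi ⟨h1, h2, h3, h4, h5⟩ _ x w hg rfl ⟨rfl, h6, h7⟩
      (hpc.trans h2) (fun k => rfl)⟩

lemma halted_of_pc {s : ℕ} (hpc : (y.config.proc p).pc = s * 89)
    (h : (Z.S.translate Z.A).Halted y.config p) : (Z.A p)[s]? = none := by
  by_contra hn
  obtain ⟨i, hi⟩ := Option.ne_none_iff_exists'.mp hn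
  exact Z.translate_isSome (j := 0) hi (by omega) (by rw [add_zero, ← hpc]; exact h)

/-- `p` arrives at the restart location of its first capsule. -/
lemma Good.arrive (hg : Good x w) (h : Rec₁ p (view p w) w)
    (hproc : ∀ q, q ≠ p → y.config.proc q = x.config.proc q)
    (hidle : ∀ q, q ≠ p → y.idle q = x.idle q) (hmem : y.config.mem = x.config.mem)
    (hcomp : y.completed = x.completed) (hpc : (y.config.proc p).pc = view p w 1) :
    ∃ w', Trans p w w' y ∧ Within p 89 y w' := by
  obtain ⟨st, h1, h2, h3, h4, h5, h6, h7⟩ := id h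
  have hs : Z.S.Stores w.M p (w.c.proc p) := by
    rw [h6]; exact ⟨h3, h5⟩
  obtain ⟨t1, t2⟩ := hg.record (y := y) (step_forget hg.gi h7 hs (Active y p)) hproc hidle
    (hg.mem.trans hmem.symm) (hg.comp.trans hcomp.symm) (by simp [forget])
    (fun hh => by
      show (Z.A p)[(w.c.proc p).pc]? = none
      rw [h6]
      exact halted_of_pc (hpc.trans h2) hh)
  refine ⟨_, t1, Rec₁.within (stable_rec₁ p _ _ _ t2 ?_) t1.good hpc⟩
  exact ⟨st, h1, h2, h3, h4, h5, h6, h7⟩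

lemma AfterB.step (hg : Good x w) (h : AfterB p x w) (hy : track x (.step p) = some y) :
    ∃ w', Trans p w w' y ∧ Within p 89 y w' := by
  obtain ⟨h1, s, i, hi, hpc, h3⟩ := h
  have hy' := track_step (I := .jumpTo (reg Z.hv 3)) hi (by norm_num) hpc
    (blockCode_suffix _ _ _ _ _ (by norm_num) rfl) hy
  refine hg.arrive h1 (fun q hq => ?_) (fun q hq => ?_) ?_ ?_ ?_
  · rw [hy']; exact Function.update_of_ne hq _ _
  · rw [hy']; exact Function.update_of_ne hq _ _
  · rw [hy']; rfl
  · rw [hy']; rfl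
  · rw [hy']; simpa [Instr.exec] using h3

lemma track_completed {e : Event Z.v Z.n} (hy : track x e = some y) (q : Fin Z.n) :
    x.completed q ≤ y.completed q := by
  simp only [track, Simulator.track, Option.map_eq_some_iff] at hy
  obtain ⟨c, -, rfl⟩ := hy
  cases e with
  | crash => exact le_rfl
  | step p =>
    dsimp only
    split_ifs
    · by_cases hq : q = p
      · subst hq; simp
      · simp [hq]
    · exact le_rfl

lemma track_boundary {s : ℕ} (hpc : (x.config.proc p).pc = s * 89 + 87)
    (hy : track x (.step p) = some y) : x.completed p < y.completed p := by
  simp only [track, Simulator.track, Option.map_eq_some_iff] at hy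
  obtain ⟨c, -, rfl⟩ := hy
  have hb : Z.S.AtBoundary x.config p := by
    show (x.config.proc p).pc % 89 = 87
    omega
  simp [hb]

/-- The counter decreases unless an instruction is completed. It restarts at 90: one step for the
jump behind the boundary and 89 for the next block. -/
lemma Within.step {r : ℕ} (hr : r ≤ 90) (hg : Good x w) (h : Within p r x w)
    (hy : track x (.step p) = some y) : ∃ w' r', Trans p w w' y ∧ r' ≤ 90 ∧ Within p r' y w' ∧
      (x.completed p < y.completed p ∨ r' < r) := by
  rcases h with ⟨m, hm, h⟩ | ⟨h, h90⟩ | ⟨h1, h2, h3⟩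
  · cases m with
    | zero => exact h.elim
    | succ m =>
      obtain ⟨s, j, i, ins, g1, g2, g3, g4, g5, g6⟩ := h.2 x w (Ext.refl p w) rfl rfl hg
      obtain ⟨w', t, ⟨rfl, h'⟩ | ⟨hj, h'⟩⟩ := g6 y hy
      · exact ⟨w', 90, t, le_rfl, .inr (.inl ⟨h', le_rfl⟩), .inl (track_boundary g1 hy)⟩
      · exact ⟨w', m, t, by omega, .inl ⟨m, le_rfl, h'⟩, .inr (by omega)⟩
  · obtain ⟨w', t, h'⟩ := h.step hg hy
    exact ⟨w', 89, t, by omega, h', .inr (by omega)⟩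
  · exfalso
    simp only [track, Simulator.track, PProgram.next, Option.map_eq_some_iff] at hy
    obtain ⟨c, ⟨I, hI, -⟩, -⟩ := hy
    have := Z.translate_getElem? p (w.c.proc p).pc 0 (by omega)
    rw [add_zero, ← h2, hI, h3] at this
    simp at this

lemma Good.continue (hg : Good x w) (hact : w.act p)
    (hproc : ∀ q, q ≠ p → y.config.proc q = x.config.proc q) (hidle : y.idle = x.idle)
    (hmem : y.config.mem = x.config.mem) (hcomp : y.completed = x.completed)
    (hnh : ¬(Z.S.translate Z.A).Halted y.config p) :
    Trans p w (w.record y) y ∧ Ext p w (w.record y) := by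
  refine hg.record (Step.refl p hg.gi) hproc (fun q _ => by rw [hidle])
    (hg.mem.trans hmem.symm) (hg.comp.trans hcomp.symm) ?_ (fun hh => absurd hh hnh)
  have := ((hg.act p).mp hact).1
  exact ⟨fun _ => ⟨by rw [hidle]; exact this, hnh⟩, fun _ => hact⟩

/-- Cells 0 and 1 lead to the start of the current capsule. The reloaded volatile words are not
relied upon: the rules for the three restart locations hold for arbitrary registers. -/
lemma Rec.crash (h : Rec p (view p w) w) (hg : Good x w) {junk : Fin Z.v → ℕ}
    (hy : track x (.crash p junk) = some y) : ∃ w', Trans p w w' y ∧ Within p 89 y w' := by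
  simp only [track, Simulator.track, PProgram.next, Option.map_some, Option.some.injEq] at hy
  have hpr : ∀ q, q ≠ p → y.config.proc q = x.config.proc q := fun q hq => by
    rw [← hy]; exact Function.update_of_ne hq _ _
  have hidle : y.idle = x.idle := by rw [← hy]
  have hmem : y.config.mem = x.config.mem := by rw [← hy]
  have hcomp : y.completed = x.completed := by rw [← hy]
  have hpc : view p w 0 = priv Z.n p 1 → (y.config.proc p).pc = view p w 1 := fun h0 => by
    rw [← hy]
    simp only [Function.update_self, restart]
    unfold view at h0 ⊢
    rw [priv_zero] at h0
    rw [← hg.mem, h0]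
  rcases h with h | h | h
  -- In the first capsule, `p` forgets the records it has seen and starts again; in the other two it
  -- keeps its assertion.
  · exact hg.arrive h hpr (fun q _ => by rw [hidle]) hmem hcomp (hpc (by obtain ⟨_, h, -⟩ := h; exact h))
  · obtain ⟨st, i, hi, h1, h2, h3, h4, h5, h6⟩ := id h
    have hpc' := (hpc h1).trans h2
    have hnh : ¬(Z.S.translate Z.A).Halted y.config p := by
      unfold PProgram.Halted; rw [hpc']; exact Z.translate_isSome hi (by omega)
    have hact : w.act p := by
      rcases h6 with ⟨a, b, -, -, -, g⟩ | ⟨d, a, e, u, -, -, g⟩ <;> exact g.1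
    obtain ⟨t1, t2⟩ := hg.continue hact hpr hidle hmem hcomp hnh
    refine ⟨_, t1, .inl ⟨39, by omega, ?_⟩⟩
    have hm : MidMem p st (w.own p) (view p w) := ⟨h1, h2, h3, h4, h5⟩
    rcases h6 with ⟨a, b, rfl, g1, g2, g3⟩ | ⟨d, a, e, u, rfl, g1, g3⟩
    · exact T_mid_write hi hm g1 g2 (w.isRec_own p) _ _ _ t1.good rfl
        (stable_wrA _ _ _ _ _ _ _ t2 ⟨rfl, g3⟩) hpc' (fun _ => rfl)
    · exact T_mid_cas hi hm g1 (w.isRec_own p) _ _ _ t1.good rfl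
        (stable_casA _ _ t2 ⟨rfl, g3⟩) hpc' (fun _ => rfl)
  · obtain ⟨s, i, st, k, hi, h1, h2, h3, h4, h5, h6, h7, h8⟩ := id h
    have hpc' := (hpc h1).trans h2
    have hnh : ¬(Z.S.translate Z.A).Halted y.config p := by
      unfold PProgram.Halted; rw [hpc']; exact Z.translate_isSome hi (by omega)
    obtain ⟨t1, t2⟩ := hg.continue h8.1 hpr hidle hmem hcomp hnh
    refine ⟨_, t1, .inl ⟨19, by omega, ?_⟩⟩
    have hm : FinMem p s st k (w.own p) (view p w) := ⟨h1, h2, h3, h4, h5, h6, h7⟩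
    exact T_fin hi hm _ _ _ t1.good rfl (stable_finAssert _ _ _ _ _ t2 ⟨rfl, h8⟩) hpc'
      (fun _ => rfl)

/-- The invariant of the simulating program. -/
structure Inv (x : Z.Trk) (r : Fin Z.n → ℕ) (w : World Z) : Prop where
  good : Good x w
  le : ∀ q, r q ≤ 90
  within : ∀ q, Within q (r q) x w

lemma Inv.update {r : Fin Z.n → ℕ} {r' : ℕ} (h : Inv x r w) (ht : Trans p w w' y)
    (hproc : ∀ q, q ≠ p → y.config.proc q = x.config.proc q) (hr : r' ≤ 90)
    (hw : Within p r' y w') : Inv y (Function.update r p r') w' := by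
  refine ⟨ht.good, fun q => ?_, fun q => ?_⟩
  · by_cases hq : q = p
    · subst hq; simpa using hr
    · simpa [hq] using h.le q
  · by_cases hq : q = p
    · subst hq; simpa using hw
    · rw [Function.update_of_ne hq]
      exact (h.within q).ext h.good.gi (ht.ext q hq) (ht.view q hq) (hproc q hq)

lemma track_proc {q : Fin Z.n} (hq : q ≠ p) {e : Event Z.v Z.n} (hy : track x e = some y)
    (he : e = .step p ∨ ∃ junk, e = .crash p junk) : y.config.proc q = x.config.proc q := by
  simp only [track, Simulator.track, Option.map_eq_some_iff] at hy
  obtain ⟨c, hc, rfl⟩ := hy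
  rcases he with rfl | ⟨junk, rfl⟩
  · simp only [PProgram.next, Option.map_eq_some_iff] at hc
    obtain ⟨I, -, rfl⟩ := hc
    dsimp only
    split_ifs <;> cases I <;> simp [Function.update_of_ne hq]
  · simp only [PProgram.next, Option.some.injEq] at hc
    subst hc
    exact Function.update_of_ne hq _ _

/-- Events of other processes leave the counter of `q` unchanged, which gives a bound independent of
the schedule. -/
lemma Inv.next {r : Fin Z.n → ℕ} (h : Inv x r w) {e : Event Z.v Z.n} (hy : track x e = some y) :
    ∃ w' r', Inv y r' w' ∧ snaps w'.H = snaps w.H ++ [y] ∧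
      ∀ q, e.isCrash q = false → if e.isStep q then x.completed q < y.completed q ∨ r' q < r q
        else r' q = r q := by
  cases e with
  | step p =>
    obtain ⟨w', r', t, h1, h2, h3⟩ := (h.within p).step (h.le p) h.good hy
    refine ⟨w', _, h.update t (fun q hq => track_proc hq hy (.inl rfl)) h1 h2, t.snaps,
      fun q _ => ?_⟩
    by_cases hq : q = p
    · subst hq; simpa [Event.isStep] using h3
    · simp [Event.isStep, Ne.symm hq, hq]
  | crash p junk =>
    obtain ⟨w', t, h2⟩ := (h.within p).rc.crash h.good hy
    refine ⟨w', _, h.update t (fun q hq => track_proc hq hy (.inr ⟨_, rfl⟩)) (by norm_num) h2,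
      t.snaps, fun q hq => ?_⟩
    have : p ≠ q := by simpa [Event.isCrash] using hq
    simp [Event.isStep, Ne.symm this]

/-! ### The start -/

def startTrk (Z : Setup) (junk : Fin Z.n → Fin Z.v → ℕ) : Z.Trk :=
  ⟨Z.S.start Z.m₀ junk, fun _ => 0, fun _ => true⟩

/-- The start state is already recorded, so the state with index `t` is the one after `t` events. -/
def init (Z : Setup) (junk : Fin Z.n → Fin Z.v → ℕ) : World Z where
  M a := Sum.elim id Z.m₀ (initCell Z.n a)
  H := [.snap (startTrk Z junk)]
  c := srcStart Z.m₀
  kind I x := I = initRec Z.n x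
  inst I := ∃ x, I = initRec Z.n x
  seen _ _ := False
  comp _ := 0
  act _ := False

lemma stores_init (junk : Fin Z.n → Fin Z.v → ℕ) (p : Fin Z.n) :
    Z.S.Stores (init Z junk).M p ((init Z junk).c.proc p) := by
  refine ⟨?_, fun j => ?_⟩
  · show Sum.elim id Z.m₀ (initCell Z.n (priv Z.n p 2)) = 0
    rw [initCell_priv]; rfl
  · show Sum.elim id Z.m₀ (initCell Z.n (priv Z.n p (11 + j))) = 0
    rw [initCell_priv, if_neg (by omega), if_neg (by omega)]; rfl

lemma halted_init {junk : Fin Z.n → Fin Z.v → ℕ} {p : Fin Z.n}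
    (h : (Z.S.translate Z.A).Halted (startTrk Z junk).config p) :
    Z.A.Halted (init Z junk).c p :=
  halted_of_pc (s := 0) (y := startTrk Z junk) rfl h

lemma gi_init (junk : Fin Z.n → Fin Z.v → ℕ) : (init Z junk).GI where
  cfg := rfl
  valid := by
    refine Valid.snoc (H := []) Z (fun H₁ x H₂ e => by simp at e) rfl (fun p => ?_)
    exact ⟨le_rfl, by simp, fun _ => ⟨rfl, stores_init junk p⟩, halted_init⟩
  kind_fun h h' := initRec_inj (h.symm.trans h')
  kind_obj x := by
    show Sum.elim id Z.m₀ (initCell Z.n (objAddr Z.n x)) = _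
    rw [initCell_objAddr]; rfl
  value x := by
    simp [init, initCell_objAddr, initCell_rec (isRec_initRec x), initCell_initRec_val, srcStart]
  kind_inst h := ⟨_, h⟩
  cell_inst {I x} h := by
    subst h
    exact ⟨x, by simp [init, initCell_rec (isRec_initRec x)]⟩
  disp {I x} h hn := by
    subst h
    exact absurd (by simp [init, initCell_objAddr]) hn
  flag hI _ := by simp [init, initCell_rec_flag hI]
  inst_form h := .inl h
  cnt_comp _ := .inl rfl
  seen_kind h := h.elim
  seen_act h := h.elim
  stores p _ := ⟨rfl, stores_init junk p⟩

lemma inv_init (junk : Fin Z.n → Fin Z.v → ℕ) :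
    Inv (startTrk Z junk) (fun _ => 89) (init Z junk) := by
  have hg : Good (startTrk Z junk) (init Z junk) :=
    ⟨rfl, rfl, fun q => ⟨fun h => h.elim, fun h => by simp [Active, startTrk] at h⟩,
      fun q => halted_init, gi_init junk⟩
  have hv : ∀ (q : Fin Z.n) j, view q (init Z junk) j =
      Sum.elim id Z.m₀ (initCell Z.n (priv Z.n q j)) := fun _ _ => rfl
  refine ⟨hg, fun _ => by norm_num, fun q => Rec₁.within ⟨⟨0, fun _ => 0⟩, ?_, ?_, ?_, ?_, ?_,
    rfl, rfl⟩ hg ?_⟩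
  · rw [hv, initCell_priv]; rfl
  · rw [hv, initCell_priv]; rfl
  · rw [hv, initCell_priv]; rfl
  · rw [hv, initCell_priv]; rfl
  · exact (stores_init junk q).2
  · rw [hv, initCell_priv]; rfl

/-! ### Executions -/

def runs (junk : Fin Z.n → Fin Z.v → ℕ) (E : List (Event Z.v Z.n)) : Option Z.Trk :=
  Z.S.run Z.interp Z.ctx Z.A Z.m₀ junk E

lemma runs_append (junk : Fin Z.n → Fin Z.v → ℕ) (E F : List (Event Z.v Z.n)) :
    runs junk (E ++ F) = (runs junk E).bind fun x => F.foldlM track x := by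
  show List.foldlM _ _ _ = _
  rw [List.foldlM_append]; rfl

/-- Insertions do not affect the sequence of states in the history, so the final history still lists
the states after all prefixes of `E`. -/
lemma exists_inv (junk : Fin Z.n → Fin Z.v → ℕ) (E : List (Event Z.v Z.n)) :
    ∀ x, runs junk E = some x → ∃ w r, Inv x r w ∧ (snaps w.H).length = E.length + 1 ∧
      ∀ t ≤ E.length, runs junk (E.take t) = (snaps w.H)[t]? := by
  induction E using List.reverseRecOn with
  | nil =>
    intro x hx
    obtain rfl : startTrk Z junk = x := Option.some.inj hx
    refine ⟨_, _, inv_init junk, rfl, fun t ht => ?_⟩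
    obtain rfl : t = 0 := by simpa using ht
    rfl
  | append_singleton E e ih =>
    intro y hy
    have hy' := hy
    rw [runs_append, Option.bind_eq_some_iff] at hy
    obtain ⟨x, hx, hxy⟩ := hy
    simp only [List.foldlM_cons, List.foldlM_nil, bind_pure] at hxy
    obtain ⟨w, r, h1, h2, h3⟩ := ih x hx
    obtain ⟨w', r', g1, g2, -⟩ := h1.next hxy
    refine ⟨w', r', g1, by simp [g2, h2], fun t ht => ?_⟩
    rw [List.length_append, List.length_singleton] at ht
    rw [g2]
    rcases Nat.lt_or_ge t (E.length + 1) with h | h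
    · rw [List.getElem?_append_left (by omega), List.take_append_of_le_length (by omega)]
      exact h3 t (by omega)
    · obtain rfl : t = E.length + 1 := by omega
      rw [List.take_of_length_le (by simp), hy', ← h2]
      simp

/-- Each step of `p` lowers its counter or completes an instruction, so more than `r p` steps cannot
pass without a completion. -/
lemma Inv.progress : ∀ (F : List (Event Z.v Z.n)) {x y : Z.Trk} {r : Fin Z.n → ℕ} {w : World Z},
    Inv x r w → F.foldlM track x = some y → ∀ p, F.countP (Event.isCrash p) = 0 →
      x.completed p ≤ y.completed p ∧
        (r p < F.countP (Event.isStep p) → x.completed p < y.completed p)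
  | [], x, y, r, w, _, hy, p, _ => by
      obtain rfl : x = y := by simpa using hy
      simp
  | e :: F, x, y, r, w, h, hy, p, hF => by
      rw [List.foldlM_cons] at hy
      obtain ⟨x', hx', hy⟩ := Option.bind_eq_some_iff.mp hy
      obtain ⟨w', r', g1, -, g2⟩ := h.next hx'
      have hc : e.isCrash p = false ∧ F.countP (Event.isCrash p) = 0 := by
        rw [List.countP_cons] at hF
        cases he : e.isCrash p
        · simpa [he] using hF
        · simp [he] at hF
      have h1 := track_completed hx' p
      have h2 := Inv.progress F g1 hy p hc.2
      have h3 := g2 p hc.1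
      refine ⟨h1.trans h2.1, fun hr => ?_⟩
      rw [List.countP_cons] at hr
      split_ifs at h3 hr with hs
      · rcases h3 with h3 | h3
        · omega
        · have := h2.2 (by omega); omega
      · have := h2.2 (by omega); omega

end World
end Setup
end PPM

/-! ### From the final history to the theorem -/

namespace PPM

section Lists

variable {v n : ℕ}

/-- The instructions in a history before the state with index `t`. -/
def opsBefore : List (Lbl v n) → ℕ → List (Fin n)
  | [], _ => []
  | .op p _ :: H, t => p :: opsBefore H t
  | .snap _ :: _, 0 => []
  | .snap _ :: H, t + 1 => opsBefore H t

/-- Within one fixed history the instructions before successive states extend each other, so their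
differences can be attached to the events. -/
lemma opsBefore_prefix : ∀ (H : List (Lbl v n)) (t : ℕ), opsBefore H t <+: opsBefore H (t + 1)
  | [], _ => List.prefix_rfl
  | .op p _ :: H, t => by
      simpa only [opsBefore, List.cons_prefix_cons, true_and] using opsBefore_prefix H t
  | .snap _ :: H, 0 => List.nil_prefix
  | .snap _ :: H, t + 1 => opsBefore_prefix H t

lemma exists_split_snap : ∀ (H : List (Lbl v n)) (t : ℕ) {x : Simulator.Tracked v n},
    (snaps H)[t]? = some x → ∃ H₁ H₂, H = H₁ ++ .snap x :: H₂ ∧ ops H₁ = opsBefore H t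
  | [], _, _, h => by simp at h
  | .op p τ :: H, t, x, h => by
      obtain ⟨H₁, H₂, rfl, h2⟩ := exists_split_snap H t (x := x) h
      exact ⟨.op p τ :: H₁, H₂, rfl, by simp [opsBefore, h2]⟩
  | .snap y :: H, 0, x, h => by
      obtain rfl : y = x := by simpa using h
      exact ⟨[], H, rfl, rfl⟩
  | .snap y :: H, t + 1, x, h => by
      obtain ⟨H₁, H₂, rfl, h2⟩ := exists_split_snap H t (x := x) (by simpa using h)
      exact ⟨.snap y :: H₁, H₂, rfl, by simp [opsBefore, h2]⟩

/-- The instructions in a history between the states with indices `t` and `t + 1`. -/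
def opsBetween (H : List (Lbl v n)) (t : ℕ) : List (Fin n) :=
  (opsBefore H (t + 1)).drop (opsBefore H t).length

lemma flatMap_opsBetween {H : List (Lbl v n)} (h : opsBefore H 0 = []) (t : ℕ) :
    (List.range t).flatMap (opsBetween H) = opsBefore H t := by
  induction t with
  | zero => exact h.symm
  | succ t ih =>
    rw [List.range_succ, List.flatMap_append, ih, List.flatMap_singleton, opsBetween]
    obtain ⟨L, hL⟩ := opsBefore_prefix H t
    rw [← hL, List.drop_left]

end Lists

namespace Setup

open World

variable (Z : Setup)

/-- The linearization is read off the history at the end of `E`, after all insertions into the past;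
`Valid` explains every earlier state by the same history. -/
theorem simulates : Z.S.Simulates Z.interp Z.ctx Z.A Z.m₀ := by
  intro junk E hE
  obtain ⟨x, hx⟩ := Option.isSome_iff_exists.mp hE
  obtain ⟨w, r, hI, -, hs⟩ := exists_inv junk E x hx
  have key : ∀ t ≤ E.length, ∀ y, runs junk (E.take t) = some y →
      ∃ c, Z.A.run Z.interp Z.m₀ (opsBefore w.H t) = some c ∧
        Z.SnapOK y c fun p => (opsBefore w.H t).count p := fun t ht y hy => by
    rw [hs t ht] at hy
    obtain ⟨H₁, H₂, e, h⟩ := exists_split_snap w.H t hy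
    obtain ⟨c, hc, hok⟩ := hI.good.gi.valid H₁ y H₂ e
    rw [← h]
    exact ⟨c, hc, hok⟩
  -- All processes are idle in the start state with no completed instruction, so nothing can have
  -- been inserted before it. The union over the events then misses no instruction.
  have h0 : opsBefore w.H 0 = [] := by
    obtain ⟨c, -, hok⟩ := key 0 (Nat.zero_le _) (startTrk Z junk) rfl
    refine List.eq_nil_iff_forall_not_mem.mpr fun p hp => ?_
    have h1 : (opsBefore w.H 0).count p = 0 := ((hok p).2.2.1 (.inl rfl)).1
    exact List.count_eq_zero.mp h1 hp
  refine ⟨opsBetween w.H, fun t ht y hy => ?_⟩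
  rw [flatMap_opsBetween h0]
  exact key t ht y hy

variable {Z}

lemma exists_run {junk : Fin Z.n → Fin Z.v → ℕ} {E F : List (Event Z.v Z.n)} {x y : Z.Trk}
    (hx : runs junk E = some x) (hy : runs junk (E ++ F) = some y) :
    F.foldlM track x = some y := by
  rw [runs_append, hx] at hy
  exact hy

variable (Z)

theorem computationDelay {k : ℕ} (hk : 90 < k) :
    Z.S.ComputationDelay Z.interp Z.ctx Z.A Z.m₀ k := by
  intro junk E F x y p hx hy _ hF hkF
  obtain ⟨w, r, hI, -⟩ := exists_inv junk E x hx
  have := hI.le p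
  exact (hI.progress F (exists_run hx hy) p hF).2 (by omega)

/-- The crash itself is an event that preserves the invariant, with a new counter of at most 90
steps. -/
theorem recoveryDelay {k : ℕ} (hk : 90 < k) :
    Z.S.RecoveryDelay Z.interp Z.ctx Z.A Z.m₀ k := by
  intro junk E F x y p junk' hx hy hF hkF
  obtain ⟨w, r, hI, -⟩ := exists_inv junk E x hx
  have h := exists_run hx hy
  rw [List.foldlM_cons] at h
  obtain ⟨x', hx', h⟩ := Option.bind_eq_some_iff.mp h
  obtain ⟨w', r', hI', -⟩ := hI.next hx'
  have h1 := hI'.le p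
  have h2 := (hI'.progress F h p hF).2 (by omega)
  have h3 := track_completed hx' p
  omega

/-- Locality is part of `Safe`; the only other instruction that can be executed is the jump behind
the boundary, which accesses no memory. -/
theorem preservesLocality : Z.S.PreservesLocality Z.interp Z.ctx Z.A Z.m₀ := by
  intro junk E x p i j a hx hi hj ha
  obtain ⟨w, r, hI, -⟩ := exists_inv junk E x hx
  change (Z.A p)[(x.config.proc p).pc / 89]? = some i at hi
  rcases hI.within p with ⟨m, -, h⟩ | ⟨⟨-, s, i', h1, h2, -⟩, -⟩ | ⟨-, h1, h2⟩
  · cases m with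
    | zero => exact h.elim
    | succ m =>
      obtain ⟨s, j', i', ins, g1, g2, g3, g4, g5, -⟩ := h.2 x w (Ext.refl p w) rfl rfl hI.good
      rw [g1, Z.translate_getElem?_some g3 g2, g4] at hj
      obtain rfl := Option.some.inj hj
      rw [g1, show (s * 89 + j') / 89 = s by omega, g3] at hi
      obtain rfl := Option.some.inj hi
      exact g5 a ha
  · rw [h2, Z.translate_getElem?_some h1 (by norm_num),
      blockCode_suffix _ _ _ _ _ (by norm_num) (I := jto Z.hv 3) rfl] at hj
    obtain rfl := Option.some.inj hj
    simp [jto, PInstr.address, Instr.address] at ha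
  · rw [h1, Nat.mul_div_cancel _ (by norm_num), h2] at hi
    simp at hi

end Setup

end PPM

theorem mainTheorem1 :
    ∃ k : ℕ, ∀ (Op : Type) (interp : Op → ℕ → ℕ → ℕ) (v ctx n : ℕ), k ≤ v →
      ∃ S : PPM.Simulator Op v n, S.blockLen ≤ k ∧
        ∀ (A : PPM.SrcProgram Op n) (m₀ : ℕ → ℕ),
          S.Simulates interp ctx A m₀ ∧
          S.ComputationDelay interp ctx A m₀ k ∧
          S.PreservesLocality interp ctx A m₀ ∧
          S.RecoveryDelay interp ctx A m₀ k := by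
  -- The counters are at most 90, and completion needs one step more than the counter. This also
  -- exceeds the block length 89 and the 16 registers used.
  refine ⟨91, fun Op interp v ctx n hv => ⟨PPM.sim Op (by omega) n, ?_, fun A m₀ => ?_⟩⟩
  · show 89 ≤ 91
    norm_num
  let Z : PPM.Setup := ⟨Op, interp, v, ctx, n, by omega, A, m₀⟩
  exact ⟨Z.simulates, Z.computationDelay (by norm_num), Z.preservesLocality,
    Z.recoveryDelay (by norm_num)⟩
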